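/- **Arrowhead Lemma.** *Notation.* Put $\alpha=\sqrt2$, $\beta=\sqrt2-1$, $\omega=\sqrt2+1$ and $\mathbf u_m=(\cos\frac{m\pi}4,\sin\frac{m\pi}4)$. Let $\mathtt T_{\mathbf d}$ be the translation by $\mathbf d$, $\mathtt R_m$ the rotation about the origin by $m\pi/4$, and $\mathtt U_m$ the reflection about the line through the origin spanned by $\mathbf u_m$ ($m$ may be a half-integer). Write $[(m_1,\dots,m_n),(b_1,\dots,b_n)]$ for the open polygon $\{p:\mathbf u_{m_i}\cdot p<b_i,\ i=1,\dots,n\}$, and let $Q_1(a)=[(6,1,3),(a,0,0)]$, $Q_3(a)=[(6,7,2,3),(a,a,a,a)]$, $Q_4(a,b)=[(6,1,2,3),(a,0,-b,0)]$, $Q_5(a)=[(0,1,\dots,7),(a,\dots,a)]$, $Q_7(a)=[(5,7,0,2),(0,a,a,0)]$, $Q_8(a,b)=[(4,5,7,0,1,2),(0,0,a,b,b,a)]$, $Q_{13}(a,b)=[(5,6,0,2),(0,b,a,0)]$. The span of a set of tiles is the interior of the closure of their union. *Arrowhead.* Let $l>0$ and $0<h<l$. The atoms of the arrowhead $\widehat{\mathcal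 A}(l,h)$ are the following. In all cases $$A_1=\mathtt T_{(-\alpha(l-h),0)}\mathtt R_2Q_1(\omega(l-h)).$$ If $h/l<\beta$, then $$A_2=\mathtt T_{(-\beta(l-h),\,l-h)}\mathtt R_5Q_{13}(\alpha(l-h),2h),\qquad A_3=\mathtt T_{(-\alpha l,\,\alpha h)}\mathtt R_4Q_1(l-\omega h).$$ If $h/l\ge\beta$, then $A_2=\mathtt T_{(-\alpha(l-h),0)}\mathtt R_4Q_1(l-h)$ and there is no $A_3$ (put $A_3=\emptyset$). Let $\mathrm A$ be the span of the atoms. The domain map $\rho$ is $\mathtt R_5$ on $A_1$ and $\mathtt T_{(2l,2l)}\mathtt R_1$ on $A_3$, and is left undefined elsewhere. The exit tile is $A_2$ and the entrance tile is $A_2^{-1}=\mathtt U_{5/2}A_2$. The transfer map $\psi$ sends a point of $A_2^{-1}$ whose $\rho$-orbit visits only $A_1$ and $A_3$ until it enters $A_2$ to that point of $A_2$. Its path is the word of the indices of the atoms visited before reaching $A_2$. The tiles of the partition of $A_2^{-1}$ by $\psi$ are the non-empty sets of all points with a given path. *Strip.* Let $J=J(l,h)=\lceil\log_\beta(h/l)\rceil$,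 so that $J=k$ for $h/l\in[\beta^k,\beta^{k-1})$. For $h/l<\beta$ (that is, $J\ge2$) the strip $\widehat{\mathbf S}(l,h)=(S_1,\dots,S_{2J})$ is given as follows. For $1\le j\le J$, $$S_{2j-1}=\mathtt T_{(-\beta^{j-1}l,\,(-1)^{j-1}(\beta^jl-\alpha h))}\,\mathtt R_{r_j}\,P_j,$$ where $r_j=4$ for $j$ even and $r_j=0$ for $j$ odd, $P_j=Q_4(\beta^jl-\beta h,\beta^jl-\omega h)$ for $j\le J-2$, and $P_j=Q_1(\beta^jl-\beta h)$ for $j=J-1,J$. Moreover: - for $1\le j\le J-2$, $S_{2j}=\mathtt T_{(-\alpha\beta^jl,0)}\mathtt R_{m}Q_3(h)$ with $m=0$ ($j$ even) or $m=7$ ($j$ odd); - $S_{2J-2}=\mathtt T_{(-\alpha\beta^{J-1}l-\beta h,\,(-1)^{J-1}h)}\mathtt R_mQ_8(\alpha\beta^{J-1}l-\alpha\beta h,\,2h)$ with $m=1$ ($J$ even) or $m=6$ ($J$ odd); - $S_{2J}=\mathtt T_{(-h,\,(-1)^{J-1}(\alpha\beta^{J-1}l-\omega h))}\mathtt R_mQ_7(\alpha\beta^{J-1}l-\alpha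 h)$ with $m=3$ ($J$ even) or $m=6$ ($J$ odd). *Claim.* For all $l>0$ and $0<h<l$ the following holds. (i) The partition of the entrance tile by $\psi$ consists of exactly $2J$ distinct tiles $E_1,\dots,E_{2J}$, whose span is the entrance tile. For $h/l\in(0,\beta)$ it is the strip $\mathtt T_{(l,l)}\widehat{\mathbf S}(l,h)$, i.e. $E_i=\mathtt T_{(l,l)}S_i$. For $h/l\in[\beta,1)$ (where $J=1$) it is $$E_1=\mathtt T_{(0,\alpha(l-h))}Q_1(\beta(l-h)),\qquad E_2=\mathtt T_{(l-h,\,\omega(l-h))}\mathtt R_6Q_7(\alpha(l-h)).$$ (ii) $\psi$ is the composition of two involutions: a simultaneous reflection of the tiles $E_i$ about their respective symmetry axes (each of these reflections maps $E_i$ to itself; for a rhombus the axis is the short diagonal), followed by $\mathtt U_{5/2}$, the reflection about the symmetry axis of $\mathrm A$. The images $\psi(E_i)$ have the exit tile as their span. (iii) For $k=1,\dots,J$, the numbers of visits of the transfer orbit of $E_j$ to $(A_1,A_3)$ are $$\mathrm N(E_{2k-1})=\begin{pmatrix}-\frac12-(-1)^k+\frac32\,3^k\\-\frac12+(-1)^k+\frac12\,3^k\end{pmatrix},\qquad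 \mathrm N(E_{2k})=\begin{pmatrix}-\frac12-\frac14(-1)^k+\frac34\,3^k\\-\frac12+\frac14(-1)^k+\frac14\,3^k\end{pmatrix}.$$ (iv) For $k=0,\dots,J-1$ let $\Pi^{(k)}=\mathtt T_{\gamma^{(k)}}Q_5(\beta^kl-h)$, where $\gamma^{(k)}=(-\alpha l(1-\beta^k),0)$ for $k$ even and $\gamma^{(k)}=(-\alpha l,\alpha\beta^kl)$ for $k$ odd. Each $\Pi^{(k)}$ is a non-empty octagon that is periodic under $\rho$ as a tile, with path $\sigma^k(1)$, where $\sigma$ is the substitution $\sigma(1)=(3,1,1)$, $\sigma(3)=(1,1,1)$, and with least period $3^k$. The tiles of the transfer orbits of $E_1,\dots,E_{2J}$ (from the entrance tile up to and including the destination tiles in $A_2$), together with the tiles of the orbits of $\Pi^{(0)},\dots,\Pi^{(J-1)}$, are pairwise disjoint, lie in $\mathrm A$, and cover $\mathrm A$ up to a set of measure zero. -/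

import Mathlib

namespace Arrowhead

/-- The plane. Only its topology, its area measure and the explicit maps below are used. -/
abbrev Plane : Type := ℝ × ℝ

noncomputable def alpha : ℝ := √2
noncomputable def beta : ℝ := √2 - 1
noncomputable def omega : ℝ := √2 + 1

/-! ### Octagonal isometries and tiles -/

/-- The unit vector `u_m = (cos (mπ/4), sin (mπ/4))`. -/
noncomputable def u (m : ℝ) : Plane :=
  (Real.cos (m * Real.pi / 4), Real.sin (m * Real.pi / 4))

/-- Translation by `d`. -/
def T (d : Plane) (p : Plane) : Plane := d + p

/-- Rotation about the origin by the angle `mπ/4`. -/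
noncomputable def R (m : ℝ) (p : Plane) : Plane :=
  (Real.cos (m * Real.pi / 4) * p.1 - Real.sin (m * Real.pi / 4) * p.2,
   Real.sin (m * Real.pi / 4) * p.1 + Real.cos (m * Real.pi / 4) * p.2)

/-- Reflection about the line through the origin spanned by `u m`
(`m` may be a half-integer); that line has polar angle `mπ/4`. -/
noncomputable def U (m : ℝ) (p : Plane) : Plane :=
  (Real.cos (m * Real.pi / 2) * p.1 + Real.sin (m * Real.pi / 2) * p.2,
   Real.sin (m * Real.pi / 2) * p.1 - Real.cos (m * Real.pi / 2) * p.2)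

/-- Reflection about the line through `c` parallel to `u m`. -/
noncomputable def reflectAt (c : Plane) (m : ℝ) (p : Plane) : Plane := c + U m (p - c)

/-- The open polygon `[(m₁, …, mₙ), (b₁, …, bₙ)]`, the solution set of `u_{mᵢ} · p < bᵢ`. -/
def polygon (edges : List (ℝ × ℝ)) : Set Plane :=
  {p | ∀ e ∈ edges, (u e.1).1 * p.1 + (u e.1).2 * p.2 < e.2}

/-- The tile `X` rotated by `R m` and then translated by `d`. -/
def place (d : Plane) (m : ℝ) (X : Set Plane) : Set Plane := (T d ∘ R m) '' X

/-- Interior of the closure of the union of a family of tiles. -/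
def tileSpan (𝒳 : Set (Set Plane)) : Set Plane := interior (closure (⋃₀ 𝒳))

def Q1 (a : ℝ) : Set Plane := polygon [(6, a), (1, 0), (3, 0)]
def Q3 (a : ℝ) : Set Plane := polygon [(6, a), (7, a), (2, a), (3, a)]
def Q4 (a b : ℝ) : Set Plane := polygon [(6, a), (1, 0), (2, -b), (3, 0)]
def Q5 (a : ℝ) : Set Plane :=
  polygon [(0, a), (1, a), (2, a), (3, a), (4, a), (5, a), (6, a), (7, a)]
def Q7 (a : ℝ) : Set Plane := polygon [(5, 0), (7, a), (0, a), (2, 0)]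
def Q8 (a b : ℝ) : Set Plane := polygon [(4, 0), (5, 0), (7, a), (0, b), (1, b), (2, a)]
def Q13 (a b : ℝ) : Set Plane := polygon [(5, 0), (6, b), (0, a), (2, 0)]

/-! ### The arrowhead -/

open Classical in
/-- The atoms `A₁, A₂, A₃` of the arrowhead `Â(l, h)`, indexed by `1, 2, 3`.
There is no third atom when `β ≤ h / l`. -/
noncomputable def atom (l h : ℝ) (i : ℕ) : Set Plane :=
  if i = 1 then place (-alpha * (l - h), 0) 2 (Q1 (omega * (l - h)))
  else if i = 2 then
    if h / l < beta then place (-beta * (l - h), l - h) 5 (Q13 (alpha * (l - h)) (2 * h))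
    else place (-alpha * (l - h), 0) 4 (Q1 (l - h))
  else if i = 3 ∧ h / l < beta then place (-alpha * l, alpha * h) 4 (Q1 (l - omega * h))
  else ∅

/-- The arrowhead polygon `A`, the span of its atoms. -/
noncomputable def domain (l h : ℝ) : Set Plane :=
  tileSpan {atom l h 1, atom l h 2, atom l h 3}

/-- The exit tile `A₂`. -/
noncomputable def exitTile (l h : ℝ) : Set Plane := atom l h 2

/-- The entrance tile `A₂⁻¹`, the reflection of the exit tile in the line along `u_{5/2}`. -/
noncomputable def entranceTile (l h : ℝ) : Set Plane := U (5 / 2) '' exitTile l h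

open Classical in
/-- The domain map: `R₅` on `A₁` and `T_{(2l,2l)} R₁` on `A₃`. It is undefined elsewhere; the
placeholder value given there is never used, since every orbit considered below is required to
stay in `A₁ ∪ A₃` until its last point. -/
noncomputable def rho (l h : ℝ) (p : Plane) : Plane :=
  if p ∈ atom l h 1 then R 5 p
  else if p ∈ atom l h 3 then T (2 * l, 2 * l) (R 1 p)
  else p

/-- The point `p` visits successively the atoms listed in the word `w` (first letter first). -/
def Follows (l h : ℝ) (w : List ℕ) (p : Plane) : Prop :=
  ∀ i : Fin w.length, (rho l h)^[i] p ∈ atom l h (w.get i)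

/-- `p` starts in the entrance tile, then visits `A₁` and `A₃` in the order given by the word `w`
in the letters `1, 3`, and is then in the exit tile. -/
def IsTransferPath (l h : ℝ) (w : List ℕ) (p : Plane) : Prop :=
  p ∈ entranceTile l h ∧ (∀ a ∈ w, a = 1 ∨ a = 3) ∧ Follows l h w p ∧
    (rho l h)^[w.length] p ∈ exitTile l h

/-- The tiles into which the transfer map partitions the entrance tile: the non-empty sets of all
points with a given transfer path. -/
def transferPartition (l h : ℝ) : Set (Set Plane) :=
  {S | S.Nonempty ∧ ∃ w : List ℕ, S = {p | IsTransferPath l h w p}}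

/-- The number of iterations of the domain map that carries a point of the entrance tile to the
exit tile along a transfer path (unique if it exists, the atoms being disjoint). -/
noncomputable def transferTime (l h : ℝ) (p : Plane) : ℕ :=
  sInf {n | ∃ w : List ℕ, w.length = n ∧ IsTransferPath l h w p}

/-- The transfer map `ψ`. -/
noncomputable def psi (l h : ℝ) (p : Plane) : Plane := (rho l h)^[transferTime l h p] p

/-- How often the transfer orbit of `p` visits the atom `Aᵢ`. -/
noncomputable def visits (l h : ℝ) (i : ℕ) (p : Plane) : ℕ :=
  {t : ℕ | t < transferTime l h p ∧ (rho l h)^[t] p ∈ atom l h i}.ncard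

/-! ### The strip -/

/-- `J(l, h) = ⌈log_β (h / l)⌉`, that is, `J = k` for `h / l ∈ [β ^ k, β ^ (k - 1))`. -/
noncomputable def J (l h : ℝ) : ℕ := ⌈Real.logb beta (h / l)⌉₊

/-- The tile `S_{2j-1}` of the strip, `1 ≤ j ≤ J`: a trapezium for `j ≤ J - 2`, and a triangle
for `j = J - 1, J`. -/
noncomputable def stripOdd (l h : ℝ) (j : ℕ) : Set Plane :=
  place (-beta ^ (j - 1) * l, (-1) ^ (j - 1) * (beta ^ j * l - alpha * h))
    (if Even j then 4 else 0)
    (if j + 2 ≤ J l h then Q4 (beta ^ j * l - beta * h) (beta ^ j * l - omega * h)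
      else Q1 (beta ^ j * l - beta * h))

/-- The tile `S_{2j}` of the strip, `1 ≤ j ≤ J`: a rhombus for `j ≤ J - 2`, a hexagon for
`j = J - 1`, and a kite for `j = J`. -/
noncomputable def stripEven (l h : ℝ) (j : ℕ) : Set Plane :=
  if j + 2 ≤ J l h then
    place (-alpha * beta ^ j * l, 0) (if Even j then 0 else 7) (Q3 h)
  else if j + 1 = J l h then
    place (-alpha * beta ^ j * l - beta * h, (-1) ^ j * h) (if Even j then 6 else 1)
      (Q8 (alpha * beta ^ j * l - alpha * beta * h) (2 * h))
  else
    place (-h, (-1) ^ (j - 1) * (alpha * beta ^ (j - 1) * l - omega * h))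
      (if Even j then 3 else 6) (Q7 (alpha * beta ^ (j - 1) * l - alpha * h))

/-- The prototype strip `Ŝ(l, h) = (S₁, …, S_{2J})`. -/
noncomputable def strip (l h : ℝ) (i : ℕ) : Set Plane :=
  if i % 2 = 1 then stripOdd l h ((i + 1) / 2) else stripEven l h (i / 2)

open Classical in
/-- The tiles `E₁, …, E_{2J}`: the strip translated by `(l, l)` when `h / l < β`, and two explicit
tiles (a triangle and a kite) when `β ≤ h / l`. -/
noncomputable def E (l h : ℝ) (i : ℕ) : Set Plane :=
  if h / l < beta then T (l, l) '' strip l h i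
  else if i = 1 then place (0, alpha * (l - h)) 0 (Q1 (beta * (l - h)))
  else place (l - h, omega * (l - h)) 6 (Q7 (alpha * (l - h)))

/-- The line through `c` parallel to `u m` is the relevant symmetry axis of the tile `S`: the
reflection about it preserves `S` and, if `S` is a rhombus `T_d R_n Q₃(r)`, it is the short diagonal
of that rhombus. (`Q₃(r)` has vertices `± r (ω, 1)` and `± r (-β, 1)`, so its short diagonal is
centred at the origin and parallel to `u_{5/2}`.) -/
def IsTileAxis (S : Set Plane) (c : Plane) (m : ℝ) : Prop :=
  reflectAt c m '' S = S ∧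
    ∀ (r : ℝ) (d : Plane) (n : ℤ), 0 < r → S = place d n (Q3 r) →
      reflectAt c m = reflectAt d (n + 5 / 2)

/-! ### Periodic octagons -/

/-- The octagon `Π^{(k)} = T_{γ^{(k)}} Q₅(β^k l - h)`. -/
noncomputable def octagon (l h : ℝ) (k : ℕ) : Set Plane :=
  T (if Even k then (-alpha * l * (1 - beta ^ k), 0) else (-alpha * l, alpha * beta ^ k * l)) ''
    Q5 (beta ^ k * l - h)

/-- The substitution `σ(1) = (3, 1, 1)`, `σ(3) = (1, 1, 1)` on words in the letters `1, 3`. -/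
def sigma (w : List ℕ) : List ℕ := w.flatMap fun a => if a = 1 then [3, 1, 1] else [1, 1, 1]

/-- The word `σ^k(1)`. -/
def sigmaPow (k : ℕ) : List ℕ := sigma^[k] [1]

/-- Images of tiles under the domain map: `inl (j, t)` stands for `ρ^t (E_j)` and `inr (k, t)`
for `ρ^t (Π^{(k)})`. -/
noncomputable def orbitTile (l h : ℝ) : (ℕ × ℕ) ⊕ (ℕ × ℕ) → Set Plane
  | Sum.inl (j, t) => (rho l h)^[t] '' E l h j
  | Sum.inr (k, t) => (rho l h)^[t] '' octagon l h k

/-- The indices of the transfer orbits of `E₁, …, E_{2J}`, destination tiles included, and of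
one full period of each of the octagons `Π^{(0)}, …, Π^{(J-1)}`. -/
def orbitIndex (l h : ℝ) : Set ((ℕ × ℕ) ⊕ (ℕ × ℕ)) :=
  {a | (∃ j t, a = Sum.inl (j, t) ∧ 1 ≤ j ∧ j ≤ 2 * J l h ∧
          ∃ p ∈ E l h j, t ≤ transferTime l h p) ∨
       (∃ k t, a = Sum.inr (k, t) ∧ k < J l h ∧ t < 3 ^ k)}

end Arrowhead

open Arrowhead

set_option linter.unusedSimpArgs false

namespace Arrowhead

/-! The functionals `nu k` turn the geometry into linear arithmetic: every octagonal isometry shifts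
or reflects the index and adds a constant, and √2 · `nu k` = `nu (k-1)` + `nu (k+1)`. With a = l -
h, the atom A₁ is `nu` < a in the directions 0, 3, 5. The entrance and exit tiles and A₃ are similar
short systems, the same for all values of h / l.

The engine is renormalization from `beta * l` to `l` with h fixed. The isometry `Phi` carries one
step of the small system to three steps of the large one, with path 3, 1, 1 over A₁ and 1, 1, 1 over
A₃ (`reach_Phi_one`, `reach_Phi_three`); this is the substitution `sigma` (`reach_sigma`). The
isometry `Psi` maps the small entrance tile into the large one, and two steps later its image is the
image under `Phi`. Hence E_{j+2} is the `Psi`-image of the small E_j (`E_add_two`), its path is 1, 1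
followed by `sigma` of the old path, and `octagon_succ` gives the octagons in the same way. Only E₁,
E₂ and the central octagon, on which the map is a rotation, need direct study. Since `Phi` ∘ U = U ∘
`Psi` for the reversing reflection U = `U (5 / 2)`, the form "reflect the tile, then apply U"
survives renormalization (`transferTile_E`). As `J` drops by one each time, everything is an
induction with base case `beta * l ≤ h`.

Completeness uses the same induction. The entrance tile is cut by two lines into E₁, E₂ and a copy
of the small entrance tile (`entranceTile_subset`). The atom A₁ is filled by the central octagon and
by rotated copies of regions that are either E₁, E₂ or come from the small arrowhead
(`atom_one_subset_step`). Covering is proved up to closure; tiles are open convex polygons, so each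
equals the interior of its closure and has null boundary, which upgrades density to exact tiles and
full measure.

Disjointness comes from determinism: the map is injective on A₁ ∪ A₃ and its values miss the
entrance tile, so transfer orbits can be run backwards. Octagon orbits never reach the exit tile,
and their itineraries have least period 3^k, because the number of letters 1 in σ^k(1) is prime to 3
(`dvd_of_periodic`). -/

/-! ### Linear functionals in the octagonal directions as coordinates -/

/-- The linear functional `p ↦ u_m · p`. -/
noncomputable def nu (m : ℝ) (p : Plane) : ℝ := (u m).1 * p.1 + (u m).2 * p.2

theorem nu_add_vec (m : ℝ) (p q : Plane) : nu m (p + q) = nu m p + nu m q := by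
  simp [nu]; ring

theorem nu_sub_vec (m : ℝ) (p q : Plane) : nu m (p - q) = nu m p - nu m q := by
  simp [nu]; ring

theorem nu_smul (m t : ℝ) (p : Plane) : nu m (t • p) = t * nu m p := by
  simp [nu]; ring

theorem nu_T (m : ℝ) (d p : Plane) : nu m (T d p) = nu m d + nu m p := nu_add_vec m d p

theorem nu_R (k m : ℝ) (p : Plane) : nu k (R m p) = nu (k - m) p := by
  have h : (k - m) * Real.pi / 4 = k * Real.pi / 4 - m * Real.pi / 4 := by ring
  simp only [nu, u, R, h, Real.cos_sub, Real.sin_sub]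
  ring

theorem nu_U (k m : ℝ) (p : Plane) : nu k (U m p) = nu (2 * m - k) p := by
  have h : (2 * m - k) * Real.pi / 4 = m * Real.pi / 2 - k * Real.pi / 4 := by ring
  simp only [nu, u, U, h, Real.cos_sub, Real.sin_sub]
  ring

theorem nu_reflectAt (k m : ℝ) (c p : Plane) :
    nu k (reflectAt c m p) = nu k c + nu (2 * m - k) p - nu (2 * m - k) c := by
  rw [reflectAt, nu_add_vec, nu_U, nu_sub_vec]; ring

theorem nu_add_four (k : ℝ) (p : Plane) : nu (k + 4) p = -nu k p := by
  have h : (k + 4) * Real.pi / 4 = k * Real.pi / 4 + Real.pi := by ring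
  simp only [nu, u, h, Real.cos_add_pi, Real.sin_add_pi]
  ring

theorem nu_neg (k : ℝ) (p : Plane) : nu (-k) p = -nu (4 - k) p := by
  rw [← nu_add_four, show 4 - k + 4 = -k + 4 + 4 by ring, nu_add_four, nu_add_four, neg_neg]

theorem nu_add_eight (k : ℝ) (p : Plane) : nu (k + 8) p = nu k p := by
  rw [show k + 8 = k + 4 + 4 by ring, nu_add_four, nu_add_four, neg_neg]

theorem nu_add_eight_mul_int (k : ℝ) (z : ℤ) (p : Plane) : nu (k + 8 * z) p = nu k p := by
  have h : (k + 8 * z) * Real.pi / 4 = k * Real.pi / 4 + z * (2 * Real.pi) := by ring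
  simp only [nu, u, h, Real.cos_add_int_mul_two_pi, Real.sin_add_int_mul_two_pi]

theorem sqrt_two_mul_self : √2 * √2 = (2 : ℝ) := Real.mul_self_sqrt (by norm_num)

theorem nu_zero (p : Plane) : nu 0 p = p.1 := by simp [nu, u]

theorem nu_two (p : Plane) : nu 2 p = p.2 := by
  simp [nu, u, show (2 : ℝ) * Real.pi / 4 = Real.pi / 2 by ring]

/-- Any functional is determined by the two neighbouring ones. -/
theorem nu_sub_one_add_nu_add_one (k : ℝ) (p : Plane) :
    nu (k - 1) p + nu (k + 1) p = √2 * nu k p := by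
  have h₁ : (k - 1) * Real.pi / 4 = k * Real.pi / 4 - Real.pi / 4 := by ring
  have h₂ : (k + 1) * Real.pi / 4 = k * Real.pi / 4 + Real.pi / 4 := by ring
  simp only [nu, u, h₁, h₂, Real.cos_sub, Real.sin_sub, Real.cos_add, Real.sin_add,
    Real.cos_pi_div_four, Real.sin_pi_div_four]
  ring

theorem sqrt_two_mul_nu_one (p : Plane) : √2 * nu 1 p = nu 0 p + nu 2 p := by
  have := nu_sub_one_add_nu_add_one 1 p
  norm_num at this; linarith

theorem sqrt_two_mul_nu_two (p : Plane) : √2 * nu 2 p = nu 1 p + nu 3 p := by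
  have := nu_sub_one_add_nu_add_one 2 p
  norm_num at this; linarith

theorem nu_four (p : Plane) : nu 4 p = -nu 0 p := by rw [← nu_add_four]; norm_num
theorem nu_five (p : Plane) : nu 5 p = -nu 1 p := by rw [← nu_add_four]; norm_num
theorem nu_six (p : Plane) : nu 6 p = -nu 2 p := by rw [← nu_add_four]; norm_num
theorem nu_seven (p : Plane) : nu 7 p = -nu 3 p := by rw [← nu_add_four]; norm_num
theorem nu_eight (p : Plane) : nu 8 p = nu 0 p := by rw [← nu_add_eight 0]; norm_num
theorem nu_nine (p : Plane) : nu 9 p = nu 1 p := by rw [← nu_add_eight 1]; norm_num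
theorem nu_ten (p : Plane) : nu 10 p = nu 2 p := by rw [← nu_add_eight 2]; norm_num
theorem nu_eleven (p : Plane) : nu 11 p = nu 3 p := by rw [← nu_add_eight 3]; norm_num
theorem nu_twelve (p : Plane) : nu 12 p = -nu 0 p := by
  rw [show (12 : ℝ) = 4 + 8 by norm_num, nu_add_eight, nu_four]
theorem nu_thirteen (p : Plane) : nu 13 p = -nu 1 p := by
  rw [show (13 : ℝ) = 5 + 8 by norm_num, nu_add_eight, nu_five]
theorem nu_fourteen (p : Plane) : nu 14 p = -nu 2 p := by
  rw [show (14 : ℝ) = 6 + 8 by norm_num, nu_add_eight, nu_six]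

theorem sqrt_two_mul_nu_three (p : Plane) : √2 * nu 3 p = nu 2 p - nu 0 p := by
  have := nu_sub_one_add_nu_add_one 3 p
  norm_num [nu_four] at this; linarith

theorem sqrt_two_mul_nu_zero (p : Plane) : √2 * nu 0 p = nu 1 p - nu 3 p := by
  have := nu_sub_one_add_nu_add_one 0 p
  norm_num [nu_neg] at this; linarith

theorem plane_ext {p q : Plane} (h₀ : nu 0 p = nu 0 q) (h₂ : nu 2 p = nu 2 q) : p = q := by
  rw [nu_zero, nu_zero] at h₀
  rw [nu_two, nu_two] at h₂
  exact Prod.ext h₀ h₂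

theorem plane_ext' {p q : Plane} (h : ∀ k : ℝ, nu k p = nu k q) : p = q :=
  plane_ext (h 0) (h 2)

theorem R_R (k m : ℝ) (p : Plane) : R k (R m p) = R (k + m) p :=
  plane_ext' fun j => by rw [nu_R, nu_R, nu_R]; congr 1; ring

theorem R_zero (p : Plane) : R 0 p = p := plane_ext' fun j => by rw [nu_R, sub_zero]

theorem R_add_eight (m : ℝ) (p : Plane) : R (m + 8) p = R m p :=
  plane_ext' fun j => by
    rw [nu_R, nu_R, ← nu_add_eight (j - (m + 8))]; congr 1; ring

theorem U_U (m : ℝ) (p : Plane) : U m (U m p) = p :=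
  plane_ext' fun j => by rw [nu_U, nu_U]; congr 1; ring

theorem continuous_nu (k : ℝ) : Continuous (nu k) := by unfold nu; fun_prop
theorem continuous_R (m : ℝ) : Continuous (R m) := by unfold R; fun_prop
theorem continuous_U (m : ℝ) : Continuous (U m) := by unfold U; fun_prop
theorem continuous_T (d : Plane) : Continuous (T d) := by unfold T; fun_prop

/-! ### Images of polygons -/

theorem mem_polygon {es : List (ℝ × ℝ)} {p : Plane} :
    p ∈ polygon es ↔ ∀ e ∈ es, nu e.1 p < e.2 := Iff.rfl

theorem mem_place_polygon {d : Plane} {m : ℝ} {es : List (ℝ × ℝ)} {p : Plane} :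
    p ∈ place d m (polygon es) ↔ ∀ e ∈ es, nu (m + e.1) p < nu (m + e.1) d + e.2 := by
  constructor
  · rintro ⟨q, hq, rfl⟩ e he
    have := mem_polygon.1 hq e he
    rw [Function.comp_apply, nu_T, nu_R, add_sub_cancel_left]
    linarith
  · intro hp
    refine ⟨R (-m) (p - d), fun e he => ?_, ?_⟩
    · change nu e.1 _ < _
      rw [nu_R, nu_sub_vec, show e.1 - -m = m + e.1 by ring]
      linarith [hp e he]
    · rw [Function.comp_apply, R_R, add_neg_cancel, R_zero, T]; abel

/-- A set is polygonal if it is an (open, convex, possibly empty) polygon. -/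
def IsPolygonal (S : Set Plane) : Prop := ∃ es, S = polygon es

/-- Pulling back along the inverse only renames the direction of each half-plane and shifts its
bound, so the edge list can be rewritten entry by entry. -/
theorem isPolygonal_image_of_nu {S : Set Plane} (hS : IsPolygonal S) (f g : Plane → Plane)
    (fg : Function.RightInverse g f) (gf : Function.LeftInverse g f) (φ : ℝ → ℝ) (c : ℝ → ℝ)
    (hg : ∀ k p, nu k (g p) = nu (φ k) p + c k) : IsPolygonal (f '' S) := by
  obtain ⟨es, rfl⟩ := hS
  refine ⟨es.map fun e => (φ e.1, e.2 - c e.1), ?_⟩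
  rw [Set.image_eq_preimage_of_inverse gf fg]
  ext p
  simp only [Set.mem_preimage, mem_polygon, List.forall_mem_map, hg, lt_sub_iff_add_lt]

theorem IsPolygonal.image_T {S : Set Plane} (hS : IsPolygonal S) (d : Plane) :
    IsPolygonal (T d '' S) :=
  isPolygonal_image_of_nu hS _ (T (-d)) (fun p => by simp [T]) (fun p => by simp [T])
    id (fun k => nu k (-d)) fun k p => by rw [nu_T, id, add_comm]

theorem IsPolygonal.image_R {S : Set Plane} (hS : IsPolygonal S) (m : ℝ) :
    IsPolygonal (R m '' S) :=
  isPolygonal_image_of_nu hS _ (R (-m)) (fun p => by simp [R_R, R_zero])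
    (fun p => by simp [R_R, R_zero]) (fun k => k - -m) (fun _ => 0) fun k p => by rw [nu_R, add_zero]

theorem IsPolygonal.image_U {S : Set Plane} (hS : IsPolygonal S) (m : ℝ) :
    IsPolygonal (U m '' S) :=
  isPolygonal_image_of_nu hS _ (U m) (U_U m) (U_U m) (fun k => 2 * m - k) (fun _ => 0)
    fun k p => by rw [nu_U, add_zero]

theorem isPolygonal_polygon (es : List (ℝ × ℝ)) : IsPolygonal (polygon es) := ⟨es, rfl⟩

theorem IsPolygonal.place {S : Set Plane} (hS : IsPolygonal S) (d : Plane) (m : ℝ) :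
    IsPolygonal (place d m S) := by
  rw [Arrowhead.place, Set.image_comp]
  exact (hS.image_R m).image_T d

theorem polygon_cons (e : ℝ × ℝ) (es : List (ℝ × ℝ)) :
    polygon (e :: es) = {p | nu e.1 p < e.2} ∩ polygon es := by
  ext p; simp [mem_polygon]

theorem IsPolygonal.isOpen {S : Set Plane} (hS : IsPolygonal S) : IsOpen S := by
  obtain ⟨es, rfl⟩ := hS
  induction es with
  | nil => simp [polygon]
  | cons e es ih =>
    rw [polygon_cons]
    exact (isOpen_lt (continuous_nu _) continuous_const).inter ih

theorem IsPolygonal.convex {S : Set Plane} (hS : IsPolygonal S) : Convex ℝ S := by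
  obtain ⟨es, rfl⟩ := hS
  induction es with
  | nil => simpa [polygon] using convex_univ
  | cons e es ih =>
    rw [polygon_cons]
    refine Convex.inter (convex_halfSpace_lt ⟨nu_add_vec _, fun t p => ?_⟩ _) ih
    rw [nu_smul, smul_eq_mul]

/-- Openness and convexity give this. It is the tool that turns inclusions up to closure into exact
equalities of tiles and spans. -/
theorem IsPolygonal.interior_closure {S : Set Plane} (hS : IsPolygonal S) :
    interior (closure S) = S := by
  rcases S.eq_empty_or_nonempty with rfl | hne
  · simp
  · rw [hS.convex.interior_closure_eq_interior_of_nonempty_interior, hS.isOpen.interior_eq]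
    rwa [hS.isOpen.interior_eq]

theorem IsPolygonal.volume_frontier {S : Set Plane} (hS : IsPolygonal S) :
    MeasureTheory.volume (frontier S) = 0 :=
  hS.convex.addHaar_frontier _

/-- The points of the segment from `p` towards the interior point `q` satisfy every inequality
strictly. The point `q` is indispensable: weak inequalities may be solvable when the strict ones are
not. -/
theorem mem_closure_polygon {es : List (ℝ × ℝ)} {p q : Plane} (hq : q ∈ polygon es)
    (hp : ∀ e ∈ es, nu e.1 p ≤ e.2) : p ∈ closure (polygon es) := by
  have h : ∀ t ∈ Set.Ioi (0 : ℝ) ∩ Set.Iio 1, p + t • (q - p) ∈ polygon es := by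
    rintro t ⟨h0, h1⟩ e he
    change nu _ _ < _
    rw [nu_add_vec, nu_smul, nu_sub_vec]
    have h2 := hp e he
    have h3 := mem_polygon.1 hq e he
    simp only [Set.mem_Ioi, Set.mem_Iio] at h0 h1
    nlinarith
  have hc : Filter.Tendsto (fun t : ℝ => p + t • (q - p)) (nhdsWithin 0 (Set.Ioi 0)) (nhds p) := by
    have : Continuous fun t : ℝ => p + t • (q - p) := by fun_prop
    have h' := this.tendsto 0
    simp only [zero_smul, add_zero] at h'
    exact h'.mono_left nhdsWithin_le_nhds
  refine mem_closure_of_tendsto hc ?_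
  filter_upwards [Ioo_mem_nhdsGT (zero_lt_one : (0 : ℝ) < 1)] with t ht
  exact h t ⟨ht.1, ht.2⟩

theorem nu_le_of_mem_closure {S : Set Plane} {k b : ℝ} (h : ∀ p ∈ S, nu k p < b) {p : Plane}
    (hp : p ∈ closure S) : nu k p ≤ b :=
  closure_minimal (fun q hq => (h q hq).le) (isClosed_le (continuous_nu k) continuous_const) hp

theorem nu_one_mk (x y : ℝ) : nu 1 (x, y) = √2 / 2 * (x + y) := by
  simp [nu, u]; ring

theorem nu_three_mk (x y : ℝ) : nu 3 (x, y) = √2 / 2 * (y - x) := by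
  have := sqrt_two_mul_nu_three (x, y)
  rw [nu_two, nu_zero] at this
  have h := sqrt_two_mul_self
  linear_combination √2 / 2 * this - nu 3 (x, y) / 2 * h

theorem nu_mk (x y : ℝ) : nu 0 (x, y) = x ∧ nu 1 (x, y) = √2 / 2 * (x + y) ∧
    nu 2 (x, y) = y ∧ nu 3 (x, y) = √2 / 2 * (y - x) :=
  ⟨nu_zero _, nu_one_mk x y, nu_two _, nu_three_mk x y⟩

/-- Reduction of the functionals to `nu 0, …, nu 3`. -/
theorem nu_reduce (p : Plane) : nu 4 p = -nu 0 p ∧ nu 5 p = -nu 1 p ∧ nu 6 p = -nu 2 p ∧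
    nu 7 p = -nu 3 p ∧ nu 8 p = nu 0 p ∧ nu 9 p = nu 1 p ∧ nu 10 p = nu 2 p ∧ nu 11 p = nu 3 p ∧
    nu 12 p = -nu 0 p ∧ nu 13 p = -nu 1 p ∧ nu 14 p = -nu 2 p :=
  ⟨nu_four p, nu_five p, nu_six p, nu_seven p, nu_eight p, nu_nine p, nu_ten p, nu_eleven p,
    nu_twelve p, nu_thirteen p, nu_fourteen p⟩

/-! ### Atoms and entrance tile as systems of linear inequalities -/

theorem sqrt_two_gt : (7 / 5 : ℝ) < √2 := Real.lt_sqrt_of_sq_lt (by norm_num)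
theorem sqrt_two_lt : √2 < (17 / 12 : ℝ) := (Real.sqrt_lt' (by norm_num)).2 (by norm_num)

/-- Supplies the relations that let `linarith` treat `l` and `√2 * l` as independent unknowns. -/
theorem sqrt_two_powers (l : ℝ) :
    √2 * √2 * l = 2 * l ∧ √2 * √2 * √2 * l = 2 * (√2 * l) ∧ √2 * √2 * √2 * √2 * l = 4 * l := by
  have h := sqrt_two_mul_self
  refine ⟨by rw [h], by rw [h]; ring, ?_⟩
  rw [h, mul_assoc 2, h]; ring

theorem mem_atom_one {l h : ℝ} {p : Plane} :
    p ∈ atom l h 1 ↔ nu 0 p < l - h ∧ nu 3 p < l - h ∧ -nu 1 p < l - h := by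
  have ⟨l2, l3, l4⟩ := sqrt_two_powers l
  have ⟨h2, h3, h4⟩ := sqrt_two_powers h
  rw [atom, if_pos rfl, Q1, mem_place_polygon]
  simp only [List.forall_mem_cons, List.not_mem_nil, false_imp_iff, implies_true, and_true]
  norm_num1
  simp only [nu_reduce, nu_mk, alpha, beta, omega]
  constructor
  · rintro ⟨i1, i2, i3⟩; refine ⟨?_, ?_, ?_⟩ <;> linarith
  · rintro ⟨i1, i2, i3⟩; refine ⟨?_, ?_, ?_⟩ <;> linarith

theorem atom_two_of_lt {l h : ℝ} (hb : h < beta * l) (hl : 0 < l) {p : Plane} :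
    p ∈ atom l h 2 ↔ nu 2 p < l - h ∧ l - h < nu 3 p ∧ -nu 1 p < l - h ∧ nu 3 p < l + h := by
  have ⟨l2, l3, l4⟩ := sqrt_two_powers l
  have ⟨h2, h3, h4⟩ := sqrt_two_powers h
  rw [atom, if_neg (by norm_num), if_pos rfl, if_pos (by rwa [div_lt_iff₀ hl]), Q13,
    mem_place_polygon]
  simp only [List.forall_mem_cons, List.not_mem_nil, false_imp_iff, implies_true, and_true]
  norm_num1
  simp only [nu_reduce, nu_mk, alpha, beta, omega]
  constructor
  · rintro ⟨i1, i2, i3, i4⟩; refine ⟨?_, ?_, ?_, ?_⟩ <;> linarith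
  · rintro ⟨i1, i2, i3, i4⟩; refine ⟨?_, ?_, ?_, ?_⟩ <;> linarith

theorem atom_two_of_ge {l h : ℝ} (hb : beta * l ≤ h) (hl : 0 < l) {p : Plane} :
    p ∈ atom l h 2 ↔ nu 2 p < l - h ∧ l - h < nu 3 p ∧ -nu 1 p < l - h := by
  have ⟨l2, l3, l4⟩ := sqrt_two_powers l
  have ⟨h2, h3, h4⟩ := sqrt_two_powers h
  rw [atom, if_neg (by norm_num), if_pos rfl, if_neg (by rwa [div_lt_iff₀ hl, not_lt]), Q1,
    mem_place_polygon]
  simp only [List.forall_mem_cons, List.not_mem_nil, false_imp_iff, implies_true, and_true]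
  norm_num1
  simp only [nu_reduce, nu_mk, alpha, beta, omega]
  constructor
  · rintro ⟨i1, i2, i3⟩; refine ⟨?_, ?_, ?_⟩ <;> linarith
  · rintro ⟨i1, i2, i3⟩; refine ⟨?_, ?_, ?_⟩ <;> linarith

/-- From `nu 3` = √2 · `nu 2` - `nu 1`; the bound is the value at the apex of the corner. -/
theorem nu_three_lt_of_corner {b : ℝ} {p : Plane} (h₂ : nu 2 p < b) (h₁ : -nu 1 p < b) :
    nu 3 p < (√2 + 1) * b := by
  have := sqrt_two_mul_nu_two p
  nlinarith [sqrt_two_gt]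

/-- One system serves both shapes: ω(l - h) ≤ l + h is equivalent to h ≥ β l, so for large h the
last inequality follows from the corner bound and the quadrilateral becomes the triangle. -/
theorem mem_atom_two {l h : ℝ} (hl : 0 < l) {p : Plane} :
    p ∈ atom l h 2 ↔ nu 2 p < l - h ∧ l - h < nu 3 p ∧ -nu 1 p < l - h ∧ nu 3 p < l + h := by
  rcases lt_or_ge h (beta * l) with hb | hb
  · exact atom_two_of_lt hb hl
  · rw [atom_two_of_ge hb hl]
    refine ⟨fun ⟨h₁, h₂, h₃⟩ => ⟨h₁, h₂, h₃, ?_⟩, fun ⟨h₁, h₂, h₃, _⟩ => ⟨h₁, h₂, h₃⟩⟩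
    have := nu_three_lt_of_corner h₁ h₃
    rw [beta] at hb
    nlinarith [sqrt_two_gt, sqrt_two_mul_self]

/-- For h ≥ β l the corner bound contradicts the third inequality, which agrees with the absence of
A₃. -/
theorem mem_atom_three {l h : ℝ} (hl : 0 < l) {p : Plane} :
    p ∈ atom l h 3 ↔ nu 2 p < l - h ∧ -nu 1 p < l - h ∧ l + h < nu 3 p := by
  have ⟨l2, l3, l4⟩ := sqrt_two_powers l
  have ⟨h2, h3, h4⟩ := sqrt_two_powers h
  rcases lt_or_ge h (beta * l) with hb | hb
  · rw [atom, if_neg (by norm_num), if_neg (by norm_num), if_pos ⟨rfl, by rwa [div_lt_iff₀ hl]⟩, Q1,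
      mem_place_polygon]
    simp only [List.forall_mem_cons, List.not_mem_nil, false_imp_iff, implies_true, and_true]
    norm_num1
    simp only [nu_reduce, nu_mk, alpha, beta, omega]
    constructor
    · rintro ⟨i1, i2, i3⟩; refine ⟨?_, ?_, ?_⟩ <;> linarith
    · rintro ⟨i1, i2, i3⟩; refine ⟨?_, ?_, ?_⟩ <;> linarith
  · rw [atom, if_neg (by norm_num), if_neg (by norm_num),
      if_neg fun h' => not_lt.2 hb (by rw [← div_lt_iff₀ hl]; exact h'.2)]
    simp only [Set.mem_empty_iff_false, false_iff, not_and, not_lt]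
    intro h₁ h₂
    have := nu_three_lt_of_corner h₁ h₂
    rw [beta] at hb
    nlinarith [sqrt_two_gt, sqrt_two_mul_self]

theorem isPolygonal_atom (l h : ℝ) (i : ℕ) : IsPolygonal (atom l h i) := by
  unfold atom
  split_ifs
  · exact (isPolygonal_polygon _).place _ _
  · exact (isPolygonal_polygon _).place _ _
  · exact (isPolygonal_polygon _).place _ _
  · exact (isPolygonal_polygon _).place _ _
  -- Two opposite half-planes present the empty set as a polygon.
  · exact ⟨[(0, 0), (4, 0)], by
      ext p; simp only [mem_polygon, List.forall_mem_cons, nu_four]; simp; intros; linarith⟩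

theorem mem_image_U {m : ℝ} {S : Set Plane} {p : Plane} : p ∈ U m '' S ↔ U m p ∈ S := by
  rw [Set.image_eq_preimage_of_inverse (U_U m) (U_U m)]; rfl

/-- The four functionals after the reversing reflection. -/
theorem nu_U_axis (p : Plane) :
    nu 0 (U (5 / 2) p) = -nu 1 p ∧ nu 1 (U (5 / 2) p) = -nu 0 p ∧
      nu 2 (U (5 / 2) p) = nu 3 p ∧ nu 3 (U (5 / 2) p) = nu 2 p := by
  refine ⟨?_, ?_, ?_, ?_⟩ <;> rw [nu_U] <;> norm_num [nu_five, nu_four]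

theorem mem_entranceTile {l h : ℝ} (hl : 0 < l) {p : Plane} :
    p ∈ entranceTile l h ↔ nu 3 p < l - h ∧ l - h < nu 2 p ∧ nu 0 p < l - h ∧ nu 2 p < l + h := by
  have ⟨h₀, h₁, h₂, h₃⟩ := nu_U_axis p
  rw [entranceTile, mem_image_U, exitTile, mem_atom_two hl, h₁, h₂, h₃, neg_neg]

/-! ### The domain map -/

theorem atoms_disjoint {l h : ℝ} (hl : 0 < l) (hh : 0 < h) {i j : ℕ}
    (hi : i = 1 ∨ i = 2 ∨ i = 3) (hj : j = 1 ∨ j = 2 ∨ j = 3)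
    {p : Plane} (pi : p ∈ atom l h i) (pj : p ∈ atom l h j) : i = j := by
  rcases hi with rfl | rfl | rfl <;> rcases hj with rfl | rfl | rfl <;>
    simp only [mem_atom_one, mem_atom_two hl, mem_atom_three hl] at pi pj <;> first | rfl | linarith

theorem nu_R_one (p : Plane) : nu 0 (R 1 p) = -nu 3 p ∧ nu 1 (R 1 p) = nu 0 p ∧
    nu 2 (R 1 p) = nu 1 p ∧ nu 3 (R 1 p) = nu 2 p := by
  refine ⟨?_, ?_, ?_, ?_⟩ <;> rw [nu_R] <;> norm_num [nu_neg]

theorem nu_R_five (p : Plane) : nu 0 (R 5 p) = nu 3 p ∧ nu 1 (R 5 p) = -nu 0 p ∧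
    nu 2 (R 5 p) = -nu 1 p ∧ nu 3 (R 5 p) = -nu 2 p := by
  refine ⟨?_, ?_, ?_, ?_⟩ <;> rw [nu_R] <;> norm_num [nu_neg, nu_reduce]

/-- The functionals after the domain map on the third atom. -/
theorem nu_T_R_one (l : ℝ) (p : Plane) :
    nu 0 (T (2 * l, 2 * l) (R 1 p)) = 2 * l - nu 3 p ∧
    nu 1 (T (2 * l, 2 * l) (R 1 p)) = 2 * (√2 * l) + nu 0 p ∧
    nu 2 (T (2 * l, 2 * l) (R 1 p)) = 2 * l + nu 1 p ∧
    nu 3 (T (2 * l, 2 * l) (R 1 p)) = nu 2 p := by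
  have ⟨h0, h1, h2, h3⟩ := nu_R_one p
  refine ⟨?_, ?_, ?_, ?_⟩ <;> rw [nu_T] <;> simp only [nu_mk, h0, h1, h2, h3] <;> ring

theorem rho_of_mem_one {l h : ℝ} {p : Plane} (hp : p ∈ atom l h 1) : rho l h p = R 5 p :=
  if_pos hp

theorem rho_of_mem_three {l h : ℝ} (hl : 0 < l) (hh : 0 < h) {p : Plane} (hp : p ∈ atom l h 3) :
    rho l h p = T (2 * l, 2 * l) (R 1 p) := by
  have : p ∉ atom l h 1 := fun hp' => by
    have := atoms_disjoint hl hh (i := 1) (j := 3) (by simp) (by simp) hp' hp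
    omega
  rw [rho, if_neg this, if_pos hp]

/-- The coordinate `nu 2` reveals the past: images of A₁ lie below l - h, images of A₃ above l + h,
and the entrance tile lies strictly between. Both injectivity and the impossibility of re-entering
follow. -/
theorem nu_two_rho_of_mem_one {l h : ℝ} {p : Plane} (hp : p ∈ atom l h 1) :
    nu 2 (rho l h p) < l - h := by
  rw [rho_of_mem_one hp, (nu_R_five p).2.2.1]
  exact (mem_atom_one.1 hp).2.2

theorem nu_two_rho_of_mem_three {l h : ℝ} (hl : 0 < l) (hh : 0 < h) {p : Plane}
    (hp : p ∈ atom l h 3) : l + h < nu 2 (rho l h p) := by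
  rw [rho_of_mem_three hl hh hp, (nu_T_R_one l p).2.2.1]
  linarith [((mem_atom_three hl).1 hp).2.1]

theorem R_injective (m : ℝ) : Function.Injective (R m) :=
  Function.LeftInverse.injective (g := R (-m)) fun p => by simp [R_R, R_zero]

theorem T_injective (d : Plane) : Function.Injective (T d) := fun _ _ => add_left_cancel

theorem rho_injective {l h : ℝ} (hl : 0 < l) (hh : 0 < h) {a b : ℕ} (ha : a = 1 ∨ a = 3)
    (hb : b = 1 ∨ b = 3) {p q : Plane} (hp : p ∈ atom l h a) (hq : q ∈ atom l h b)
    (e : rho l h p = rho l h q) : p = q := by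
  have key : ∀ {p q : Plane}, p ∈ atom l h 1 → q ∈ atom l h 3 → rho l h p ≠ rho l h q :=
    fun hp hq e => by
      have h₁ := nu_two_rho_of_mem_one hp
      have h₂ := nu_two_rho_of_mem_three hl hh hq
      rw [e] at h₁; linarith
  rcases ha with rfl | rfl <;> rcases hb with rfl | rfl
  · rw [rho_of_mem_one hp, rho_of_mem_one hq] at e
    exact R_injective _ e
  · exact absurd e (key hp hq)
  · exact absurd e.symm (key hq hp)
  · rw [rho_of_mem_three hl hh hp, rho_of_mem_three hl hh hq] at e
    exact R_injective _ (T_injective _ e)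

theorem rho_notMem_entranceTile {l h : ℝ} (hl : 0 < l) (hh : 0 < h) {a : ℕ} (ha : a = 1 ∨ a = 3)
    {p : Plane} (hp : p ∈ atom l h a) : rho l h p ∉ entranceTile l h := fun he => by
  have he := (mem_entranceTile hl).1 he
  rcases ha with rfl | rfl
  · linarith [nu_two_rho_of_mem_one hp]
  · linarith [nu_two_rho_of_mem_three hl hh hp]

/-! ### Paths -/

/-- The orbit of `p` visits the atoms named by the word `w` (letters `1`, `3`) and then is at `q`. -/
def Reach (l h : ℝ) : List ℕ → Plane → Plane → Prop
  | [], p, q => p = q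
  | a :: w, p, q => (a = 1 ∨ a = 3) ∧ p ∈ atom l h a ∧ Reach l h w (rho l h p) q

theorem follows_nil (l h : ℝ) (p : Plane) : Follows l h [] p := fun i => i.elim0

theorem follows_cons {l h : ℝ} {a : ℕ} {w : List ℕ} {p : Plane} :
    Follows l h (a :: w) p ↔ p ∈ atom l h a ∧ Follows l h w (rho l h p) := by
  constructor
  · intro hf
    refine ⟨hf ⟨0, by simp⟩, fun i => ?_⟩
    exact hf ⟨i + 1, by simp⟩
  · rintro ⟨h₀, hf⟩ ⟨i, hi⟩
    cases i with
    | zero => exact h₀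
    | succ i => exact hf ⟨i, by simpa using hi⟩

theorem reach_iff {l h : ℝ} {w : List ℕ} {p q : Plane} :
    Reach l h w p q ↔
      (∀ a ∈ w, a = 1 ∨ a = 3) ∧ Follows l h w p ∧ (rho l h)^[w.length] p = q := by
  induction w generalizing p with
  | nil => simp [Reach, follows_nil]
  | cons a w ih =>
    rw [Reach, ih, follows_cons, List.forall_mem_cons, List.length_cons, Function.iterate_succ_apply]
    tauto

theorem isTransferPath_iff {l h : ℝ} {w : List ℕ} {p : Plane} :
    IsTransferPath l h w p ↔ p ∈ entranceTile l h ∧ ∃ q ∈ exitTile l h, Reach l h w p q := by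
  simp only [IsTransferPath, reach_iff]
  constructor
  · rintro ⟨h₁, h₂, h₃, h₄⟩; exact ⟨h₁, _, h₄, h₂, h₃, rfl⟩
  · rintro ⟨h₁, q, h₂, h₃, h₄, rfl⟩; exact ⟨h₁, h₃, h₄, h₂⟩

theorem reach_append {l h : ℝ} {v w : List ℕ} {p r : Plane} :
    Reach l h (v ++ w) p r ↔ ∃ q, Reach l h v p q ∧ Reach l h w q r := by
  induction v generalizing p with
  | nil => simp [Reach]
  | cons a v ih => simp only [List.cons_append, Reach, ih, and_assoc, exists_and_left]

theorem Reach.eq_iterate {l h : ℝ} {w : List ℕ} {p q : Plane} (hr : Reach l h w p q) :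
    (rho l h)^[w.length] p = q := (reach_iff.1 hr).2.2

theorem Reach.drop {l h : ℝ} {w : List ℕ} {p q : Plane} (hr : Reach l h w p q) {t : ℕ}
    (ht : t ≤ w.length) : Reach l h (w.drop t) ((rho l h)^[t] p) q := by
  rw [← List.take_append_drop t w, reach_append] at hr
  obtain ⟨r, h₁, h₂⟩ := hr
  have := h₁.eq_iterate
  rw [List.length_take, min_eq_left ht] at this
  rwa [this]

theorem Reach.take {l h : ℝ} {w : List ℕ} {p q : Plane} (hr : Reach l h w p q) {t : ℕ}
    (ht : t ≤ w.length) : Reach l h (w.take t) p ((rho l h)^[t] p) := by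
  rw [← List.take_append_drop t w, reach_append] at hr
  obtain ⟨r, h₁, h₂⟩ := hr
  have := h₁.eq_iterate
  rw [List.length_take, min_eq_left ht] at this
  rwa [this]

theorem Reach.mem_atom {l h : ℝ} {w : List ℕ} {p q : Plane} (hr : Reach l h w p q) {t : ℕ}
    (ht : t < w.length) :
    (w[t] = 1 ∨ w[t] = 3) ∧ (rho l h)^[t] p ∈ atom l h w[t] := by
  have := hr.drop ht.le
  rw [List.drop_eq_getElem_cons ht, Reach] at this
  exact ⟨this.1, this.2.1⟩

section

variable {l h : ℝ}

/-- The exit tile is disjoint from A₁ and A₃, so a path must stop at the first visit there. -/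
theorem reach_unique (hl : 0 < l) (hh : 0 < h) {v w : List ℕ} {p q r : Plane}
    (hv : Reach l h v p q) (hw : Reach l h w p r) (hq : q ∈ exitTile l h)
    (hr : r ∈ exitTile l h) : v = w := by
  induction v generalizing w p with
  | nil =>
    cases w with
    | nil => rfl
    | cons b w =>
      obtain rfl : p = q := hv
      have := atoms_disjoint hl hh (by simp) (by have := hw.1; tauto) hq hw.2.1
      have := hw.1; omega
  | cons a v ih =>
    cases w with
    | nil =>
      obtain rfl : p = r := hw
      have := atoms_disjoint hl hh (by simp) (by have := hv.1; tauto) hr hv.2.1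
      have := hv.1; omega
    | cons b w =>
      have := atoms_disjoint hl hh (by have := hv.1; tauto) (by have := hw.1; tauto) hv.2.1 hw.2.1
      rw [this, ih hv.2.2 hw.2.2]

theorem reach_injective (hl : 0 < l) (hh : 0 < h) {v w : List ℕ} {p q r : Plane}
    (hv : Reach l h v p r) (hw : Reach l h w q r) (hlen : v.length = w.length) : p = q := by
  induction v generalizing w p q with
  | nil =>
    obtain rfl := List.length_eq_zero_iff.1 hlen.symm
    exact hv.trans hw.symm
  | cons a v ih =>
    cases w with
    | nil => simp at hlen
    | cons b w =>
      exact rho_injective hl hh hv.1 hw.1 hv.2.1 hw.2.1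
        (ih hv.2.2 hw.2.2 (by simpa using hlen))

/-- A point of the entrance tile is not visited after the start of an orbit. -/
theorem not_reach_entranceTile (hl : 0 < l) (hh : 0 < h) {w : List ℕ} {p q : Plane}
    (hr : Reach l h w p q) (hq : q ∈ entranceTile l h) : w = [] := by
  induction w generalizing p with
  | nil => rfl
  | cons a w ih =>
    have hw := ih hr.2.2
    subst hw
    obtain rfl : rho l h p = q := hr.2.2
    exact absurd hq (rho_notMem_entranceTile hl hh hr.1 hr.2.1)

/-- Running both orbits back by the smaller of the two times shows that one starting point lies on
the other orbit. It is in the entrance tile, so it must be the start of that orbit too. -/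
theorem iterate_eq_iterate (hl : 0 < l) (hh : 0 < h) {v w : List ℕ} {p₁ p₂ q₁ q₂ : Plane}
    (h₁ : Reach l h v p₁ q₁) (h₂ : Reach l h w p₂ q₂) {s t : ℕ} (hs : s ≤ v.length)
    (ht : t ≤ w.length) (m₁ : p₁ ∈ entranceTile l h) (m₂ : p₂ ∈ entranceTile l h)
    (e : (rho l h)^[s] p₁ = (rho l h)^[t] p₂) : s = t ∧ p₁ = p₂ := by
  wlog hst : s ≤ t generalizing v w p₁ p₂ q₁ q₂ s t
  · have := this h₂ h₁ ht hs m₂ m₁ e.symm (by omega)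
    exact ⟨this.1.symm, this.2.symm⟩
  obtain ⟨d, rfl⟩ := Nat.exists_eq_add_of_le' hst
  have a₁ := h₁.take hs
  have a₂ := h₂.take ht
  rw [← e, List.take_add, reach_append] at a₂
  obtain ⟨r, b₁, b₂⟩ := a₂
  obtain rfl := reach_injective hl hh a₁ b₂ (by simp only [List.length_take, List.length_drop]; omega)
  have := congrArg List.length (not_reach_entranceTile hl hh b₁ m₁)
  rw [List.length_take, List.length_nil] at this
  obtain rfl : d = 0 := by omega
  rw [List.take_zero] at b₁
  exact ⟨by omega, Eq.symm b₁⟩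

end

/-! ### Generic points -/

theorem nu_u_self (k : ℝ) : nu k (u k) = 1 := by
  have := Real.cos_sq_add_sin_sq (k * Real.pi / 4)
  simp only [nu, u]; nlinarith

theorem dense_nu_ne (k c : ℝ) : Dense {p | nu k p ≠ c} := by
  intro p
  by_cases hp : nu k p = c
  · have hc : Filter.Tendsto (fun t : ℝ => p + t • u k) (nhdsWithin 0 (Set.Ioi 0)) (nhds p) := by
      have : Continuous fun t : ℝ => p + t • u k := by fun_prop
      have h' := this.tendsto 0
      simp only [zero_smul, add_zero] at h'
      exact h'.mono_left nhdsWithin_le_nhds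
    refine mem_closure_of_tendsto hc ?_
    filter_upwards [self_mem_nhdsWithin] with t ht
    have ht' : (0 : ℝ) < t := ht
    simp only [Set.mem_ofPred_eq, nu_add_vec, nu_smul, nu_u_self, hp]
    linarith
  · exact subset_closure hp

/-- An open set is in the closure of its points that avoid finitely many lines. -/
theorem subset_closure_generic {O : Set Plane} (hO : IsOpen O) (es : List (ℝ × ℝ)) :
    O ⊆ closure (O ∩ {p | ∀ e ∈ es, nu e.1 p ≠ e.2}) := by
  have hd : ∀ es : List (ℝ × ℝ), IsOpen {p | ∀ e ∈ es, nu e.1 p ≠ e.2} ∧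
      Dense {p | ∀ e ∈ es, nu e.1 p ≠ e.2} := by
    intro es
    induction es with
    | nil => simp
    | cons e es ih =>
      simp only [List.forall_mem_cons, Set.ofPred_and]
      have ho : IsOpen {p | nu e.1 p ≠ e.2} :=
        isOpen_ne_fun (continuous_nu _) continuous_const
      exact ⟨ho.inter ih.1, (dense_nu_ne _ _).inter_of_isOpen_left ih.2 ho⟩
  exact (hd es).2.open_subset_closure_inter hO

/-! ### The first two tiles -/

theorem beta_pos : 0 < beta := by rw [beta]; linarith [sqrt_two_gt]
theorem beta_lt : beta < 1 / 2 := by rw [beta]; linarith [sqrt_two_lt]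

theorem J_eq_one {l h : ℝ} (hl : 0 < l) (hh : 0 < h) (hhl : h < l) (hb : beta * l ≤ h) :
    J l h = 1 := by
  rw [J, Nat.ceil_eq_iff one_ne_zero]
  have hx : 0 < h / l := by positivity
  constructor
  · rw [Nat.sub_self, Nat.cast_zero]
    exact Real.logb_pos_of_base_lt_one beta_pos (by linarith [beta_lt]) hx
      (by rwa [div_lt_one hl])
  · rw [Nat.cast_one, ← Real.logb_self_eq_one_iff.2 ⟨beta_pos.ne', by linarith [beta_lt], by linarith [beta_pos]⟩]
    rw [Real.logb_le_logb_of_base_lt_one beta_pos (by linarith [beta_lt]) hx beta_pos]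
    rwa [le_div_iff₀ hl]

theorem J_succ {l h : ℝ} (hl : 0 < l) (hh : 0 < h) (hb : h < beta * l) :
    J l h = J (beta * l) h + 1 := by
  have hβ := beta_pos
  have hx : 0 < h / (beta * l) := by positivity
  have e : Real.logb beta (h / l) = Real.logb beta (h / (beta * l)) + 1 := by
    rw [show h / l = h / (beta * l) * beta by field_simp, Real.logb_mul hx.ne' hβ.ne',
      Real.logb_self_eq_one_iff.2 ⟨hβ.ne', by linarith [beta_lt], by linarith⟩]
  rw [J, J, e, Nat.ceil_add_one]
  -- A natural-number ceiling commutes with adding one only for a non-negative argument; this is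
  -- where h < β l enters.
  refine (Real.logb_pos_of_base_lt_one hβ (by linarith [beta_lt]) hx ?_).le
  rwa [div_lt_one (by positivity)]

theorem J_pos {l h : ℝ} (hl : 0 < l) (hh : 0 < h) (hhl : h < l) : 1 ≤ J l h := by
  rcases lt_or_ge h (beta * l) with hb | hb
  · rw [J_succ hl hh hb]; omega
  · rw [J_eq_one hl hh hhl hb]

theorem image_T_place (c d : Plane) (m : ℝ) (X : Set Plane) :
    T c '' place d m X = place (c + d) m X := by
  simp only [place, ← Set.image_comp]
  refine congrArg (· '' X) (funext fun p => ?_)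
  simp [T, add_assoc]

theorem E_of_lt {l h : ℝ} (hl : 0 < l) (hb : h < beta * l) (i : ℕ) :
    E l h i = T (l, l) '' strip l h i := by rw [E, if_pos (by rwa [div_lt_iff₀ hl])]

theorem E_of_ge {l h : ℝ} (hl : 0 < l) (hb : beta * l ≤ h) (i : ℕ) :
    E l h i = if i = 1 then place (0, alpha * (l - h)) 0 (Q1 (beta * (l - h)))
      else place (l - h, omega * (l - h)) 6 (Q7 (alpha * (l - h))) := by
  rw [E, if_neg (by rwa [div_lt_iff₀ hl, not_lt])]

/-- A single system covers the trapezium (h < β² l) and the triangle: in the triangle `nu 2` stays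
below √2 (l - h), which is at most l + h once h ≥ β² l. -/
theorem mem_E_one {l h : ℝ} (hl : 0 < l) (hh : 0 < h) (hhl : h < l) {p : Plane} :
    p ∈ E l h 1 ↔ l - h < nu 2 p ∧ nu 1 p < l - h ∧ nu 3 p < l - h ∧ nu 2 p < l + h := by
  have ⟨l2, l3, l4⟩ := sqrt_two_powers l
  have ⟨h2, h3, h4⟩ := sqrt_two_powers h
  have hs := sqrt_two_mul_nu_two p
  have hg := sqrt_two_gt
  rcases lt_or_ge h (beta * l) with hb | hb
  · rw [E_of_lt hl hb, strip, if_pos rfl, stripOdd, image_T_place, if_neg (by decide),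
      J_succ hl hh hb]
    rcases lt_or_ge h (beta * (beta * l)) with hc | hc
    · rw [if_pos (by have := J_pos (mul_pos beta_pos hl) hh hb
                     rw [J_succ (mul_pos beta_pos hl) hh hc]
                     have := J_pos (mul_pos beta_pos (mul_pos beta_pos hl)) hh hc
                     omega), Q4, mem_place_polygon]
      simp only [List.forall_mem_cons, List.not_mem_nil, false_imp_iff, implies_true, and_true,
        Prod.mk_add_mk]
      norm_num1
      simp only [nu_reduce, nu_mk, alpha, beta, omega, pow_zero, pow_one] at hb hc ⊢
      constructor
      · rintro ⟨i1, i2, i3, i4⟩; refine ⟨?_, ?_, ?_, ?_⟩ <;> linarith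
      · rintro ⟨i1, i2, i3, i4⟩; refine ⟨?_, ?_, ?_, ?_⟩ <;> linarith
    · rw [if_neg (by rw [J_eq_one (mul_pos beta_pos hl) hh hb hc]; omega), Q1, mem_place_polygon]
      simp only [List.forall_mem_cons, List.not_mem_nil, false_imp_iff, implies_true, and_true,
        Prod.mk_add_mk]
      norm_num1
      simp only [nu_reduce, nu_mk, alpha, beta, omega, pow_zero, pow_one] at hb hc ⊢
      constructor
      · rintro ⟨i1, i2, i3⟩
        refine ⟨?_, ?_, ?_, ?_⟩ <;> first | linarith | nlinarith
      · rintro ⟨i1, i2, i3, i4⟩; refine ⟨?_, ?_, ?_⟩ <;> linarith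
  · rw [E_of_ge hl hb, if_pos rfl, Q1, mem_place_polygon]
    simp only [List.forall_mem_cons, List.not_mem_nil, false_imp_iff, implies_true, and_true]
    norm_num1
    simp only [nu_reduce, nu_mk, alpha, beta, omega] at hb ⊢
    constructor
    · rintro ⟨i1, i2, i3⟩
      refine ⟨?_, ?_, ?_, ?_⟩ <;> first | linarith | nlinarith
    · rintro ⟨i1, i2, i3, i4⟩; refine ⟨?_, ?_, ?_⟩ <;> linarith

/-- Rhombus, hexagon and kite share this system. For the rhombus the bounds on `nu 0` and `nu 3` are
redundant, for the kite the upper bounds on `nu 1` and `nu 2`. -/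
theorem mem_E_two {l h : ℝ} (hl : 0 < l) (hh : 0 < h) {p : Plane} :
    p ∈ E l h 2 ↔ l - h < nu 2 p ∧ l - h < nu 1 p ∧ nu 0 p < l - h ∧ nu 3 p < l - h ∧
      nu 2 p < l + h ∧ nu 1 p < l + h := by
  have ⟨l2, l3, l4⟩ := sqrt_two_powers l
  have ⟨h2, h3, h4⟩ := sqrt_two_powers h
  have hs := sqrt_two_mul_nu_two p
  have hs₁ := sqrt_two_mul_nu_one p
  have hs₀ := sqrt_two_mul_nu_zero p
  have hs₃ := sqrt_two_mul_nu_three p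
  have hg := sqrt_two_gt
  rcases lt_or_ge h (beta * l) with hb | hb
  · rw [E_of_lt hl hb, strip, if_neg (by decide), stripEven, J_succ hl hh hb]
    rcases lt_or_ge h (beta * (beta * l)) with hc | hc
    · rw [if_pos (by have := J_pos (mul_pos beta_pos hl) hh hb
                     rw [J_succ (mul_pos beta_pos hl) hh hc]
                     have := J_pos (mul_pos beta_pos (mul_pos beta_pos hl)) hh hc
                     omega), image_T_place, if_neg (by decide), Q3, mem_place_polygon]
      simp only [List.forall_mem_cons, List.not_mem_nil, false_imp_iff, implies_true, and_true,
        Prod.mk_add_mk]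
      norm_num1
      simp only [nu_reduce, nu_mk, alpha, beta, omega, pow_zero, pow_one] at hb hc ⊢
      constructor
      · rintro ⟨i1, i2, i3, i4⟩
        refine ⟨?_, ?_, ?_, ?_, ?_, ?_⟩ <;> first | linarith | nlinarith
      · rintro ⟨i1, i2, i3, i4, i5, i6⟩; refine ⟨?_, ?_, ?_, ?_⟩ <;> linarith
    · rw [J_eq_one (mul_pos beta_pos hl) hh hb hc, if_neg (by decide), if_pos rfl, image_T_place,
        if_neg (by decide), Q8, mem_place_polygon]
      simp only [List.forall_mem_cons, List.not_mem_nil, false_imp_iff, implies_true, and_true,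
        Prod.mk_add_mk]
      norm_num1
      simp only [nu_reduce, nu_mk, alpha, beta, omega, pow_zero, pow_one] at hb hc ⊢
      constructor
      · rintro ⟨i1, i2, i3, i4, i5, i6⟩; refine ⟨?_, ?_, ?_, ?_, ?_, ?_⟩ <;> linarith
      · rintro ⟨i1, i2, i3, i4, i5, i6⟩; refine ⟨?_, ?_, ?_, ?_, ?_, ?_⟩ <;> linarith
  · rw [E_of_ge hl hb, if_neg (by decide), Q7, mem_place_polygon]
    simp only [List.forall_mem_cons, List.not_mem_nil, false_imp_iff, implies_true, and_true]
    norm_num1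
    simp only [nu_reduce, nu_mk, alpha, beta, omega] at hb ⊢
    constructor
    · rintro ⟨i1, i2, i3, i4⟩
      refine ⟨?_, ?_, ?_, ?_, ?_, ?_⟩ <;> first | linarith | nlinarith
    · rintro ⟨i1, i2, i3, i4, i5, i6⟩; refine ⟨?_, ?_, ?_, ?_⟩ <;> linarith

theorem E_one_eq {l h : ℝ} (hl : 0 < l) (hh : 0 < h) (hhl : h < l) :
    E l h 1 = polygon [(6, -(l - h)), (1, l - h), (3, l - h), (2, l + h)] := by
  ext p
  rw [mem_E_one hl hh hhl, mem_polygon]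
  simp only [List.forall_mem_cons, List.not_mem_nil, false_imp_iff, implies_true, and_true,
    nu_reduce, neg_lt_neg_iff]

theorem E_two_eq {l h : ℝ} (hl : 0 < l) (hh : 0 < h) :
    E l h 2 = polygon [(6, -(l - h)), (5, -(l - h)), (0, l - h), (3, l - h), (2, l + h),
      (1, l + h)] := by
  ext p
  rw [mem_E_two hl hh, mem_polygon]
  simp only [List.forall_mem_cons, List.not_mem_nil, false_imp_iff, implies_true, and_true,
    nu_reduce, neg_lt_neg_iff]

/-- Two neighbouring functionals are coordinates of the plane. -/
theorem exists_nu (k x y : ℝ) : ∃ p, nu k p = x ∧ nu (k + 1) p = y := by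
  refine ⟨R k (x, √2 * y - x), ?_, ?_⟩ <;> rw [nu_R]
  · rw [sub_self, nu_zero]
  · rw [add_sub_cancel_left, nu_one_mk]
    linear_combination y / 2 * sqrt_two_mul_self

theorem eq_of_nu {k : ℝ} {p q : Plane} (h₁ : nu k p = nu k q)
    (h₂ : nu (k + 1) p = nu (k + 1) q) : p = q := by
  have h₃ : ∀ r : Plane, nu 0 (R (-k) r) = nu k r ∧ nu 1 (R (-k) r) = nu (k + 1) r := fun r => by
    rw [nu_R, nu_R]; constructor <;> congr 1 <;> ring
  refine R_injective (-k) (plane_ext (by rw [(h₃ p).1, (h₃ q).1, h₁]) ?_)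
  have e₁ := sqrt_two_mul_nu_one (R (-k) p)
  have e₂ := sqrt_two_mul_nu_one (R (-k) q)
  rw [(h₃ p).1, (h₃ p).2] at e₁
  rw [(h₃ q).1, (h₃ q).2] at e₂
  rw [h₁, h₂] at e₁; linarith

theorem exists_small {l h : ℝ} (hh : 0 < h) (hhl : h < l) :
    ∃ t, 0 < t ∧ t < h ∧ t < (l - h) / 8 := by
  have ha : 0 < l - h := by linarith
  refine ⟨min h ((l - h) / 8) / 2, by positivity, ?_, ?_⟩
  · have := min_le_left h ((l - h) / 8); linarith
  · have := min_le_right h ((l - h) / 8); linarith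

theorem E_one_nonempty {l h : ℝ} (hl : 0 < l) (hh : 0 < h) (hhl : h < l) :
    (E l h 1).Nonempty := by
  have ha : 0 < l - h := by linarith
  obtain ⟨t, ht₀, ht₁, ht₂⟩ := exists_small hh hhl
  obtain ⟨p, h₁, h₂⟩ := exists_nu 1 (3 / 4 * (l - h)) (l - h + t)
  norm_num at h₂
  have hs := sqrt_two_mul_nu_two p
  refine ⟨p, (mem_E_one hl hh hhl).2 ⟨?_, ?_, ?_, ?_⟩⟩ <;> first | linarith | nlinarith [sqrt_two_lt]

theorem E_two_nonempty {l h : ℝ} (hl : 0 < l) (hh : 0 < h) (hhl : h < l) :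
    (E l h 2).Nonempty := by
  have ha : 0 < l - h := by linarith
  obtain ⟨t, ht₀, ht₁, ht₂⟩ := exists_small hh hhl
  -- A point on the symmetry axis, just inside the corner `nu 1` = `nu 2` = l - h.
  obtain ⟨p, h₁, h₂⟩ := exists_nu 1 (l - h + t) (l - h + t)
  norm_num at h₂
  have hs := sqrt_two_mul_nu_two p
  have hs₀ := sqrt_two_mul_nu_zero p
  have hg := sqrt_two_lt
  have hg' := sqrt_two_gt
  have h₃ : nu 3 p = (√2 - 1) * (l - h + t) := by rw [h₁, h₂] at hs; linarith
  have h₃' : nu 3 p < 1 / 2 * (l - h + t) := by rw [h₃]; nlinarith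
  have h₀ : nu 0 p = (√2 - 1) * (l - h + t) := by
    rw [h₃, h₁] at hs₀
    have := sqrt_two_mul_self
    linear_combination √2 / 2 * hs₀ + (-(l - h + t) / 2 - nu 0 p / 2) * this
  refine ⟨p, (mem_E_two hl hh).2 ⟨?_, ?_, ?_, ?_, ?_, ?_⟩⟩ <;> linarith

/-! ### Symmetry axes -/

theorem reflectAt_reflectAt (c : Plane) (m : ℝ) (p : Plane) :
    reflectAt c m (reflectAt c m p) = p := by
  simp [reflectAt, U_U]

theorem reflectAt_image_eq {c : Plane} {m : ℝ} {S : Set Plane}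
    (hS : ∀ p ∈ S, reflectAt c m p ∈ S) : reflectAt c m '' S = S := by
  refine Set.Subset.antisymm (Set.image_subset_iff.2 hS) fun p hp => ?_
  exact ⟨_, hS p hp, reflectAt_reflectAt c m p⟩

theorem mem_rhombus {d : Plane} {n r : ℝ} {p : Plane} :
    p ∈ place d n (Q3 r) ↔
      |nu (n + 2) p - nu (n + 2) d| < r ∧ |nu (n + 3) p - nu (n + 3) d| < r := by
  have e₆ : ∀ q, nu (n + 6) q = -nu (n + 2) q := fun q => by rw [← nu_add_four]; congr 1; ring
  have e₇ : ∀ q, nu (n + 7) q = -nu (n + 3) q := fun q => by rw [← nu_add_four]; congr 1; ring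
  rw [Q3, mem_place_polygon]
  simp only [List.forall_mem_cons, List.not_mem_nil, false_imp_iff, implies_true, and_true, e₆, e₇,
    abs_lt]
  constructor
  · rintro ⟨i1, i2, i3, i4⟩; refine ⟨⟨?_, ?_⟩, ?_, ?_⟩ <;> linarith
  · rintro ⟨⟨i1, i2⟩, i3, i4⟩; refine ⟨?_, ?_, ?_, ?_⟩ <;> linarith

theorem mem_closure_rhombus {d : Plane} {n r : ℝ} (hr : 0 < r) {p : Plane} :
    p ∈ closure (place d n (Q3 r)) ↔
      |nu (n + 2) p - nu (n + 2) d| ≤ r ∧ |nu (n + 3) p - nu (n + 3) d| ≤ r := by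
  constructor
  · refine fun hp => closure_minimal (t := {p | |nu (n + 2) p - nu (n + 2) d| ≤ r ∧
      |nu (n + 3) p - nu (n + 3) d| ≤ r}) (fun q hq => ?_) ?_ hp
    · exact ⟨(mem_rhombus.1 hq).1.le, (mem_rhombus.1 hq).2.le⟩
    · exact (isClosed_le ((continuous_nu _).sub continuous_const).abs continuous_const).inter
        (isClosed_le ((continuous_nu _).sub continuous_const).abs continuous_const)
  · rintro ⟨h₁, h₂⟩
    have e : place d n (Q3 r) = polygon [(n + 6, nu (n + 6) d + r), (n + 7, nu (n + 7) d + r),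
        (n + 2, nu (n + 2) d + r), (n + 3, nu (n + 3) d + r)] := by
      ext q
      rw [Q3, mem_place_polygon, mem_polygon]
      simp only [List.forall_mem_cons, List.not_mem_nil, false_imp_iff, implies_true, and_true]
    have hd : d ∈ place d n (Q3 r) := mem_rhombus.2 (by simpa using hr)
    rw [e] at hd ⊢
    refine mem_closure_polygon hd ?_
    have e₆ : ∀ q, nu (n + 6) q = -nu (n + 2) q := fun q => by rw [← nu_add_four]; congr 1; ring
    have e₇ : ∀ q, nu (n + 7) q = -nu (n + 3) q := fun q => by rw [← nu_add_four]; congr 1; ring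
    simp only [List.forall_mem_cons, List.not_mem_nil, false_imp_iff, implies_true, and_true, e₆,
      e₇]
    rw [abs_le] at h₁ h₂
    refine ⟨?_, ?_, ?_, ?_⟩ <;> linarith [h₁.1, h₁.2, h₂.1, h₂.2]

/-- A rhombus has a single extreme point in any direction that is not normal to an edge. -/
theorem rhombus_extreme_unique {d : Plane} {n r : ℝ} (hr : 0 < r) {k A B b : ℝ} (hA : A ≠ 0)
    (hB : B ≠ 0) (hk : ∀ p, nu k p = A * nu (n + 2) p + B * nu (n + 3) p)
    (hb : ∀ p ∈ closure (place d n (Q3 r)), nu k p ≤ b) {p q : Plane}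
    (hp : p ∈ closure (place d n (Q3 r))) (hq : q ∈ closure (place d n (Q3 r)))
    (ep : nu k p = b) (eq : nu k q = b) : p = q := by
  have key : ∃ x y, ∀ p ∈ closure (place d n (Q3 r)), nu k p = b →
      nu (n + 2) p = x ∧ nu (n + 3) p = y := by
    refine ⟨if 0 < A then nu (n + 2) d + r else nu (n + 2) d - r,
      if 0 < B then nu (n + 3) d + r else nu (n + 3) d - r, fun p hp ep => ?_⟩
    have ⟨h₁, h₂⟩ := (mem_closure_rhombus hr).1 hp
    have h₁' := abs_le.1 h₁
    have h₂' := abs_le.1 h₂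
    -- In the coordinates `nu (n + 2)`, `nu (n + 3)` the closed rhombus is a product of intervals,
    -- so each coordinate can be varied alone. Maximality then forces it to the end chosen by the
    -- sign of its coefficient.
    have mv : ∀ x y, |x - nu (n + 2) d| ≤ r → |y - nu (n + 3) d| ≤ r → A * x + B * y ≤ b := by
      intro x y hx hy
      obtain ⟨q, q₁, q₂⟩ := exists_nu (n + 2) x y
      rw [show n + 2 + 1 = n + 3 by ring] at q₂
      have := hb q ((mem_closure_rhombus hr).2 (by rw [q₁, q₂]; exact ⟨hx, hy⟩))
      rwa [hk, q₁, q₂] at this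
    rw [hk] at ep
    have a₁ := mv (nu (n + 2) d + r) _ (by simp [abs_of_pos hr]) h₂
    have a₂ := mv (nu (n + 2) d - r) _ (by simp [abs_of_pos hr]) h₂
    have a₃ := mv _ (nu (n + 3) d + r) h₁ (by simp [abs_of_pos hr])
    have a₄ := mv _ (nu (n + 3) d - r) h₁ (by simp [abs_of_pos hr])
    constructor
    · split_ifs with hA'
      · nlinarith
      · have : A < 0 := lt_of_le_of_ne (not_lt.1 hA') hA
        nlinarith
    · split_ifs with hB'
      · nlinarith
      · have : B < 0 := lt_of_le_of_ne (not_lt.1 hB') hB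
        nlinarith
  obtain ⟨x, y, hxy⟩ := key
  refine eq_of_nu (k := n + 2) ?_ ?_
  · rw [(hxy p hp ep).1, (hxy q hq eq).1]
  · rw [show n + 2 + 1 = n + 3 by ring, (hxy p hp ep).2, (hxy q hq eq).2]

theorem nu_eq_combination (n : ℝ) (p : Plane) :
    nu n p = 1 * nu (n + 2) p + -√2 * nu (n + 3) p ∧
      nu (n + 1) p = √2 * nu (n + 2) p + -1 * nu (n + 3) p := by
  have h₂ := nu_sub_one_add_nu_add_one (n + 2) p
  have h₃ := nu_sub_one_add_nu_add_one (n + 1) p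
  rw [show n + 2 - 1 = n + 1 by ring, show n + 2 + 1 = n + 3 by ring] at h₂
  rw [show n + 1 - 1 = n by ring, show n + 1 + 1 = n + 2 by ring] at h₃
  have h₁ : nu (n + 1) p = √2 * nu (n + 2) p + -1 * nu (n + 3) p := by linarith
  rw [h₁] at h₃
  exact ⟨by linear_combination h₃ + nu (n + 2) p * sqrt_two_mul_self, h₁⟩

/-- The edges of the rhombus `T_d R_n Q₃(r)` have normals `u_{n+2}`, `u_{n+3}` up to sign. -/
theorem rhombus_edge {d : Plane} {n k : ℤ} {r b : ℝ} (hr : 0 < r)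
    (hb : ∀ p ∈ place d n (Q3 r), nu k p < b) {p q : Plane} (hpq : p ≠ q)
    (hp : p ∈ closure (place d n (Q3 r))) (hq : q ∈ closure (place d n (Q3 r)))
    (ep : nu k p = b) (eq : nu k q = b) : (k - n) % 4 = 2 ∨ (k - n) % 4 = 3 := by
  by_contra hc
  have hs : √2 ≠ 0 := by positivity
  suffices ∃ A B : ℝ, A ≠ 0 ∧ B ≠ 0 ∧
      ∀ p, nu k p = A * nu (n + 2) p + B * nu (n + 3) p by
    obtain ⟨A, B, hA, hB, hk⟩ := this
    exact hpq (rhombus_extreme_unique hr hA hB hk (fun p hp => nu_le_of_mem_closure hb hp)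
      hp hq ep eq)
  have h8 := Int.emod_add_mul_ediv (k - n) 8
  set z := (k - n) / 8
  -- In the remaining directions both coefficients are non-zero, so two distinct extreme points are
  -- impossible.
  have hm : (k - n) % 8 = 0 ∨ (k - n) % 8 = 1 ∨ (k - n) % 8 = 4 ∨ (k - n) % 8 = 5 := by omega
  have red : ∀ (e : ℤ) p, (k - n) % 8 = e → nu k p = nu (n + e) p := fun e p he => by
    rw [← nu_add_eight_mul_int (n + e) z, ← he]
    congr 1
    have : k = n + (k - n) % 8 + 8 * z := by omega
    exact_mod_cast this
  rcases hm with hm | hm | hm | hm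
  · refine ⟨1, -√2, one_ne_zero, neg_ne_zero.2 hs, fun p => ?_⟩
    rw [red _ p hm, Int.cast_zero, add_zero]; exact (nu_eq_combination n p).1
  · refine ⟨√2, -1, hs, by norm_num, fun p => ?_⟩
    rw [red _ p hm, Int.cast_one]; exact (nu_eq_combination n p).2
  · refine ⟨-1, √2, by norm_num, hs, fun p => ?_⟩
    rw [red _ p hm, show (n : ℝ) + ((4 : ℤ) : ℝ) = n + 4 by norm_num, nu_add_four,
      (nu_eq_combination n p).1]; ring
  · refine ⟨-√2, 1, neg_ne_zero.2 hs, one_ne_zero, fun p => ?_⟩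
    rw [red _ p hm, show (n : ℝ) + ((5 : ℤ) : ℝ) = n + 1 + 4 by push_cast; ring, nu_add_four,
      (nu_eq_combination n p).2]; ring

theorem mem_closure_E_one {l h : ℝ} (hl : 0 < l) (hh : 0 < h) (hhl : h < l) {p : Plane}
    (h₁ : l - h ≤ nu 2 p) (h₂ : nu 1 p ≤ l - h) (h₃ : nu 3 p ≤ l - h) (h₄ : nu 2 p ≤ l + h) :
    p ∈ closure (E l h 1) := by
  obtain ⟨q, hq⟩ := E_one_nonempty hl hh hhl
  rw [E_one_eq hl hh hhl] at hq ⊢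
  refine mem_closure_polygon hq ?_
  simp only [List.forall_mem_cons, List.not_mem_nil, false_imp_iff, implies_true, and_true,
    nu_reduce, neg_le_neg_iff]
  exact ⟨h₁, h₂, h₃, h₄⟩

theorem mem_closure_E_two {l h : ℝ} (hl : 0 < l) (hh : 0 < h) (hhl : h < l) {p : Plane}
    (h₁ : l - h ≤ nu 2 p) (h₂ : l - h ≤ nu 1 p) (h₃ : nu 0 p ≤ l - h) (h₄ : nu 3 p ≤ l - h)
    (h₅ : nu 2 p ≤ l + h) (h₆ : nu 1 p ≤ l + h) :
    p ∈ closure (E l h 2) := by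
  obtain ⟨q, hq⟩ := E_two_nonempty hl hh hhl
  rw [E_two_eq hl hh] at hq ⊢
  refine mem_closure_polygon hq ?_
  simp only [List.forall_mem_cons, List.not_mem_nil, false_imp_iff, implies_true, and_true,
    nu_reduce, neg_le_neg_iff]
  exact ⟨h₁, h₂, h₃, h₄, h₅, h₆⟩

theorem exists_nu_one_two (x y : ℝ) : ∃ p, nu 1 p = x ∧ nu 2 p = y ∧ nu 3 p = √2 * y - x ∧
    nu 0 p = √2 * x - y := by
  obtain ⟨p, h₁, h₂⟩ := exists_nu 1 x y
  norm_num at h₂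
  have hs₂ := sqrt_two_mul_nu_two p
  have hs₁ := sqrt_two_mul_nu_one p
  rw [h₁] at hs₁ hs₂
  rw [h₂] at hs₁ hs₂
  exact ⟨p, h₁, h₂, by linarith, by linarith⟩

/-- The tile has edges of positive length with normals 6, 1 and 3. These are three different
directions modulo 4, while a rhombus has only two. -/
theorem E_one_ne_rhombus {l h : ℝ} (hl : 0 < l) (hh : 0 < h) (hhl : h < l) {r : ℝ} (hr : 0 < r)
    (d : Plane) (n : ℤ) : E l h 1 ≠ place d n (Q3 r) := by
  intro e
  obtain ⟨t, ht₀, ht₁, ht₂⟩ := exists_small hh hhl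
  have hg := sqrt_two_lt
  have hg' := sqrt_two_gt
  have hE : ∀ p ∈ place d n (Q3 r), l - h < nu 2 p ∧ nu 1 p < l - h ∧ nu 3 p < l - h ∧
    nu 2 p < l + h := fun p hp => (mem_E_one hl hh hhl).1 (e ▸ hp)
  have hcl : ∀ p, l - h ≤ nu 2 p → nu 1 p ≤ l - h → nu 3 p ≤ l - h → nu 2 p ≤ l + h →
      p ∈ closure (place d n (Q3 r)) := fun p h₁ h₂ h₃ h₄ => e ▸ mem_closure_E_one hl hh hhl h₁ h₂ h₃ h₄
  have c₁ : (6 - n) % 4 = 2 ∨ (6 - n) % 4 = 3 := by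
    obtain ⟨p, p₁, p₂, p₃, p₀⟩ := exists_nu_one_two (l - h) (l - h)
    obtain ⟨q, q₁, q₂, q₃, q₀⟩ := exists_nu_one_two (l - h - t) (l - h)
    refine rhombus_edge (k := 6) (b := -(l - h)) hr (fun p hp => ?_) (p := p) (q := q) ?_
      (hcl p ?_ ?_ ?_ ?_) (hcl q ?_ ?_ ?_ ?_) ?_ ?_
    · have := hE p hp; push_cast; rw [nu_six]; linarith
    · rintro rfl; linarith
    all_goals first | linarith | nlinarith | (push_cast; rw [nu_six]; linarith)
  have c₂ : (1 - n) % 4 = 2 ∨ (1 - n) % 4 = 3 := by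
    obtain ⟨p, p₁, p₂, p₃, p₀⟩ := exists_nu_one_two (l - h) (l - h)
    obtain ⟨q, q₁, q₂, q₃, q₀⟩ := exists_nu_one_two (l - h) (l - h + t)
    refine rhombus_edge (k := 1) (b := l - h) hr (fun p hp => ?_) (p := p) (q := q) ?_
      (hcl p ?_ ?_ ?_ ?_) (hcl q ?_ ?_ ?_ ?_) ?_ ?_
    · have := hE p hp; push_cast; linarith
    · rintro rfl; linarith
    all_goals first | linarith | nlinarith | (push_cast; linarith)
  have c₃ : (3 - n) % 4 = 2 ∨ (3 - n) % 4 = 3 := by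
    obtain ⟨p, p₁, p₂, p₃, p₀⟩ := exists_nu_one_two ((√2 - 1) * (l - h)) (l - h)
    obtain ⟨q, q₁, q₂, q₃, q₀⟩ := exists_nu_one_two (√2 * (l - h + t) - (l - h)) (l - h + t)
    refine rhombus_edge (k := 3) (b := l - h) hr (fun p hp => ?_) (p := p) (q := q) ?_
      (hcl p ?_ ?_ ?_ ?_) (hcl q ?_ ?_ ?_ ?_) ?_ ?_
    · have := hE p hp; push_cast; linarith
    · rintro rfl; linarith
    all_goals first | linarith | nlinarith | (push_cast; linarith)
  omega

theorem nu_reflectAt_zero (k m : ℝ) (p : Plane) : nu k (reflectAt 0 m p) = nu (2 * m - k) p := by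
  rw [nu_reflectAt]; simp [nu]

theorem nu_reflectAt_four (p : Plane) :
    nu 0 (reflectAt 0 ((4 : ℤ) / 2) p) = -nu 0 p ∧ nu 1 (reflectAt 0 ((4 : ℤ) / 2) p) = nu 3 p ∧
    nu 2 (reflectAt 0 ((4 : ℤ) / 2) p) = nu 2 p ∧ nu 3 (reflectAt 0 ((4 : ℤ) / 2) p) = nu 1 p := by
  refine ⟨?_, ?_, ?_, ?_⟩ <;> rw [nu_reflectAt_zero] <;> norm_num [nu_four]

theorem nu_reflectAt_three (p : Plane) :
    nu 0 (reflectAt 0 ((3 : ℤ) / 2) p) = nu 3 p ∧ nu 1 (reflectAt 0 ((3 : ℤ) / 2) p) = nu 2 p ∧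
    nu 2 (reflectAt 0 ((3 : ℤ) / 2) p) = nu 1 p ∧ nu 3 (reflectAt 0 ((3 : ℤ) / 2) p) = nu 0 p := by
  refine ⟨?_, ?_, ?_, ?_⟩ <;> rw [nu_reflectAt_zero] <;> norm_num

theorem isTileAxis_E_one {l h : ℝ} (hl : 0 < l) (hh : 0 < h) (hhl : h < l) :
    IsTileAxis (E l h 1) 0 ((4 : ℤ) / 2) := by
  refine ⟨reflectAt_image_eq fun p hp => ?_,
    fun r d n hr e => absurd e (E_one_ne_rhombus hl hh hhl hr d n)⟩
  rw [mem_E_one hl hh hhl] at hp ⊢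
  obtain ⟨e₀, e₁, e₂, e₃⟩ := nu_reflectAt_four p
  rw [e₁, e₂, e₃]; tauto

/-- The edges with normals 5 and 6 meeting at the corner `p` fix the orientation n ≡ 3 mod 4. That
corner minimizes both `nu 1` and `nu 2`, so the centre has `nu 1` = `nu 2` and lies on the axis
through the origin. -/
theorem reflectAt_eq_of_rhombus {l h : ℝ} (hl : 0 < l) (hh : 0 < h) (hhl : h < l) {r : ℝ}
    (hr : 0 < r) {d : Plane} {n : ℤ} (e : E l h 2 = place d n (Q3 r)) :
    reflectAt 0 ((3 : ℤ) / 2) = reflectAt d (n + 5 / 2) := by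
  obtain ⟨t, ht₀, ht₁, ht₂⟩ := exists_small hh hhl
  have hg := sqrt_two_lt
  have hg' := sqrt_two_gt
  have hE : ∀ p ∈ place d n (Q3 r), l - h < nu 2 p ∧ l - h < nu 1 p ∧ nu 0 p < l - h ∧
      nu 3 p < l - h ∧ nu 2 p < l + h ∧ nu 1 p < l + h :=
    fun p hp => (mem_E_two hl hh).1 (e ▸ hp)
  have hcl : ∀ p, l - h ≤ nu 2 p → l - h ≤ nu 1 p → nu 0 p ≤ l - h → nu 3 p ≤ l - h →
      nu 2 p ≤ l + h → nu 1 p ≤ l + h → p ∈ closure (place d n (Q3 r)) :=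
    fun p h₁ h₂ h₃ h₄ h₅ h₆ => e ▸ mem_closure_E_two hl hh hhl h₁ h₂ h₃ h₄ h₅ h₆
  obtain ⟨p, p₁, p₂, p₃, p₀⟩ := exists_nu_one_two (l - h) (l - h)
  have hp : p ∈ closure (place d n (Q3 r)) := by
    refine hcl p ?_ ?_ ?_ ?_ ?_ ?_ <;> first | linarith | nlinarith
  have c₁ : (6 - n) % 4 = 2 ∨ (6 - n) % 4 = 3 := by
    obtain ⟨q, q₁, q₂, q₃, q₀⟩ := exists_nu_one_two (l - h + t) (l - h)
    refine rhombus_edge (k := 6) (b := -(l - h)) hr (fun p hp => ?_) (p := p) (q := q) ?_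
      hp (hcl q ?_ ?_ ?_ ?_ ?_ ?_) ?_ ?_
    · have := hE p hp; push_cast; rw [nu_six]; linarith
    · rintro rfl; linarith
    all_goals first | linarith | nlinarith | (push_cast; rw [nu_six]; linarith)
  have c₂ : (5 - n) % 4 = 2 ∨ (5 - n) % 4 = 3 := by
    obtain ⟨q, q₁, q₂, q₃, q₀⟩ := exists_nu_one_two (l - h) (l - h + t)
    refine rhombus_edge (k := 5) (b := -(l - h)) hr (fun p hp => ?_) (p := p) (q := q) ?_
      hp (hcl q ?_ ?_ ?_ ?_ ?_ ?_) ?_ ?_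
    · have := hE p hp; push_cast; rw [nu_five]; linarith
    · rintro rfl; linarith
    all_goals first | linarith | nlinarith | (push_cast; rw [nu_five]; linarith)
  obtain ⟨z, rfl⟩ : ∃ z : ℤ, n = 3 + 4 * z := ⟨n / 4, by omega⟩
  -- the centre of the rhombus is on the axis
  have sgn : ∃ ε : ℝ, (ε = 1 ∨ ε = -1) ∧ ∀ q, nu (3 + 4 * z + 2) q = ε * nu 1 q ∧
      nu (3 + 4 * z + 3) q = ε * nu 2 q := by
    rcases Int.even_or_odd' z with ⟨w, rfl | rfl⟩
    · refine ⟨-1, Or.inr rfl, fun q => ?_⟩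
      rw [← nu_add_eight_mul_int 1 w, ← nu_add_eight_mul_int 2 w, neg_one_mul, neg_one_mul,
        ← nu_add_four, ← nu_add_four]
      constructor <;> congr 1 <;> push_cast <;> ring
    · refine ⟨1, Or.inl rfl, fun q => ?_⟩
      rw [← nu_add_eight_mul_int 1 (w + 1), ← nu_add_eight_mul_int 2 (w + 1), one_mul, one_mul]
      constructor <;> congr 1 <;> push_cast <;> ring
  obtain ⟨ε, hε, sgn⟩ := sgn
  have hcr : ∀ q : Plane, q ∈ closure (place d ((3 + 4 * z : ℤ) : ℝ) (Q3 r)) ↔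
      |nu 1 q - nu 1 d| ≤ r ∧ |nu 2 q - nu 2 d| ≤ r := by
    intro q
    have ha : ∀ x y : ℝ, |ε * x - ε * y| = |x - y| := by
      intro x y
      rcases hε with rfl | rfl
      · simp
      · rw [← abs_neg]; congr 1; ring
    rw [mem_closure_rhombus hr]
    push_cast
    rw [(sgn q).1, (sgn d).1, (sgn q).2, (sgn d).2, ha, ha]
  have hlow : ∀ q : Plane, q ∈ closure (place d ((3 + 4 * z : ℤ) : ℝ) (Q3 r)) →
      l - h ≤ nu 1 q ∧ l - h ≤ nu 2 q := by
    intro q hq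
    constructor
    · have := nu_le_of_mem_closure (k := 5) (b := -(l - h))
        (fun p hp => by rw [nu_five]; linarith [(hE p hp).2.1]) hq
      rw [nu_five] at this; linarith
    · have := nu_le_of_mem_closure (k := 6) (b := -(l - h))
        (fun p hp => by rw [nu_six]; linarith [(hE p hp).1]) hq
      rw [nu_six] at this; linarith
  obtain ⟨q, q₁, q₂, -, -⟩ := exists_nu_one_two (nu 1 d - r) (nu 2 d - r)
  have hq := hlow q ((hcr q).2 (by rw [q₁, q₂]; simp [abs_of_pos hr]))
  have hp' := (hcr p).1 hp
  rw [abs_le, abs_le] at hp'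
  have hd : nu 1 d = nu 2 d := by linarith [hp'.1.1, hp'.2.1]
  have hdU : ∀ k, nu (3 - k) d = nu k d := by
    intro k
    have : U (3 / 2) d = d := by
      refine eq_of_nu (k := 1) ?_ ?_ <;> rw [nu_U] <;> norm_num [hd]
    conv_rhs => rw [← this]
    rw [nu_U]; congr 1; ring
  refine funext fun p => plane_ext' fun k => ?_
  have e8 : ∀ q, nu (2 * (((3 + 4 * z : ℤ) : ℝ) + 5 / 2) - k) q = nu (3 - k) q := fun q => by
    rw [← nu_add_eight_mul_int (3 - k) (z + 1)]; congr 1; push_cast; ring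
  rw [nu_reflectAt_zero, nu_reflectAt, e8, e8, hdU,
    show 2 * (((3 : ℤ) : ℝ) / 2) - k = 3 - k by push_cast; ring]
  ring

theorem isTileAxis_E_two {l h : ℝ} (hl : 0 < l) (hh : 0 < h) (hhl : h < l) :
    IsTileAxis (E l h 2) 0 ((3 : ℤ) / 2) := by
  refine ⟨reflectAt_image_eq fun p hp => ?_,
    fun r d n hr e => reflectAt_eq_of_rhombus hl hh hhl hr e⟩
  rw [mem_E_two hl hh] at hp ⊢
  obtain ⟨e₀, e₁, e₂, e₃⟩ := nu_reflectAt_three p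
  rw [e₀, e₁, e₂, e₃]; tauto

/-! ### The first two words -/

theorem reach_cons_one {l h : ℝ} {w : List ℕ} {p q : Plane} (hp : p ∈ atom l h 1)
    (hr : Reach l h w (R 5 p) q) : Reach l h (1 :: w) p q :=
  ⟨Or.inl rfl, hp, by rwa [rho_of_mem_one hp]⟩

theorem reach_cons_three {l h : ℝ} (hl : 0 < l) (hh : 0 < h) {w : List ℕ} {p q : Plane}
    (hp : p ∈ atom l h 3) (hr : Reach l h w (T (2 * l, 2 * l) (R 1 p)) q) :
    Reach l h (3 :: w) p q :=
  ⟨Or.inr rfl, hp, by rwa [rho_of_mem_three hl hh hp]⟩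

theorem E_one_subset {l h : ℝ} (hl : 0 < l) (hh : 0 < h) (hhl : h < l) :
    E l h 1 ⊆ entranceTile l h := fun p hp => by
  rw [mem_E_one hl hh hhl] at hp
  rw [mem_entranceTile hl]
  have := sqrt_two_mul_nu_zero p
  have := sqrt_two_mul_nu_two p
  have := sqrt_two_mul_nu_three p
  refine ⟨?_, ?_, ?_, ?_⟩ <;> first | linarith | nlinarith [sqrt_two_gt]

theorem E_two_subset {l h : ℝ} (hl : 0 < l) (hh : 0 < h) : E l h 2 ⊆ entranceTile l h :=
  fun p hp => by
    rw [mem_E_two hl hh] at hp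
    rw [mem_entranceTile hl]
    tauto

/-- Among the eight directions only 2 exceeds l - h. Each `R 5` raises the offending index by 5
modulo 8: 2, 7, 4, 1, 6, 3. The constraints of A₁ are in directions 0, 3, 5, so the sixth position
is the first violation. Finally R₅⁵ = R₁ = U_{5/2} U₂. -/
theorem reach_E_one {l h : ℝ} (hl : 0 < l) (hh : 0 < h) (hhl : h < l) {p : Plane}
    (hp : p ∈ E l h 1) :
    Reach l h [1, 1, 1, 1, 1] p (U (5 / 2) (reflectAt 0 ((4 : ℤ) / 2) p)) := by
  have he := (mem_entranceTile hl).1 (E_one_subset hl hh hhl hp)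
  rw [mem_E_one hl hh hhl] at hp
  have a := sqrt_two_mul_nu_two p
  have e : U (5 / 2) (reflectAt 0 ((4 : ℤ) / 2) p) = R 5 (R 5 (R 5 (R 5 (R 5 p)))) := by
    apply plane_ext <;>
      simp only [nu_U_axis, nu_reflectAt_four, nu_R_five, neg_neg]
  rw [e]
  have hn : -(l - h) < nu 0 p := by
    have := sqrt_two_mul_nu_zero p
    have := sqrt_two_mul_nu_one p
    nlinarith [sqrt_two_gt]
  have hn1 : -(l - h) < nu 1 p := by nlinarith [sqrt_two_gt]
  have hn3 : -(l - h) < nu 3 p := by nlinarith [sqrt_two_gt]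
  refine reach_cons_one ?_ (reach_cons_one ?_ (reach_cons_one ?_ (reach_cons_one ?_
    (reach_cons_one ?_ rfl)))) <;>
  · simp only [mem_atom_one, nu_R_five, neg_neg]
    refine ⟨?_, ?_, ?_⟩ <;> linarith

/-- Now directions 1 and 2 are both too large; they move to 6, 7 and then to 3, 4, which leaves A₁.
Moreover R₅² = R₂ = U_{5/2} U_{3/2}. -/
theorem reach_E_two {l h : ℝ} (hl : 0 < l) (hh : 0 < h) (hhl : h < l) {p : Plane}
    (hp : p ∈ E l h 2) : Reach l h [1, 1] p (U (5 / 2) (reflectAt 0 ((3 : ℤ) / 2) p)) := by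
  rw [mem_E_two hl hh] at hp
  have e : U (5 / 2) (reflectAt 0 ((3 : ℤ) / 2) p) = R 5 (R 5 p) := by
    apply plane_ext <;>
      simp only [nu_U_axis, nu_reflectAt_three, nu_R_five, neg_neg]
  rw [e]
  refine reach_cons_one ?_ (reach_cons_one ?_ rfl) <;>
  · simp only [mem_atom_one, nu_R_five, neg_neg]
    refine ⟨?_, ?_, ?_⟩ <;> linarith

/-! ### Renormalization -/

/-- The reversing isometry that embeds the arrowhead `Â(β l, h)` in `Â(l, h)`. -/
noncomputable def Phi (l : ℝ) (p : Plane) : Plane := T (-√2 * l, √2 * beta * l) (U 1 p)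

/-- The isometry that carries the tiles `E_j` of `Â(β l, h)` to the tiles `E_{j+2}`
of `Â(l, h)`. -/
noncomputable def Psi (l : ℝ) (p : Plane) : Plane := T (√2 * beta * l, √2 * l) (U 0 p)

theorem nu_Phi (l : ℝ) (p : Plane) :
    nu 0 (Phi l p) = -√2 * l + nu 2 p ∧ nu 1 (Phi l p) = √2 * l - 2 * l + nu 1 p ∧
    nu 2 (Phi l p) = 2 * l - √2 * l + nu 0 p ∧ nu 3 (Phi l p) = √2 * l - nu 3 p := by
  have h := sqrt_two_mul_self
  refine ⟨?_, ?_, ?_, ?_⟩ <;> rw [Phi, nu_T, nu_U] <;> norm_num1 <;>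
    simp only [nu_mk, nu_neg, beta, sub_zero] <;> norm_num1
  · linear_combination (√2 / 2 * l - l) * h
  · linear_combination l * h
  · linear_combination (√2 / 2 * l) * h

theorem nu_Psi (l : ℝ) (p : Plane) :
    nu 0 (Psi l p) = 2 * l - √2 * l + nu 0 p ∧ nu 1 (Psi l p) = √2 * l - nu 3 p ∧
    nu 2 (Psi l p) = √2 * l - nu 2 p ∧ nu 3 (Psi l p) = 2 * l - √2 * l - nu 1 p := by
  have h := sqrt_two_mul_self
  refine ⟨?_, ?_, ?_, ?_⟩ <;> rw [Psi, nu_T, nu_U] <;> norm_num1 <;>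
    simp only [nu_mk, nu_neg, beta, sub_zero] <;> norm_num1
  · linear_combination l * h
  · linear_combination (√2 / 2 * l) * h
  · ring
  · linear_combination (l - √2 / 2 * l) * h

/-- The inverse of `Psi l`. -/
noncomputable def PsiInv (l : ℝ) (p : Plane) : Plane := T (-(√2 * beta * l), √2 * l) (U 0 p)

theorem nu_PsiInv (l : ℝ) (p : Plane) :
    nu 0 (PsiInv l p) = √2 * l - 2 * l + nu 0 p ∧ nu 1 (PsiInv l p) = 2 * l - √2 * l - nu 3 p ∧
    nu 2 (PsiInv l p) = √2 * l - nu 2 p ∧ nu 3 (PsiInv l p) = √2 * l - nu 1 p := by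
  have h := sqrt_two_mul_self
  refine ⟨?_, ?_, ?_, ?_⟩ <;> rw [PsiInv, nu_T, nu_U] <;> norm_num1 <;>
    simp only [nu_mk, nu_neg, beta, sub_zero] <;> norm_num1
  · linear_combination -l * h
  · linear_combination (l - √2 / 2 * l) * h
  · ring
  · linear_combination (√2 / 2 * l) * h

theorem Psi_PsiInv (l : ℝ) (p : Plane) : Psi l (PsiInv l p) = p := by
  apply plane_ext <;> simp only [nu_Psi, nu_PsiInv] <;> ring

theorem PsiInv_Psi (l : ℝ) (p : Plane) : PsiInv l (Psi l p) = p := by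
  apply plane_ext <;> simp only [nu_Psi, nu_PsiInv] <;> ring

theorem mem_image_Psi {l : ℝ} {S : Set Plane} {p : Plane} : p ∈ Psi l '' S ↔ PsiInv l p ∈ S := by
  rw [Set.image_eq_preimage_of_inverse (PsiInv_Psi l) (Psi_PsiInv l)]; rfl

theorem Phi_injective (l : ℝ) : Function.Injective (Phi l) :=
  (T_injective _).comp (Function.LeftInverse.injective (U_U 1))

theorem Psi_injective (l : ℝ) : Function.Injective (Psi l) :=
  (T_injective _).comp (Function.LeftInverse.injective (U_U 0))

theorem continuous_Phi (l : ℝ) : Continuous (Phi l) := (continuous_T _).comp (continuous_U _)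

theorem continuous_Psi (l : ℝ) : Continuous (Psi l) := (continuous_T _).comp (continuous_U _)

/-- Time reversal exchanges the two embeddings. This makes the end of a renormalized orbit the
U-image of a point of the tile where it started. -/
theorem Phi_U (l : ℝ) (p : Plane) : Phi l (U (5 / 2) p) = U (5 / 2) (Psi l p) := by
  apply plane_ext <;> simp only [nu_Phi, nu_Psi, nu_U_axis] <;> ring

section

variable {l h : ℝ}

theorem R_R_Psi (p : Plane) : R 5 (R 5 (Psi l p)) = Phi l p := by
  apply plane_ext <;> simp only [nu_R_five, nu_Phi, nu_Psi] <;> ring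

theorem Psi_mem_entranceTile (hl : 0 < l) (hb : h < beta * l) {p : Plane}
    (hp : p ∈ entranceTile (beta * l) h) : Psi l p ∈ entranceTile l h := by
  rw [mem_entranceTile (mul_pos beta_pos hl)] at hp
  rw [mem_entranceTile hl]
  simp only [nu_Psi]
  have h₂ := sqrt_two_mul_nu_two p
  have h₁ : 0 < nu 1 p := by
    have : 0 < nu 2 p := by linarith
    nlinarith [sqrt_two_gt]
  rw [beta] at hp hb
  refine ⟨?_, ?_, ?_, ?_⟩ <;> linarith

theorem reach_Psi (hl : 0 < l) (hb : h < beta * l) {w : List ℕ} {p q : Plane}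
    (hp : p ∈ entranceTile (beta * l) h) (hr : Reach l h w (Phi l p) q) :
    Reach l h (1 :: 1 :: w) (Psi l p) q := by
  have he := Psi_mem_entranceTile hl hb hp
  rw [mem_entranceTile hl] at he
  have hβ := beta_lt
  have hhl : h < l := by nlinarith
  have h₂ := sqrt_two_mul_nu_two (Psi l p)
  have h₁ : 0 < nu 1 (Psi l p) := by
    have : 0 < nu 2 (Psi l p) := by linarith
    nlinarith [sqrt_two_gt]
  refine reach_cons_one ?_ (reach_cons_one ?_ (by rwa [R_R_Psi])) <;>
  · simp only [mem_atom_one, nu_R_five]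
    refine ⟨?_, ?_, ?_⟩ <;> linarith

/-- A₃ is exactly the embedded copy of the small A₁, so filling the small A₁ also fills A₃. -/
theorem Phi_mem_atom_three (hl : 0 < l) {p : Plane} :
    Phi l p ∈ atom l h 3 ↔ p ∈ atom (beta * l) h 1 := by
  rw [mem_atom_one, mem_atom_three hl]
  simp only [nu_Phi, beta]
  constructor <;> rintro ⟨h₁, h₂, h₃⟩ <;> refine ⟨?_, ?_, ?_⟩ <;> linarith

theorem rho_mem_atom_one (hl : 0 < l) (hh : 0 < h) {p : Plane} (hp : p ∈ atom l h 3) :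
    rho l h p ∈ atom l h 1 ∧ R 5 (rho l h p) ∈ atom l h 1 := by
  rw [rho_of_mem_three hl hh hp]
  rw [mem_atom_three hl] at hp
  have h₁ := sqrt_two_mul_nu_one p
  have h₀ : -(2 * (√2 * l)) - (l - h) < nu 0 p := by nlinarith [sqrt_two_gt]
  constructor <;>
  · simp only [mem_atom_one, nu_R_five, nu_T_R_one]
    refine ⟨?_, ?_, ?_⟩ <;> linarith

/-- The return map R₅ R₅ T R₁ has rotation part R₃ = R₋₅, the conjugate of R₅ by the reflection in
`Phi`; the translations match as well. -/
theorem reach_Phi_one (hl : 0 < l) (hh : 0 < h) {p : Plane}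
    (hp : p ∈ atom (beta * l) h 1) : Reach l h [3, 1, 1] (Phi l p) (Phi l (rho (beta * l) h p)) := by
  have h₃ := (Phi_mem_atom_three hl).2 hp
  have ⟨m₁, m₂⟩ := rho_mem_atom_one hl hh h₃
  rw [rho_of_mem_three hl hh h₃] at m₁ m₂
  refine reach_cons_three hl hh h₃ (reach_cons_one m₁ (reach_cons_one m₂ ?_))
  rw [rho_of_mem_one hp]
  apply plane_ext <;> simp only [nu_R_five, nu_T_R_one, nu_Phi] <;> ring

/-- Here R₅³ = R₇ is the conjugate of R₁. The small A₃ lies deep enough inside A₁ for three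
rotations to stay there. -/
theorem reach_Phi_three (hl : 0 < l) (hh : 0 < h) (hb : h < beta * l) {p : Plane}
    (hp : p ∈ atom (beta * l) h 3) :
    Reach l h [1, 1, 1] (Phi l p) (Phi l (rho (beta * l) h p)) := by
  have hl' := mul_pos beta_pos hl
  have hp' := (mem_atom_three hl').1 hp
  have ⟨l2, l3, l4⟩ := sqrt_two_powers l
  have hβ := beta_lt
  have hhl : h < l := by nlinarith
  have s₁ := sqrt_two_mul_nu_one p
  have s₂ := sqrt_two_mul_nu_two p
  have h₀ : -l < nu 0 p := by
    have e : (√2 + 1) * (beta * l) = l := by rw [beta]; linarith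
    nlinarith [sqrt_two_gt, mul_pos (show 0 < √2 by positivity) hh]
  have h₁ : nu 1 p < beta * l - h := by nlinarith [sqrt_two_gt, sqrt_two_lt]
  have g := sqrt_two_gt
  have g' : 0 < (√2 - 7 / 5) * l := mul_pos (by linarith) hl
  have g₂ : 0 < (17 / 12 - √2) * l := mul_pos (by linarith [sqrt_two_lt]) hl
  rw [beta] at hp' hb h₁
  refine reach_cons_one ?_ (reach_cons_one ?_ (reach_cons_one ?_ ?_))
  · simp only [mem_atom_one, nu_Phi]
    refine ⟨?_, ?_, ?_⟩ <;> linarith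
  · simp only [mem_atom_one, nu_R_five, nu_Phi]
    refine ⟨?_, ?_, ?_⟩ <;> linarith
  · simp only [mem_atom_one, nu_R_five, nu_Phi]
    refine ⟨?_, ?_, ?_⟩ <;> linarith
  · rw [rho_of_mem_three hl' hh hp]
    apply plane_ext <;> simp only [nu_R_five, nu_T_R_one, nu_Phi, beta] <;> ring

end

/-! ### Self-similarity of the strip, the tiles and the octagons -/

theorem nu_U_zero (p : Plane) : nu 0 (U 0 p) = nu 0 p ∧ nu 1 (U 0 p) = -nu 3 p ∧
    nu 2 (U 0 p) = -nu 2 p ∧ nu 3 (U 0 p) = -nu 1 p := by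
  refine ⟨?_, ?_, ?_, ?_⟩ <;> rw [nu_U] <;> norm_num [nu_neg]

/-- Raising j trades a factor β in l and flips the parity signs, which is reflection in the
horizontal axis. The hypothesis on `J` aligns the choice of shape on both sides. -/
theorem stripOdd_add_two {l h : ℝ} (hJ : J l h = J (beta * l) h + 1) (i : ℕ) :
    stripOdd l h (i + 2) = U 0 '' stripOdd (beta * l) h (i + 1) := by
  ext p
  obtain ⟨e₀, e₁, e₂, e₃⟩ := nu_U_zero p
  have hc : i + 2 + 2 ≤ J l h ↔ i + 1 + 2 ≤ J (beta * l) h := by omega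
  have e : i + 2 - 1 = i + 1 := rfl
  have e' : i + 1 - 1 = i := rfl
  rw [mem_image_U, stripOdd, stripOdd, e, e']
  simp only [hc]
  by_cases hi : Even i
  · have h₁ : Even (i + 2) := hi.add (by decide)
    have h₂ : ¬ Even (i + 1) := by simpa [Nat.even_add_one] using hi
    rw [if_pos h₁, if_neg h₂]
    simp only [pow_succ, hi.neg_one_pow]
    generalize beta ^ i = b
    split_ifs
    · rw [Q4, mem_place_polygon, Q4, mem_place_polygon]
      simp only [List.forall_mem_cons, List.not_mem_nil, false_imp_iff, implies_true, and_true]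
      norm_num1
      simp only [nu_reduce, nu_mk, e₀, e₁, e₂, e₃]
      constructor <;> rintro ⟨i1, i2, i3, i4⟩ <;> refine ⟨?_, ?_, ?_, ?_⟩ <;> linarith
    · rw [Q1, mem_place_polygon, Q1, mem_place_polygon]
      simp only [List.forall_mem_cons, List.not_mem_nil, false_imp_iff, implies_true, and_true]
      norm_num1
      simp only [nu_reduce, nu_mk, e₀, e₁, e₂, e₃]
      constructor <;> rintro ⟨i1, i2, i3⟩ <;> refine ⟨?_, ?_, ?_⟩ <;> linarith
  · have h₁ : ¬ Even (i + 2) := by simpa [Nat.even_add] using hi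
    have h₂ : Even (i + 1) := by simpa [Nat.even_add_one] using hi
    rw [if_neg h₁, if_pos h₂]
    simp only [pow_succ, (Nat.not_even_iff_odd.1 hi).neg_one_pow]
    generalize beta ^ i = b
    split_ifs
    · rw [Q4, mem_place_polygon, Q4, mem_place_polygon]
      simp only [List.forall_mem_cons, List.not_mem_nil, false_imp_iff, implies_true, and_true]
      norm_num1
      simp only [nu_reduce, nu_mk, e₀, e₁, e₂, e₃]
      constructor <;> rintro ⟨i1, i2, i3, i4⟩ <;> refine ⟨?_, ?_, ?_, ?_⟩ <;> linarith
    · rw [Q1, mem_place_polygon, Q1, mem_place_polygon]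
      simp only [List.forall_mem_cons, List.not_mem_nil, false_imp_iff, implies_true, and_true]
      norm_num1
      simp only [nu_reduce, nu_mk, e₀, e₁, e₂, e₃]
      constructor <;> rintro ⟨i1, i2, i3⟩ <;> refine ⟨?_, ?_, ?_⟩ <;> linarith

theorem stripEven_add_two {l h : ℝ} (hJ : J l h = J (beta * l) h + 1) (i : ℕ) :
    stripEven l h (i + 2) = U 0 '' stripEven (beta * l) h (i + 1) := by
  ext p
  obtain ⟨e₀, e₁, e₂, e₃⟩ := nu_U_zero p
  have hc : i + 2 + 2 ≤ J l h ↔ i + 1 + 2 ≤ J (beta * l) h := by omega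
  have hc' : i + 2 + 1 = J l h ↔ i + 1 + 1 = J (beta * l) h := by omega
  have e : i + 2 - 1 = i + 1 := rfl
  have e' : i + 1 - 1 = i := rfl
  rw [mem_image_U, stripEven, stripEven, e, e']
  simp only [hc, hc']
  by_cases hi : Even i
  · have h₁ : Even (i + 2) := hi.add (by decide)
    have h₂ : ¬ Even (i + 1) := by simpa [Nat.even_add_one] using hi
    simp only [if_pos h₁, if_neg h₂]
    simp only [pow_succ, hi.neg_one_pow]
    generalize beta ^ i = b
    split_ifs
    · rw [Q3, mem_place_polygon, mem_place_polygon]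
      simp only [List.forall_mem_cons, List.not_mem_nil, false_imp_iff, implies_true, and_true]
      norm_num1
      simp only [nu_reduce, nu_mk, e₀, e₁, e₂, e₃]
      constructor <;> rintro ⟨i1, i2, i3, i4⟩ <;> refine ⟨?_, ?_, ?_, ?_⟩ <;> linarith
    · rw [Q8, mem_place_polygon, Q8, mem_place_polygon]
      simp only [List.forall_mem_cons, List.not_mem_nil, false_imp_iff, implies_true, and_true]
      norm_num1
      simp only [nu_reduce, nu_mk, e₀, e₁, e₂, e₃]
      constructor <;> rintro ⟨i1, i2, i3, i4, i5, i6⟩ <;>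
        refine ⟨?_, ?_, ?_, ?_, ?_, ?_⟩ <;> linarith
    · rw [Q7, mem_place_polygon, Q7, mem_place_polygon]
      simp only [List.forall_mem_cons, List.not_mem_nil, false_imp_iff, implies_true, and_true]
      norm_num1
      simp only [nu_reduce, nu_mk, e₀, e₁, e₂, e₃]
      constructor <;> rintro ⟨i1, i2, i3, i4⟩ <;> refine ⟨?_, ?_, ?_, ?_⟩ <;> linarith
  · have h₁ : ¬ Even (i + 2) := by simpa [Nat.even_add] using hi
    have h₂ : Even (i + 1) := by simpa [Nat.even_add_one] using hi
    simp only [if_neg h₁, if_pos h₂]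
    simp only [pow_succ, (Nat.not_even_iff_odd.1 hi).neg_one_pow]
    generalize beta ^ i = b
    split_ifs
    · rw [Q3, mem_place_polygon, mem_place_polygon]
      simp only [List.forall_mem_cons, List.not_mem_nil, false_imp_iff, implies_true, and_true]
      norm_num1
      simp only [nu_reduce, nu_mk, e₀, e₁, e₂, e₃]
      constructor <;> rintro ⟨i1, i2, i3, i4⟩ <;> refine ⟨?_, ?_, ?_, ?_⟩ <;> linarith
    · rw [Q8, mem_place_polygon, Q8, mem_place_polygon]
      simp only [List.forall_mem_cons, List.not_mem_nil, false_imp_iff, implies_true, and_true]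
      norm_num1
      simp only [nu_reduce, nu_mk, e₀, e₁, e₂, e₃]
      constructor <;> rintro ⟨i1, i2, i3, i4, i5, i6⟩ <;>
        refine ⟨?_, ?_, ?_, ?_, ?_, ?_⟩ <;> linarith
    · rw [Q7, mem_place_polygon, Q7, mem_place_polygon]
      simp only [List.forall_mem_cons, List.not_mem_nil, false_imp_iff, implies_true, and_true]
      norm_num1
      simp only [nu_reduce, nu_mk, e₀, e₁, e₂, e₃]
      constructor <;> rintro ⟨i1, i2, i3, i4⟩ <;> refine ⟨?_, ?_, ?_, ?_⟩ <;> linarith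

theorem strip_add_two {l h : ℝ} (hJ : J l h = J (beta * l) h + 1) {j : ℕ} (hj : 1 ≤ j) :
    strip l h (j + 2) = U 0 '' strip (beta * l) h j := by
  rw [strip, strip, Nat.add_mod_right]
  split_ifs with hm
  · obtain ⟨i, rfl⟩ : ∃ i, j = 2 * i + 1 := ⟨j / 2, by omega⟩
    rw [show (2 * i + 1 + 2 + 1) / 2 = i + 2 by omega, show (2 * i + 1 + 1) / 2 = i + 1 by omega,
      stripOdd_add_two hJ]
  · obtain ⟨i, rfl⟩ : ∃ i, j = 2 * i + 2 := ⟨j / 2 - 1, by omega⟩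
    rw [show (2 * i + 2 + 2) / 2 = i + 2 by omega, show (2 * i + 2) / 2 = i + 1 by omega,
      stripEven_add_two hJ]

/-- When the small parameters are already in the base range, the small tiles are given by separate
formulas rather than by a strip, so the last two strip entries have to be matched by hand. -/
theorem E_add_two {l h : ℝ} (hl : 0 < l) (hh : 0 < h) (hb : h < beta * l) {j : ℕ} (hj : 1 ≤ j)
    (hj' : j ≤ 2 * J (beta * l) h) : E l h (j + 2) = Psi l '' E (beta * l) h j := by
  have hJ := J_succ hl hh hb
  have hl' := mul_pos beta_pos hl
  have ⟨l2, l3, l4⟩ := sqrt_two_powers l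
  have ⟨h2, h3, h4⟩ := sqrt_two_powers h
  rcases lt_or_ge h (beta * (beta * l)) with hc | hc
  · rw [E_of_lt hl hb, E_of_lt hl' hc, strip_add_two hJ hj, ← Set.image_comp, ← Set.image_comp]
    refine congrArg (· '' strip (beta * l) h j) (funext fun p => ?_)
    apply plane_ext <;> simp only [Function.comp, nu_T, nu_Psi, nu_U_zero, nu_mk, beta] <;> ring
  · have h1 := J_eq_one hl' hh hb hc
    rw [h1] at hJ hj'
    obtain rfl | rfl : j = 1 ∨ j = 2 := by omega
    · rw [E_of_lt hl hb, E_of_ge hl' hc, if_pos rfl, strip, if_pos (by decide), stripOdd,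
        image_T_place]
      norm_num [hJ]
      ext p
      obtain ⟨e₀, e₁, e₂, e₃⟩ := nu_PsiInv l p
      rw [mem_image_Psi, Q1, mem_place_polygon, Q1, mem_place_polygon]
      simp only [List.forall_mem_cons, List.not_mem_nil, false_imp_iff, implies_true, and_true]
      norm_num1
      simp only [nu_reduce, nu_mk, e₀, e₁, e₂, e₃, alpha, beta, pow_succ, pow_zero]
      constructor <;> rintro ⟨i1, i2, i3⟩ <;> refine ⟨?_, ?_, ?_⟩ <;> linarith
    · rw [E_of_lt hl hb, E_of_ge hl' hc, if_neg (by decide), strip, if_neg (by decide), stripEven,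
        hJ, if_neg (by decide), if_neg (by decide), if_pos (by decide), image_T_place]
      ext p
      obtain ⟨e₀, e₁, e₂, e₃⟩ := nu_PsiInv l p
      rw [mem_image_Psi, Q7, mem_place_polygon, Q7, mem_place_polygon]
      simp only [List.forall_mem_cons, List.not_mem_nil, false_imp_iff, implies_true, and_true,
        Prod.mk_add_mk]
      norm_num1
      simp only [nu_reduce, nu_mk, e₀, e₁, e₂, e₃, alpha, beta, omega, pow_succ, pow_zero]
      constructor <;> rintro ⟨i1, i2, i3, i4⟩ <;> refine ⟨?_, ?_, ?_, ?_⟩ <;> linarith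

theorem mem_octagon {l h : ℝ} {k : ℕ} {p : Plane} : p ∈ octagon l h k ↔
    ∀ m ∈ ({0, 1, 2, 3} : Set ℝ), |nu m p -
      nu m (if Even k then (-alpha * l * (1 - beta ^ k), 0) else (-alpha * l, alpha * beta ^ k * l))|
        < beta ^ k * l - h := by
  have hT : ∀ d : Plane, ∀ X : Set Plane, T d '' X = place d 0 X := fun d X => by
    rw [place, Set.image_comp, show R 0 = id from funext R_zero, Set.image_id]
  rw [octagon, hT, Q5, mem_place_polygon]
  generalize (if Even k then _ else _ : Plane) = d
  simp only [List.forall_mem_cons, List.not_mem_nil, false_imp_iff, implies_true, and_true,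
    zero_add, nu_reduce, Set.mem_insert_iff, Set.mem_singleton_iff, forall_eq_or_imp, forall_eq,
    abs_lt]
  constructor
  · rintro ⟨i0, i1, i2, i3, i4, i5, i6, i7⟩
    refine ⟨⟨?_, ?_⟩, ⟨?_, ?_⟩, ⟨?_, ?_⟩, ⟨?_, ?_⟩⟩ <;> linarith
  · rintro ⟨⟨i0, i1⟩, ⟨i2, i3⟩, ⟨i4, i5⟩, ⟨i6, i7⟩⟩
    refine ⟨?_, ?_, ?_, ?_, ?_, ?_, ?_, ?_⟩ <;> linarith

/-- `Phi` permutes the four directions up to sign, so it maps a regular octagon to one of the same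
size; only the centres need computation. -/
theorem octagon_succ (l h : ℝ) (k : ℕ) :
    octagon l h (k + 1) = Phi l '' octagon (beta * l) h k := by
  have hinv : ∀ p, Phi l (U 1 (T (√2 * l, -(√2 * beta * l)) p)) = p := fun p => by
    rw [Phi, U_U]; ext <;> simp [T]
  ext p
  obtain ⟨q, rfl⟩ : ∃ q, p = Phi l q := ⟨_, (hinv p).symm⟩
  rw [(Phi_injective l).mem_set_image, mem_octagon, mem_octagon]
  have hs := sqrt_two_mul_self
  simp only [Set.mem_insert_iff, Set.mem_singleton_iff, forall_eq_or_imp, forall_eq, nu_Phi,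
    Nat.even_add_one]
  have hd : ∀ d d' : Plane, Phi l d' = d →
      ((|-√2 * l + nu 2 q - nu 0 d| < beta ^ (k + 1) * l - h ∧
        |√2 * l - 2 * l + nu 1 q - nu 1 d| < beta ^ (k + 1) * l - h ∧
        |2 * l - √2 * l + nu 0 q - nu 2 d| < beta ^ (k + 1) * l - h ∧
        |√2 * l - nu 3 q - nu 3 d| < beta ^ (k + 1) * l - h) ↔
      |nu 0 q - nu 0 d'| < beta ^ k * (beta * l) - h ∧
        |nu 1 q - nu 1 d'| < beta ^ k * (beta * l) - h ∧
        |nu 2 q - nu 2 d'| < beta ^ k * (beta * l) - h ∧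
        |nu 3 q - nu 3 d'| < beta ^ k * (beta * l) - h) := by
    rintro d d' rfl
    simp only [nu_Phi, pow_succ, mul_assoc, add_sub_add_left_eq_sub, sub_sub_sub_cancel_left]
    rw [abs_sub_comm (nu 3 d')]
    tauto
  by_cases hk : Even k
  · rw [if_neg (not_not.2 hk), if_pos hk]
    refine hd _ _ (plane_ext ?_ ?_) <;> simp only [nu_Phi, nu_mk, alpha, pow_succ]
    · ring
    · rw [beta]; generalize (√2 - 1) ^ k = b
      linear_combination -l * hs
  · rw [if_pos hk, if_neg hk]
    refine hd _ _ (plane_ext ?_ ?_) <;> simp only [nu_Phi, nu_mk, alpha, pow_succ]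
    · ring
    · rw [beta]; generalize (√2 - 1) ^ k = b
      linear_combination -l * hs

/-! ### Transport of symmetry axes -/

theorem Psi_reflectAt (l : ℝ) (c p : Plane) (m : ℝ) :
    Psi l (reflectAt c m p) = reflectAt (Psi l c) (-m) (Psi l p) := by
  refine plane_ext' fun k => ?_
  have h : ∀ j q, nu j (Psi l q) = nu j (√2 * beta * l, √2 * l) + nu (-j) q := fun j q => by
    rw [Psi, nu_T, nu_U]; congr 2; ring
  rw [h, nu_reflectAt, nu_reflectAt, h, h, h, show -(2 * -m - k) = 2 * m - -k by ring]
  ring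

theorem IsTileAxis.image_Psi {S : Set Plane} {c : Plane} {m : ℝ} (hS : IsTileAxis S c m) (l : ℝ) :
    IsTileAxis (Psi l '' S) (Psi l c) (-m) := by
  constructor
  · refine reflectAt_image_eq ?_
    rintro _ ⟨p, hp, rfl⟩
    rw [← Psi_reflectAt]
    exact Set.mem_image_of_mem _ (hS.1 ▸ Set.mem_image_of_mem _ hp)
  · intro r d n hr e
    -- The reflection sends the edge normals n + 2, n + 3 to -(n + 2), -(n + 3). Up to sign these
    -- are m + 3, m + 2 for m = -n - 1.
    have e' : S = place (PsiInv l d) ((-n - 1 : ℤ) : ℝ) (Q3 r) := by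
      ext p
      have h : p ∈ S ↔ Psi l p ∈ Psi l '' S := ((Psi_injective l).mem_set_image).symm
      rw [h, e, mem_rhombus, mem_rhombus]
      have hn : ∀ j q, nu j (Psi l q) = nu j (√2 * beta * l, √2 * l) + nu (-j) q := fun j q => by
        rw [Psi, nu_T, nu_U]; congr 2; ring
      have e₂ : ∀ q, nu (-((n : ℝ) + 2)) q = -nu (((-n - 1 : ℤ) : ℝ) + 3) q := fun q => by
        rw [← nu_add_four, ← nu_add_eight]; congr 1; push_cast; ring
      have e₃ : ∀ q, nu (-((n : ℝ) + 3)) q = -nu (((-n - 1 : ℤ) : ℝ) + 2) q := fun q => by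
        rw [← nu_add_four, ← nu_add_eight]; congr 1; push_cast; ring
      have a : ∀ x y z : ℝ, |x + -y - (x + -z)| = |y - z| := fun x y z => by
        rw [abs_sub_comm y]; congr 1; ring
      conv_lhs => rw [← Psi_PsiInv l d]
      rw [hn, hn, hn, hn, e₂, e₂, e₃, e₃, a, a, and_comm]
    have := hS.2 r _ _ hr e'
    refine funext fun p => ?_
    rw [← Psi_PsiInv l p, ← Psi_reflectAt, this, Psi_reflectAt, Psi_PsiInv]
    refine plane_ext' fun k => ?_
    have e8 : ∀ q, nu (2 * -(((-n - 1 : ℤ) : ℝ) + 5 / 2) - k) q =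
        nu (2 * ((n : ℝ) + 5 / 2) - k) q := fun q => by
      rw [← nu_add_eight]; congr 1; push_cast; ring
    rw [nu_reflectAt, nu_reflectAt, e8, e8]

/-! ### Words of the transfer orbits -/

/-- The common path of the points of `E_j`. -/
def word : ℕ → List ℕ
  | 0 => []
  | 1 => [1, 1, 1, 1, 1]
  | 2 => [1, 1]
  | j + 3 => 1 :: 1 :: sigma (word (j + 1))

theorem word_add_two {j : ℕ} (hj : 1 ≤ j) : word (j + 2) = 1 :: 1 :: sigma (word j) := by
  obtain ⟨i, rfl⟩ := Nat.exists_eq_add_of_le' hj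
  rfl

theorem sigma_cons (a : ℕ) (w : List ℕ) :
    sigma (a :: w) = (if a = 1 then [3, 1, 1] else [1, 1, 1]) ++ sigma w := by
  simp [sigma]

theorem length_sigma (w : List ℕ) : (sigma w).length = 3 * w.length := by
  induction w with
  | nil => rfl
  | cons a w ih =>
    rw [sigma_cons, List.length_append, ih, List.length_cons]
    split_ifs <;> simp <;> ring

theorem sigmaPow_succ (k : ℕ) : sigmaPow (k + 1) = sigma (sigmaPow k) :=
  Function.iterate_succ_apply' _ _ _

theorem length_sigmaPow (k : ℕ) : (sigmaPow k).length = 3 ^ k := by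
  induction k with
  | zero => rfl
  | succ k ih => rw [sigmaPow_succ, length_sigma, ih, pow_succ']

theorem reach_sigma {l h : ℝ} (hl : 0 < l) (hh : 0 < h) (hb : h < beta * l) {w : List ℕ}
    {p q : Plane} (hr : Reach (beta * l) h w p q) :
    Reach l h (sigma w) (Phi l p) (Phi l q) := by
  induction w generalizing p with
  | nil => exact congrArg _ hr
  | cons a w ih =>
    rw [sigma_cons, reach_append]
    refine ⟨_, ?_, ih hr.2.2⟩
    obtain ⟨rfl | rfl, hp, -⟩ := hr
    · exact reach_Phi_one hl hh hp
    · exact reach_Phi_three hl hh hb hp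

/-- Induction along the renormalization `l ↦ β l`. -/
theorem renormalization_induction {h : ℝ} (hh : 0 < h) {P : ℝ → Prop}
    (base : ∀ l, h < l → beta * l ≤ h → P l) (step : ∀ l, 0 < l → h < beta * l → P (beta * l) → P l)
    {l : ℝ} (hhl : h < l) : P l := by
  induction hn : J l h generalizing l with
  | zero => have := J_pos (hh.trans hhl) hh hhl; omega
  | succ n ih =>
    have hl := hh.trans hhl
    rcases lt_or_ge h (beta * l) with hb | hb
    · exact step l hl hb (ih hb (by have := J_succ hl hh hb; omega))
    · exact base l hhl hb

/-! ### The transfer orbits -/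

/-- What the transfer map does with a tile `S` all of whose points have the path `w`. -/
def TransferTile (l h : ℝ) (w : List ℕ) (S : Set Plane) : Prop :=
  IsPolygonal S ∧ S.Nonempty ∧ S ⊆ entranceTile l h ∧ ∃ (c : Plane) (n : ℤ),
    IsTileAxis S c (n / 2) ∧ ∀ p ∈ S, Reach l h w p (U (5 / 2) (reflectAt c (n / 2) p))

theorem transferTile_one {l h : ℝ} (hl : 0 < l) (hh : 0 < h) (hhl : h < l) :
    TransferTile l h (word 1) (E l h 1) :=
  ⟨⟨_, E_one_eq hl hh hhl⟩, E_one_nonempty hl hh hhl, E_one_subset hl hh hhl, 0, 4,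
    isTileAxis_E_one hl hh hhl, fun _ hp => reach_E_one hl hh hhl hp⟩

theorem transferTile_two {l h : ℝ} (hl : 0 < l) (hh : 0 < h) (hhl : h < l) :
    TransferTile l h (word 2) (E l h 2) :=
  ⟨⟨_, E_two_eq hl hh⟩, E_two_nonempty hl hh hhl, E_two_subset hl hh, 0, 3,
    isTileAxis_E_two hl hh hhl, fun _ hp => reach_E_two hl hh hhl hp⟩

theorem lt_of_lt_beta_mul {l h : ℝ} (hl : 0 < l) (hb : h < beta * l) : h < l := by
  nlinarith [beta_lt]

/-- E₁ and E₂ are treated directly at every scale; all later tiles are `Psi`-images of tiles of the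
small arrowhead. -/
theorem transferTile_E {l h : ℝ} (hh : 0 < h) (hhl : h < l) :
    ∀ j, 1 ≤ j → j ≤ 2 * J l h → TransferTile l h (word j) (E l h j) := by
  refine renormalization_induction hh (P := fun l => ∀ j, 1 ≤ j → j ≤ 2 * J l h →
    TransferTile l h (word j) (E l h j)) (fun l hhl hb j hj hj' => ?_)
    (fun l hl hb ih j hj hj' => ?_) hhl
  · rw [J_eq_one (hh.trans hhl) hh hhl hb] at hj'
    obtain rfl | rfl : j = 1 ∨ j = 2 := by omega
    · exact transferTile_one (hh.trans hhl) hh hhl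
    · exact transferTile_two (hh.trans hhl) hh hhl
  · have hhl := lt_of_lt_beta_mul hl hb
    obtain rfl | rfl | ⟨i, hi, rfl⟩ : j = 1 ∨ j = 2 ∨ ∃ i, 1 ≤ i ∧ j = i + 2 := by
      by_cases h₁ : j = 1
      · exact Or.inl h₁
      by_cases h₂ : j = 2
      · exact Or.inr (Or.inl h₂)
      · exact Or.inr (Or.inr ⟨j - 2, by omega, by omega⟩)
    · exact transferTile_one hl hh hhl
    · exact transferTile_two hl hh hhl
    · have hi' : i ≤ 2 * J (beta * l) h := by have := J_succ hl hh hb; omega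
      obtain ⟨h₁, h₂, h₃, c, n, h₄, h₅⟩ := ih i hi hi'
      rw [E_add_two hl hh hb hi hi', word_add_two hi]
      refine ⟨?_, h₂.image _, ?_, Psi l c, -n, ?_, ?_⟩
      · have : Psi l = T (√2 * beta * l, √2 * l) ∘ U 0 := rfl
        rw [this, Set.image_comp]
        exact (h₁.image_U 0).image_T _
      · rintro _ ⟨p, hp, rfl⟩
        exact Psi_mem_entranceTile hl hb (h₃ hp)
      · have := h₄.image_Psi l
        rwa [← neg_div, ← Int.cast_neg] at this
      · rintro _ ⟨p, hp, rfl⟩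
        refine reach_Psi hl hb (h₃ hp) ?_
        have := reach_sigma hl hh hb (h₅ p hp)
        rw [Phi_U, Psi_reflectAt, ← neg_div, ← Int.cast_neg] at this
        exact this

/-! ### The periodic octagons -/

theorem mem_octagon_zero {l h : ℝ} {p : Plane} : p ∈ octagon l h 0 ↔
    |nu 0 p| < l - h ∧ |nu 1 p| < l - h ∧ |nu 2 p| < l - h ∧ |nu 3 p| < l - h := by
  rw [mem_octagon]
  simp [nu_mk]

/-- The central octagon is invariant under `R 5`, with inverse `R 3`, and `Phi` carries this up the
renormalization. The last clause gives surjectivity of the return. -/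
theorem octagon_spec {l h : ℝ} (hh : 0 < h) (hhl : h < l) : ∀ k < J l h,
    (octagon l h k).Nonempty ∧
    (∀ p ∈ octagon l h k, ∃ q ∈ octagon l h k, Reach l h (sigmaPow k) p q) ∧
    ∀ q ∈ octagon l h k, ∃ p ∈ octagon l h k, Reach l h (sigmaPow k) p q := by
  have h0 : ∀ l, h < l → (octagon l h 0).Nonempty ∧
      (∀ p ∈ octagon l h 0, ∃ q ∈ octagon l h 0, Reach l h (sigmaPow 0) p q) ∧
      ∀ q ∈ octagon l h 0, ∃ p ∈ octagon l h 0, Reach l h (sigmaPow 0) p q := by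
    intro l hhl
    have hA : ∀ p ∈ octagon l h 0, p ∈ atom l h 1 := fun p hp => by
      simp only [mem_octagon_zero, abs_lt] at hp
      rw [mem_atom_one]
      refine ⟨?_, ?_, ?_⟩ <;> linarith
    refine ⟨⟨0, mem_octagon_zero.2 (by simp [nu, hhl])⟩, fun p hp => ⟨R 5 p, ?_, ?_⟩,
      fun q hq => ⟨R 3 q, ?_, ?_⟩⟩
    · simp only [mem_octagon_zero, nu_R_five, abs_neg] at hp ⊢
      tauto
    · exact reach_cons_one (hA p hp) rfl
    · rw [mem_octagon_zero] at hq ⊢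
      have : ∀ k : ℝ, nu k (R 3 q) = nu (k - 3) q := fun k => nu_R k 3 q
      norm_num [this, nu_neg, nu_reduce]
      tauto
    · have e : R 5 (R 3 q) = q := by
        rw [R_R, show (5 + 3 : ℝ) = 0 + 8 by norm_num, R_add_eight, R_zero]
      refine reach_cons_one (hA _ ?_) e
      rw [mem_octagon_zero] at hq ⊢
      have : ∀ k : ℝ, nu k (R 3 q) = nu (k - 3) q := fun k => nu_R k 3 q
      norm_num [this, nu_neg, nu_reduce]
      tauto
  refine renormalization_induction hh (P := fun l => ∀ k < J l h, (octagon l h k).Nonempty ∧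
    (∀ p ∈ octagon l h k, ∃ q ∈ octagon l h k, Reach l h (sigmaPow k) p q) ∧
    ∀ q ∈ octagon l h k, ∃ p ∈ octagon l h k, Reach l h (sigmaPow k) p q)
    (fun l hhl hb k hk => ?_) (fun l hl hb ih k hk => ?_) hhl
  · rw [J_eq_one (hh.trans hhl) hh hhl hb] at hk
    obtain rfl : k = 0 := by omega
    exact h0 l hhl
  · cases k with
    | zero => exact h0 l (lt_of_lt_beta_mul hl hb)
    | succ k =>
      obtain ⟨h₁, h₂, h₃⟩ := ih k (by have := J_succ hl hh hb; omega)
      rw [octagon_succ, sigmaPow_succ]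
      refine ⟨h₁.image _, ?_, ?_⟩
      · rintro _ ⟨p, hp, rfl⟩
        obtain ⟨q, hq, hr⟩ := h₂ p hp
        exact ⟨_, Set.mem_image_of_mem _ hq, reach_sigma hl hh hb hr⟩
      · rintro _ ⟨p, hp, rfl⟩
        obtain ⟨q, hq, hr⟩ := h₃ p hp
        exact ⟨_, Set.mem_image_of_mem _ hq, reach_sigma hl hh hb hr⟩

/-! ### Covering -/

/-- The device for all covering arguments: inside an open set only a dense set of points need be
examined, so cutting lines and tile boundaries can be ignored. -/
theorem map_mem_closure_of_isOpen {O Y Z : Set Plane} {f : Plane → Plane} (hO : IsOpen O)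
    (hf : Continuous f) (hY : O ⊆ closure Y) (h : ∀ x ∈ O, x ∈ Y → f x ∈ closure Z) {p : Plane}
    (hp : p ∈ O) : f p ∈ closure Z := by
  have h₁ : p ∈ closure (O ∩ Y) := hO.inter_closure ⟨hp, hY hp⟩
  have h₂ := map_mem_closure hf h₁ (t := closure Z) fun x hx => h x hx.1 hx.2
  rwa [closure_closure] at h₂

theorem subset_closure_lines (O : Set Plane) (es : List (ℝ × ℝ)) :
    O ⊆ closure {p | ∀ e ∈ es, nu e.1 p ≠ e.2} := fun p _ =>
  closure_mono Set.inter_subset_right (subset_closure_generic isOpen_univ es (Set.mem_univ p))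

/-- The union of the tiles `E_j`. -/
noncomputable def entranceSet (l h : ℝ) : Set Plane := ⋃ j ∈ Set.Icc 1 (2 * J l h), E l h j

theorem entranceTile_isPolygonal (l h : ℝ) : IsPolygonal (entranceTile l h) :=
  (isPolygonal_atom l h 2).image_U _

theorem mem_E_one_of {l h : ℝ} (hl : 0 < l) (hh : 0 < h) (hhl : h < l) {p : Plane}
    (hp : p ∈ entranceTile l h) (h₁ : nu 1 p < l - h) : p ∈ E l h 1 := by
  rw [mem_entranceTile hl] at hp
  rw [mem_E_one hl hh hhl]
  tauto

theorem le_of_beta_mul_le {l h : ℝ} (hb : beta * l ≤ h) : (√2 + 1) * (l - h) ≤ l + h := by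
  rw [beta] at hb
  have := sqrt_two_powers l
  nlinarith [sqrt_two_gt]

theorem mem_image_Psi_entranceTile {l h : ℝ} (hl : 0 < l) {p : Plane}
    (hp : p ∈ entranceTile l h) (h₁ : l + h < nu 1 p) :
    p ∈ Psi l '' entranceTile (beta * l) h := by
  rw [mem_entranceTile hl] at hp
  rw [mem_image_Psi, mem_entranceTile (mul_pos beta_pos hl), beta]
  simp only [nu_PsiInv]
  refine ⟨?_, ?_, ?_, ?_⟩ <;> linarith

/-- The lines `nu 1` = l ∓ h cut the entrance tile into E₁, E₂ and the `Psi`-image of the small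
entrance tile. If h ≥ β l, then `nu 1` < ω(l - h) ≤ l + h and the third piece is empty. -/
theorem entranceTile_subset {l h : ℝ} (hh : 0 < h) (hhl : h < l) :
    entranceTile l h ⊆ closure (entranceSet l h) := by
  have hE : ∀ {l : ℝ} {j : ℕ} {p : Plane}, 1 ≤ j → j ≤ 2 * J l h → p ∈ E l h j →
      p ∈ closure (entranceSet l h) := fun h₁ h₂ hp =>
    subset_closure (Set.mem_biUnion (Set.mem_Icc.2 ⟨h₁, h₂⟩) hp)
  refine renormalization_induction hh (P := fun l => entranceTile l h ⊆ closure (entranceSet l h))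
    (fun l hhl hb p hp => ?_) (fun l hl hb ih p hp => ?_) hhl
  · have hl := hh.trans hhl
    have hJ := J_pos hl hh hhl
    refine map_mem_closure_of_isOpen (f := id) (entranceTile_isPolygonal l h).isOpen
      continuous_id (subset_closure_lines _ [(1, l - h)]) (fun x hx hg => ?_) hp
    simp only [List.forall_mem_cons, List.not_mem_nil, false_imp_iff, implies_true, and_true,
      Set.mem_ofPred_eq] at hg
    rcases lt_or_gt_of_ne hg with hg | hg
    · exact hE le_rfl (by omega) (mem_E_one_of hl hh hhl hx hg)
    · refine hE (j := 2) (p := x) (by norm_num) (by omega) ((mem_E_two hl hh).2 ?_)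
      rw [mem_entranceTile hl] at hx
      have := le_of_beta_mul_le hb
      have := sqrt_two_mul_nu_two x
      have := sqrt_two_mul_nu_zero x
      refine ⟨?_, ?_, ?_, ?_, ?_, ?_⟩ <;> first | linarith | nlinarith [sqrt_two_gt]
  · have hhl := lt_of_lt_beta_mul hl hb
    have hJ := J_pos hl hh hhl
    refine map_mem_closure_of_isOpen (f := id) (entranceTile_isPolygonal l h).isOpen
      continuous_id (subset_closure_lines _ [(1, l - h), (1, l + h)]) (fun x hx hg => ?_) hp
    simp only [List.forall_mem_cons, List.not_mem_nil, false_imp_iff, implies_true, and_true,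
      Set.mem_ofPred_eq] at hg
    rcases lt_or_gt_of_ne hg.1 with hg₁ | hg₁
    · exact hE le_rfl (by omega) (mem_E_one_of hl hh hhl hx hg₁)
    rcases lt_or_gt_of_ne hg.2 with hg₂ | hg₂
    · refine hE (j := 2) (p := x) (by norm_num) (by omega) ((mem_E_two hl hh).2 ?_)
      rw [mem_entranceTile hl] at hx
      tauto
    · obtain ⟨y, hy, rfl⟩ := mem_image_Psi_entranceTile hl hx hg₂
      refine map_mem_closure_of_isOpen (f := Psi l) (entranceTile_isPolygonal (beta * l) h).isOpen
        (continuous_Psi l) ih (fun z _ hz => ?_) hy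
      obtain ⟨j, hj, hz⟩ := Set.mem_iUnion₂.1 hz
      refine hE (j := j + 2) (by omega) (by have := J_succ hl hh hb; have := hj.2; omega) ?_
      rw [E_add_two hl hh hb hj.1 hj.2]
      exact Set.mem_image_of_mem _ hz

/-- The union of the tiles of the transfer orbits and of the periodic orbits. -/
noncomputable def orbitSet (l h : ℝ) : Set Plane :=
  {x | (∃ j, 1 ≤ j ∧ j ≤ 2 * J l h ∧ ∃ t ≤ (word j).length, ∃ p ∈ E l h j, (rho l h)^[t] p = x) ∨
    ∃ k < J l h, ∃ t < 3 ^ k, ∃ p ∈ octagon l h k, (rho l h)^[t] p = x}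

section

variable {l h : ℝ}

theorem reach_of_mem_E (hh : 0 < h) (hhl : h < l) {j : ℕ} (hj : 1 ≤ j) (hj' : j ≤ 2 * J l h)
    {p : Plane} (hp : p ∈ E l h j) : ∃ q ∈ exitTile l h, Reach l h (word j) p q := by
  obtain ⟨-, -, h₃, c, n, h₄, h₅⟩ := transferTile_E hh hhl j hj hj'
  refine ⟨_, ?_, h₅ p hp⟩
  have : reflectAt c (n / 2) p ∈ E l h j := h₄.1 ▸ Set.mem_image_of_mem _ hp
  have := h₃ this
  rwa [entranceTile, mem_image_U] at this

theorem iterate_rho_eq {n : ℕ} {p q : Plane} (hr : Reach l h (List.replicate n 1) p q) {i : ℕ}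
    (hi : i ≤ n) : (rho l h)^[i] p = (R 5)^[i] p := by
  induction n generalizing p i with
  | zero => obtain rfl : i = 0 := by omega
            rfl
  | succ n ih =>
    cases i with
    | zero => rfl
    | succ i =>
      rw [List.replicate_succ] at hr
      rw [Function.iterate_succ_apply, ih hr.2.2 (by omega), rho_of_mem_one hr.2.1,
        Function.iterate_succ_apply]

/-- Time t of a small transfer orbit becomes time 3t + 2 of the large one, and time t of an octagon
orbit becomes 3t. The extra `i` reaches the two intermediate positions inside a substituted letter.
-/
theorem Phi_mem_orbitSet (hl : 0 < l) (hh : 0 < h) (hb : h < beta * l) {x : Plane}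
    (hx : x ∈ orbitSet (beta * l) h) {i : ℕ} (hi : i ≤ 2)
    (hi' : i = 0 ∨ x ∈ atom (beta * l) h 1 ∨ x ∈ atom (beta * l) h 3) :
    (rho l h)^[i] (Phi l x) ∈ orbitSet l h := by
  have hJ := J_succ hl hh hb
  have hl' := mul_pos beta_pos hl
  rcases hx with ⟨j, hj, hj', t, ht, p, hp, rfl⟩ | ⟨k, hk, t, ht, p, hp, rfl⟩
  · obtain ⟨q, hq, hr⟩ := reach_of_mem_E hh hb hj hj' hp
    -- If i > 0 the point must not yet be in the exit tile, since no letter follows there.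
    have hlen : i + 3 * t ≤ 3 * (word j).length := by
      rcases hi' with rfl | hi'
      · omega
      · have : t ≠ (word j).length := by
          rintro rfl
          rw [hr.eq_iterate] at hi'
          rcases hi' with hi' | hi'
          · have := atoms_disjoint hl' hh (by simp) (by simp) hi' hq; omega
          · have := atoms_disjoint hl' hh (by simp) (by simp) hi' hq; omega
        omega
    have h₃ := (transferTile_E hh hb j hj hj').2.2.1 hp
    have := reach_Psi hl hb h₃ (reach_sigma hl hh hb (hr.take ht))
    have := this.eq_iterate
    refine Or.inl ⟨j + 2, by omega, by omega, i + (3 * t + 2), ?_, Psi l p, ?_, ?_⟩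
    · rw [word_add_two hj, List.length_cons, List.length_cons, length_sigma]; omega
    · rw [E_add_two hl hh hb hj hj']
      exact Set.mem_image_of_mem _ hp
    · rw [Function.iterate_add_apply, ← this, List.length_cons, List.length_cons, length_sigma,
        List.length_take, min_eq_left ht]
  · obtain ⟨-, h₂, -⟩ := octagon_spec hh hb k hk
    obtain ⟨q, hq, hr⟩ := h₂ p hp
    have ht' : t ≤ (sigmaPow k).length := by rw [length_sigmaPow]; omega
    have := (reach_sigma hl hh hb (hr.take ht')).eq_iterate
    refine Or.inr ⟨k + 1, by omega, i + 3 * t, by rw [pow_succ]; omega, Phi l p, ?_, ?_⟩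
    · rw [octagon_succ]
      exact Set.mem_image_of_mem _ hp
    · rw [Function.iterate_add_apply, ← this, length_sigma, List.length_take, min_eq_left ht']

theorem R_five_R_three (p : Plane) : R 5 (R 3 p) = p := by
  rw [R_R, show (5 + 3 : ℝ) = 0 + 8 by norm_num, R_add_eight, R_zero]

theorem nu_R_three (p : Plane) : nu 0 (R 3 p) = -nu 1 p ∧ nu 1 (R 3 p) = -nu 2 p ∧
    nu 2 (R 3 p) = -nu 3 p ∧ nu 3 (R 3 p) = nu 0 p := by
  refine ⟨?_, ?_, ?_, ?_⟩ <;> rw [nu_R] <;> norm_num [nu_neg, nu_reduce]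

theorem continuous_R_iterate (m : ℝ) (i : ℕ) : Continuous (R m)^[i] := (continuous_R m).iterate i

theorem continuous_T_R (l : ℝ) : Continuous fun p => T (2 * l, 2 * l) (R 1 p) :=
  (continuous_T _).comp (continuous_R 1)

/-- If the orbits fill the two parts of the set of points that enter the first atom, in every
position, then they fill the first atom. -/
theorem atom_one_subset_of {Z : Set Plane} (ho : octagon l h 0 ⊆ Z)
    (hB : ∀ p : Plane, l - h < nu 2 p → nu 1 p < l - h → nu 3 p < l - h →
      ∀ i ≤ 4, (R 5)^[i] p ∈ closure Z)
    (hC : ∀ p : Plane, l - h < nu 2 p → l - h < nu 1 p → nu 0 p < l - h → nu 3 p < l - h →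
      ∀ i ≤ 1, (R 5)^[i] p ∈ closure Z) : atom l h 1 ⊆ closure Z := by
  intro p hp
  refine map_mem_closure_of_isOpen (f := id) (isPolygonal_atom l h 1).isOpen continuous_id
    (subset_closure_lines _ [(1, l - h), (2, l - h), (0, -(l - h)), (2, -(l - h)), (3, -(l - h))])
    (fun x hx hg => ?_) hp
  simp only [List.forall_mem_cons, List.not_mem_nil, false_imp_iff, implies_true, and_true,
    Set.mem_ofPred_eq] at hg
  obtain ⟨g₁, g₂, g₄, g₆, g₇⟩ := hg
  obtain ⟨a₀, a₃, a₅⟩ := mem_atom_one.1 hx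
  rw [id_eq]
  have e := R_five_R_three
  -- The directions not bounded by A₁ are 1, 2, 4, 6, 7. If none exceeds l - h, the point is in the
  -- octagon. Otherwise the excess is rotated back to direction 2 along 2, 7, 4, 1, 6; the pair 6, 7
  -- goes back to 1, 2.
  rcases lt_or_gt_of_ne g₂ with g₂ | g₂
  · rcases lt_or_gt_of_ne g₇ with g₇ | g₇
    · have : (R 5)^[1] (R 3 x) = x := e x
      rw [← this]
      rcases lt_or_gt_of_ne g₆ with g₆ | g₆
      · refine hC _ ?_ ?_ ?_ ?_ 1 le_rfl <;> simp only [nu_R_three] <;> linarith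
      · refine hB _ ?_ ?_ ?_ 1 (by norm_num) <;> simp only [nu_R_three] <;> linarith
    · rcases lt_or_gt_of_ne g₄ with g₄ | g₄
      · have : (R 5)^[2] (R 3 (R 3 x)) = x := by simp [e]
        rw [← this]
        refine hB _ ?_ ?_ ?_ 2 (by norm_num) <;> simp only [nu_R_three] <;> linarith
      · rcases lt_or_gt_of_ne g₁ with g₁ | g₁
        · rcases lt_or_gt_of_ne g₆ with g₆ | g₆
          · have : (R 5)^[4] (R 3 (R 3 (R 3 (R 3 x)))) = x := by simp [e]
            rw [← this]
            refine hB _ ?_ ?_ ?_ 4 (by norm_num) <;> simp only [nu_R_three] <;> linarith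
          · refine subset_closure (ho (mem_octagon_zero.2 ?_))
            simp only [abs_lt]
            refine ⟨⟨?_, ?_⟩, ⟨?_, ?_⟩, ⟨?_, ?_⟩, ⟨?_, ?_⟩⟩ <;> linarith
        · have : (R 5)^[3] (R 3 (R 3 (R 3 x))) = x := by simp [e]
          rw [← this]
          refine hB _ ?_ ?_ ?_ 3 (by norm_num) <;> simp only [nu_R_three] <;> linarith
  · rcases lt_or_gt_of_ne g₁ with g₁ | g₁
    · exact hB _ g₂ g₁ a₃ 0 (by norm_num)
    · exact hC _ g₂ g₁ a₀ a₃ 0 (by norm_num)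

theorem octagon_zero_subset (hl : 0 < l) (hh : 0 < h) (hhl : h < l) :
    octagon l h 0 ⊆ orbitSet l h := fun p hp =>
  Or.inr ⟨0, J_pos hl hh hhl, 0, by norm_num, p, hp, rfl⟩

theorem E_one_iterate (hl : 0 < l) (hh : 0 < h) (hhl : h < l) {p : Plane} (hp : p ∈ E l h 1)
    {i : ℕ} (hi : i ≤ 5) : (R 5)^[i] p ∈ orbitSet l h := by
  refine Or.inl ⟨1, le_rfl, by have := J_pos hl hh hhl; omega, i, hi, p, hp, ?_⟩
  exact iterate_rho_eq (n := 5) (reach_E_one hl hh hhl hp) hi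

theorem E_two_iterate (hl : 0 < l) (hh : 0 < h) (hhl : h < l) {p : Plane} (hp : p ∈ E l h 2)
    {i : ℕ} (hi : i ≤ 2) : (R 5)^[i] p ∈ orbitSet l h := by
  refine Or.inl ⟨2, by norm_num, by have := J_pos hl hh hhl; omega, i, hi, p, hp, ?_⟩
  exact iterate_rho_eq (n := 2) (reach_E_two hl hh hhl hp) hi

theorem isOpen_of_polygon {S : Set Plane} (es : List (ℝ × ℝ)) (e : S = polygon es) : IsOpen S :=
  e ▸ (isPolygonal_polygon es).isOpen

theorem isOpen_B (a : ℝ) : IsOpen {p : Plane | a < nu 2 p ∧ nu 1 p < a ∧ nu 3 p < a} :=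
  isOpen_of_polygon [(6, -a), (1, a), (3, a)] (by
    ext p
    simp only [mem_polygon, List.forall_mem_cons, List.not_mem_nil, false_imp_iff, implies_true,
      and_true, nu_reduce, neg_lt_neg_iff, Set.mem_ofPred_eq])

theorem isOpen_C (a : ℝ) :
    IsOpen {p : Plane | a < nu 2 p ∧ a < nu 1 p ∧ nu 0 p < a ∧ nu 3 p < a} :=
  isOpen_of_polygon [(6, -a), (5, -a), (0, a), (3, a)] (by
    ext p
    simp only [mem_polygon, List.forall_mem_cons, List.not_mem_nil, false_imp_iff, implies_true,
      and_true, nu_reduce, neg_lt_neg_iff, Set.mem_ofPred_eq])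

theorem atom_one_subset_base (hh : 0 < h) (hhl : h < l) (hb : beta * l ≤ h) :
    atom l h 1 ⊆ closure (orbitSet l h) := by
  have hl := hh.trans hhl
  have hle := le_of_beta_mul_le hb
  have g := sqrt_two_gt
  refine atom_one_subset_of (octagon_zero_subset hl hh hhl) (fun p h₂ h₁ h₃ i hi => ?_)
    (fun p h₂ h₁ h₀ h₃ i hi => ?_)
  · refine subset_closure (E_one_iterate hl hh hhl ((mem_E_one hl hh hhl).2 ⟨h₂, h₁, h₃, ?_⟩)
      (by omega))
    have := sqrt_two_mul_nu_two p
    nlinarith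
  · refine subset_closure (E_two_iterate hl hh hhl
      ((mem_E_two hl hh).2 ⟨h₂, h₁, h₀, h₃, ?_, ?_⟩) (by omega))
    · have := sqrt_two_mul_nu_three p
      nlinarith
    · have := sqrt_two_mul_nu_zero p
      nlinarith

/-- Each tile is invariant under its own reflection, so its destination is its U-image, and the
tiles fill the entrance tile. -/
theorem atom_two_subset (hh : 0 < h) (hhl : h < l) : atom l h 2 ⊆ closure (orbitSet l h) := by
  intro p hp
  have hU : U (5 / 2) p ∈ entranceTile l h := by
    rw [entranceTile, mem_image_U, U_U]; exact hp
  rw [← U_U (5 / 2) p]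
  refine map_mem_closure_of_isOpen (entranceTile_isPolygonal l h).isOpen (continuous_U _)
    (entranceTile_subset hh hhl) (fun x hx hxE => subset_closure ?_) hU
  obtain ⟨j, hj, hxE⟩ := Set.mem_iUnion₂.1 hxE
  obtain ⟨-, -, -, c, n, h₄, h₅⟩ := transferTile_E hh hhl j hj.1 hj.2
  have hm : reflectAt c (n / 2) x ∈ E l h j := h₄.1 ▸ Set.mem_image_of_mem _ hxE
  refine Or.inl ⟨j, hj.1, hj.2, _, le_rfl, _, hm, ?_⟩
  rw [(h₅ _ hm).eq_iterate, reflectAt_reflectAt]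

theorem atom_three_of_ge (hl : 0 < l) (hb : beta * l ≤ h) : atom l h 3 = ∅ := by
  rw [atom, if_neg (by norm_num), if_neg (by norm_num),
    if_neg fun h' => not_lt.2 hb (by rw [← div_lt_iff₀ hl]; exact h'.2)]

/-- The images of the points of the embedded atoms. -/
theorem Phi_mem_closure (hl : 0 < l) (hh : 0 < h) (hb : h < beta * l) {a : ℕ}
    (ha : a = 1 ∨ a = 3) (hA : atom (beta * l) h a ⊆ closure (orbitSet (beta * l) h))
    {f : Plane → Plane} (hf : Continuous f) {i : ℕ} (hi : i ≤ 2)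
    (hfi : ∀ x ∈ atom (beta * l) h a, f (Phi l x) = (rho l h)^[i] (Phi l x)) {p : Plane}
    (hp : p ∈ atom (beta * l) h a) : f (Phi l p) ∈ closure (orbitSet l h) :=
  map_mem_closure_of_isOpen (f := f ∘ Phi l) (isPolygonal_atom _ h a).isOpen
    (hf.comp (continuous_Phi l)) hA (fun x hx hxo => subset_closure (by
      rw [Function.comp_apply, hfi x hx]
      exact Phi_mem_orbitSet hl hh hb hxo hi (by rcases ha with rfl | rfl <;> tauto))) hp

theorem exists_Phi_eq (hl : 0 < l) {p : Plane} (hp : p ∈ atom l h 3) :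
    ∃ q ∈ atom (beta * l) h 1, Phi l q = p := by
  have : Phi l (U 1 (T (√2 * l, -(√2 * beta * l)) p)) = p := by
    rw [Phi, U_U]; ext <;> simp [T]
  exact ⟨_, (Phi_mem_atom_three hl).1 (by rwa [this]), this⟩

theorem atom_three_subset_step (hl : 0 < l) (hh : 0 < h) (hb : h < beta * l)
    (hA : atom (beta * l) h 1 ⊆ closure (orbitSet (beta * l) h)) :
    atom l h 3 ⊆ closure (orbitSet l h) := by
  intro p hp
  obtain ⟨q, hq, rfl⟩ := exists_Phi_eq hl hp
  exact Phi_mem_closure hl hh hb (Or.inl rfl) hA continuous_id (i := 0) (by norm_num)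
    (fun _ _ => rfl) hq

theorem exists_rho_eq (hl : 0 < l) {p : Plane} (h₀ : nu 0 p < l - h) (h₃ : nu 3 p < l - h)
    (h₂ : l + h < nu 2 p) : ∃ q ∈ atom l h 3, T (2 * l, 2 * l) (R 1 q) = p := by
  have e : T (2 * l, 2 * l) (R 1 (R (-1) (T (-(2 * l), -(2 * l)) p))) = p := by
    rw [R_R, show (1 : ℝ) + -1 = 0 by norm_num, R_zero]; ext <;> simp [T]
  refine ⟨_, (mem_atom_three hl).2 ?_, e⟩
  set q := R (-1) (T (-(2 * l), -(2 * l)) p)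
  rw [← e] at h₀ h₂ h₃
  simp only [nu_T_R_one] at h₀ h₂ h₃
  refine ⟨?_, ?_, ?_⟩ <;> linarith

/-- Such a point has just arrived from A₃, the `Phi`-image of the small A₁, so it is an intermediate
position of a substituted letter 1. -/
theorem entering_mem_closure (hl : 0 < l) (hh : 0 < h) (hb : h < beta * l)
    (hA : atom (beta * l) h 1 ⊆ closure (orbitSet (beta * l) h)) {p : Plane}
    (h₀ : nu 0 p < l - h) (h₃ : nu 3 p < l - h) (h₂ : l + h < nu 2 p) {i : ℕ} (hi : i ≤ 1) :
    (R 5)^[i] p ∈ closure (orbitSet l h) := by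
  obtain ⟨q, hq, rfl⟩ := exists_rho_eq hl h₀ h₃ h₂
  obtain ⟨y, hy, rfl⟩ := exists_Phi_eq hl hq
  refine Phi_mem_closure hl hh hb (Or.inl rfl) hA
    (f := fun x => (R 5)^[i] (T (2 * l, 2 * l) (R 1 x)))
    ((continuous_R_iterate 5 i).comp (continuous_T_R l)) (i := i + 1) (by omega)
    (fun x hx => ?_) hy
  have h3 := (Phi_mem_atom_three hl).2 hx
  rw [Function.iterate_succ_apply, ← rho_of_mem_three hl hh h3]
  interval_cases i
  · rfl
  · exact (rho_of_mem_one (rho_mem_atom_one hl hh h3).1).symm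

theorem atom_one_subset_step (hl : 0 < l) (hh : 0 < h) (hb : h < beta * l)
    (hA₁ : atom (beta * l) h 1 ⊆ closure (orbitSet (beta * l) h))
    (hA₃ : atom (beta * l) h 3 ⊆ closure (orbitSet (beta * l) h)) :
    atom l h 1 ⊆ closure (orbitSet l h) := by
  have hhl := lt_of_lt_beta_mul hl hb
  have hl' := mul_pos beta_pos hl
  have hJ := J_succ hl hh hb
  have l2 := sqrt_two_powers l
  have g := sqrt_two_gt
  refine atom_one_subset_of (octagon_zero_subset hl hh hhl) (fun p h₂ h₁ h₃ i hi => ?_)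
    (fun p h₂ h₁ h₀ h₃ i hi => ?_)
  · refine map_mem_closure_of_isOpen (isOpen_B (l - h)) (continuous_R_iterate 5 i)
      (subset_closure_lines _ [(2, l + h)]) (fun x hx hg => ?_) ⟨h₂, h₁, h₃⟩
    simp only [List.forall_mem_cons, List.not_mem_nil, false_imp_iff, implies_true, and_true,
      Set.mem_ofPred_eq] at hg hx
    obtain ⟨x₂, x₁, x₃⟩ := hx
    rcases lt_or_gt_of_ne hg with hg | hg
    · exact subset_closure (E_one_iterate hl hh hhl ((mem_E_one hl hh hhl).2 ⟨x₂, x₁, x₃, hg⟩)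
        (by omega))
    · by_cases hi1 : i ≤ 1
      · refine entering_mem_closure hl hh hb hA₁ ?_ x₃ hg hi1
        have := sqrt_two_mul_nu_one x
        nlinarith [sqrt_two_lt]
      -- From the second rotation on, the region coincides with `Phi` of the small A₃, and the
      -- remaining rotations spell the substituted letter 3.
      · obtain ⟨y, rfl⟩ : ∃ y, x = Psi l y := ⟨_, (Psi_PsiInv l x).symm⟩
        simp only [nu_Psi] at x₁ x₂ x₃ hg
        have hy : y ∈ atom (beta * l) h 3 := by
          rw [mem_atom_three hl', beta]
          refine ⟨?_, ?_, ?_⟩ <;> linarith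
        obtain ⟨k, rfl⟩ := Nat.exists_eq_add_of_le' (show 2 ≤ i by omega)
        rw [Function.iterate_add_apply, show (R 5)^[2] (Psi l y) = Phi l y from R_R_Psi y]
        refine Phi_mem_closure hl hh hb (Or.inr rfl) hA₃ (continuous_R_iterate 5 k)
          (i := k) (by omega) (fun z hz => ?_) hy
        exact (iterate_rho_eq (n := 3) (reach_Phi_three hl hh hb hz) (by omega)).symm
  · refine map_mem_closure_of_isOpen (isOpen_C (l - h)) (continuous_R_iterate 5 i)
      (subset_closure_lines _ [(2, l + h), (1, l + h)]) (fun x hx hg => ?_) ⟨h₂, h₁, h₀, h₃⟩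
    simp only [List.forall_mem_cons, List.not_mem_nil, false_imp_iff, implies_true, and_true,
      Set.mem_ofPred_eq] at hg hx
    obtain ⟨x₂, x₁, x₀, x₃⟩ := hx
    rcases lt_or_gt_of_ne hg.1 with hg₂ | hg₂
    · rcases lt_or_gt_of_ne hg.2 with hg₁ | hg₁
      · exact subset_closure (E_two_iterate hl hh hhl
          ((mem_E_two hl hh).2 ⟨x₂, x₁, x₀, x₃, hg₂, hg₁⟩) (by omega))
      -- These points form the `Psi`-copy of the small entrance tile, in the first steps of the
      -- orbits of E_{j+2}.
      · obtain ⟨y, hy, rfl⟩ := mem_image_Psi_entranceTile hl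
          ((mem_entranceTile hl).2 ⟨x₃, x₂, x₀, hg₂⟩) hg₁
        refine map_mem_closure_of_isOpen (f := (R 5)^[i] ∘ Psi l)
          (entranceTile_isPolygonal (beta * l) h).isOpen
          ((continuous_R_iterate 5 i).comp (continuous_Psi l)) (entranceTile_subset hh hb)
          (fun z hz hzE => subset_closure ?_) hy
        obtain ⟨j, hj, hzE⟩ := Set.mem_iUnion₂.1 hzE
        refine Or.inl ⟨j + 2, by omega, by have := hj.2; omega, i, ?_, Psi l z, ?_, ?_⟩
        · rw [word_add_two hj.1, List.length_cons]; omega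
        · rw [E_add_two hl hh hb hj.1 hj.2]
          exact Set.mem_image_of_mem _ hzE
        · exact iterate_rho_eq (n := 2) (reach_Psi hl hb hz rfl) (by omega)
    · exact entering_mem_closure hl hh hb hA₁ x₀ x₃ hg₂ hi

theorem atom_subset_closure (hh : 0 < h) (hhl : h < l) :
    ∀ a, atom l h a ⊆ closure (orbitSet l h) := by
  have key : atom l h 1 ⊆ closure (orbitSet l h) ∧ atom l h 3 ⊆ closure (orbitSet l h) := by
    refine renormalization_induction hh (P := fun l => atom l h 1 ⊆ closure (orbitSet l h) ∧
      atom l h 3 ⊆ closure (orbitSet l h)) (fun l hhl hb => ?_) (fun l hl hb ih => ?_) hhl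
    · refine ⟨atom_one_subset_base hh hhl hb, ?_⟩
      rw [atom_three_of_ge (hh.trans hhl) hb]
      exact Set.empty_subset _
    · exact ⟨atom_one_subset_step hl hh hb ih.1 ih.2, atom_three_subset_step hl hh hb ih.1⟩
  intro a
  by_cases h₁ : a = 1
  · subst h₁; exact key.1
  by_cases h₂ : a = 2
  · subst h₂; exact atom_two_subset hh hhl
  by_cases h₃ : a = 3
  · subst h₃; exact key.2
  · rw [atom, if_neg h₁, if_neg h₂, if_neg (fun h => h₃ h.1)]
    exact Set.empty_subset _

end

/-! ### Counting letters -/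

theorem sum_getD_eq_count (a : ℕ) (w : List ℕ) :
    (∑ i ∈ Finset.range w.length, if w.getD i 0 = a then 1 else 0) = w.count a := by
  induction w with
  | nil => simp
  | cons b w ih =>
    rw [List.length_cons, Finset.sum_range_succ', List.count_cons, ← ih]
    simp

theorem count_three_sigma (w : List ℕ) : (sigma w).count 3 = w.count 1 := by
  induction w with
  | nil => rfl
  | cons a w ih =>
    rw [sigma_cons, List.count_append, ih, List.count_cons]
    by_cases h : a = 1 <;> simp [h, add_comm]

/-- A substituted letter has three 1s, except that each original 1 contributes only two. -/
theorem count_one_sigma (w : List ℕ) : (sigma w).count 1 + w.count 1 = 3 * w.length := by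
  induction w with
  | nil => rfl
  | cons a w ih =>
    rw [sigma_cons, List.count_append, List.count_cons, List.length_cons]
    by_cases h : a = 1 <;> simp [h] <;> omega

theorem two_le_length_word {j : ℕ} (hj : 1 ≤ j) : 2 ≤ (word j).length := by
  obtain ⟨i, rfl⟩ := Nat.exists_eq_add_of_le' hj
  match i with
  | 0 => decide
  | 1 => decide
  | i + 2 => simp [word]

/-- The lengths start with 5 and 2 and obey L ↦ 3L + 2, so the length alone identifies the tile. -/
theorem word_injective {i j : ℕ} (hi : 1 ≤ i) (hj : 1 ≤ j)
    (e : (word i).length = (word j).length) : i = j := by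
  have hw : ∀ k, 1 ≤ k → (word (k + 2)).length = 3 * (word k).length + 2 := fun k hk => by
    rw [word_add_two hk, List.length_cons, List.length_cons, length_sigma]
  have small : ∀ k, 1 ≤ k → (k = 1 ∧ (word k).length = 5) ∨ (k = 2 ∧ (word k).length = 2) ∨
      (∃ m, 1 ≤ m ∧ k = m + 2) := fun k hk => by
    by_cases h₁ : k = 1
    · subst h₁; exact Or.inl ⟨rfl, rfl⟩
    by_cases h₂ : k = 2
    · subst h₂; exact Or.inr (Or.inl ⟨rfl, rfl⟩)
    · exact Or.inr (Or.inr ⟨k - 2, by omega, by omega⟩)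
  induction i using Nat.strong_induction_on generalizing j with
  | _ i ih =>
    rcases small i hi with ⟨rfl, ei⟩ | ⟨rfl, ei⟩ | ⟨m, hm, rfl⟩ <;>
      rcases small j hj with ⟨rfl, ej⟩ | ⟨rfl, ej⟩ | ⟨n, hn, rfl⟩
    · rfl
    · omega
    · have := two_le_length_word hn; have := hw n hn; omega
    · omega
    · rfl
    · have := two_le_length_word hn; have := hw n hn; omega
    · have := two_le_length_word hm; have := hw m hm; omega
    · have := two_le_length_word hm; have := hw m hm; omega
    · rw [ih m (by omega) hm hn (by have := hw n hn; have := hw m hm; omega)]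

theorem length_word_odd (k : ℕ) : (word (2 * k + 1)).length + 1 = 2 * 3 ^ (k + 1) := by
  induction k with
  | zero => rfl
  | succ k ih =>
    rw [show 2 * (k + 1) + 1 = 2 * k + 1 + 2 by ring, word_add_two (by omega), List.length_cons,
      List.length_cons, length_sigma]
    have := pow_succ 3 (k + 1)
    omega

theorem length_word_even (k : ℕ) : (word (2 * k + 2)).length + 1 = 3 ^ (k + 1) := by
  induction k with
  | zero => rfl
  | succ k ih =>
    rw [show 2 * (k + 1) + 2 = 2 * k + 2 + 2 by ring, word_add_two (by omega), List.length_cons,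
      List.length_cons, length_sigma]
    have := pow_succ 3 (k + 1)
    omega

theorem count_word_add_two {j : ℕ} (hj : 1 ≤ j) :
    ((word (j + 2)).count 1 : ℝ) = 2 + 3 * (word j).length - (word j).count 1 ∧
      ((word (j + 2)).count 3 : ℝ) = (word j).count 1 := by
  have h := count_one_sigma (word j)
  rw [word_add_two hj]
  simp only [List.count_cons, count_three_sigma]
  constructor
  · have h' : ((sigma (word j)).count 1 : ℝ) + (word j).count 1 = 3 * (word j).length := by
      exact_mod_cast h
    simp; linarith
  · simp

theorem count_word_odd (k : ℕ) :
    ((word (2 * k + 1)).count 1 : ℝ) = -1 / 2 - (-1) ^ (k + 1) + 3 / 2 * 3 ^ (k + 1) ∧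
    ((word (2 * k + 1)).count 3 : ℝ) = -1 / 2 + (-1) ^ (k + 1) + 1 / 2 * 3 ^ (k + 1) := by
  induction k with
  | zero => norm_num [word]
  | succ k ih =>
    have hl : ((word (2 * k + 1)).length : ℝ) + 1 = 2 * 3 ^ (k + 1) := by
      exact_mod_cast length_word_odd k
    obtain ⟨c₁, c₃⟩ := count_word_add_two (j := 2 * k + 1) (by omega)
    rw [show 2 * (k + 1) + 1 = 2 * k + 1 + 2 by ring, c₁, c₃, ih.1]
    constructor
    · rw [eq_sub_of_add_eq hl]; ring
    · ring

theorem count_word_even (k : ℕ) :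
    ((word (2 * k + 2)).count 1 : ℝ) = -1 / 2 - 1 / 4 * (-1) ^ (k + 1) + 3 / 4 * 3 ^ (k + 1) ∧
    ((word (2 * k + 2)).count 3 : ℝ) = -1 / 2 + 1 / 4 * (-1) ^ (k + 1) + 1 / 4 * 3 ^ (k + 1) := by
  induction k with
  | zero => norm_num [word]
  | succ k ih =>
    have hl : ((word (2 * k + 2)).length : ℝ) + 1 = 3 ^ (k + 1) := by
      exact_mod_cast length_word_even k
    obtain ⟨c₁, c₃⟩ := count_word_add_two (j := 2 * k + 2) (by omega)
    rw [show 2 * (k + 1) + 2 = 2 * k + 2 + 2 by ring, c₁, c₃, ih.1]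
    constructor
    · rw [eq_sub_of_add_eq hl]; ring
    · ring

/-- Modulo 3 the substitution negates the number of 1s, and the initial word has a single one. -/
theorem count_one_sigmaPow (k : ℕ) : ¬ 3 ∣ (sigmaPow k).count 1 := by
  induction k with
  | zero => decide
  | succ k ih =>
    rw [sigmaPow_succ]
    have := count_one_sigma (sigmaPow k)
    omega

/-- The periodic sequence with period `σ^k(1)`. -/
def periodicWord (k t : ℕ) : ℕ := (sigmaPow k).getD (t % 3 ^ k) 0

theorem periodicWord_add (k t : ℕ) : periodicWord k (t + 3 ^ k) = periodicWord k t := by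
  rw [periodicWord, Nat.add_mod_right, periodicWord]

theorem periodicWord_of_lt {k t : ℕ} (ht : t < 3 ^ k) :
    periodicWord k t = (sigmaPow k).getD t 0 := by
  rw [periodicWord, Nat.mod_eq_of_lt ht]

theorem sum_range_three_mul {f : ℕ → ℕ} {M : ℕ} (hf : Function.Periodic f M) :
    ∑ i ∈ Finset.range (M * 3), f i = 3 * ∑ i ∈ Finset.range M, f i := by
  have h₁ : ∀ i, f (M + i) = f i := fun i => by rw [add_comm]; exact hf i
  rw [show M * 3 = M + M + M by ring, Finset.sum_range_add, Finset.sum_range_add]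
  simp only [add_assoc, h₁]
  ring

/-- Every period is a multiple of `3 ^ k`. -/
theorem dvd_of_periodic {k d : ℕ} (hd : Function.Periodic (periodicWord k) d) : 3 ^ k ∣ d := by
  by_contra hnd
  have hN : Function.Periodic (periodicWord k) (3 ^ k) := periodicWord_add k
  have hlt : Nat.gcd d (3 ^ k) < 3 ^ k := by
    refine lt_of_le_of_ne (Nat.le_of_dvd (by positivity) (Nat.gcd_dvd_right _ _)) fun e => hnd ?_
    rw [← e]; exact Nat.gcd_dvd_left _ _
  obtain ⟨m, -, hm⟩ := Nat.exists_mul_mod_eq_gcd hlt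
  -- Two periods have their gcd as a period. A proper divisor of 3^k divides 3^(k-1), so the word
  -- would be a cube and its number of 3s divisible by 3. That number is the count of 1s one level
  -- below.
  have hg : Function.Periodic (periodicWord k) (Nat.gcd d (3 ^ k)) := fun t => by
    have h₁ := Nat.div_add_mod (d * m) (3 ^ k)
    rw [hm] at h₁
    have h₂ := (hN.nat_mul (d * m / 3 ^ k)) (t + Nat.gcd d (3 ^ k))
    have h₃ := (hd.nat_mul m) t
    rw [← h₂, ← h₃]
    congr 1
    simp only [Nat.cast_id]
    linarith
  obtain ⟨e, -, he⟩ := (Nat.dvd_prime_pow Nat.prime_three).1 (Nat.gcd_dvd_right d (3 ^ k))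
  rw [he] at hg hlt
  have hek : e < k := (Nat.pow_lt_pow_iff_right (by norm_num)).1 hlt
  obtain ⟨k, rfl⟩ : ∃ n, k = n + 1 := ⟨k - 1, by omega⟩
  have hp : Function.Periodic (periodicWord (k + 1)) (3 ^ k) := by
    obtain ⟨c, hc⟩ := pow_dvd_pow 3 (show e ≤ k by omega)
    have := hg.nat_mul c
    rw [Nat.cast_id, mul_comm, ← hc] at this
    exact this
  have hs := sum_range_three_mul (f := fun t => if periodicWord (k + 1) t = 3 then 1 else 0)
    (M := 3 ^ k) fun t => by simp only [hp t]
  have hc : ∑ t ∈ Finset.range (3 ^ k * 3), (if periodicWord (k + 1) t = 3 then 1 else 0) =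
      (sigmaPow (k + 1)).count 3 := by
    rw [← sum_getD_eq_count, length_sigmaPow, ← pow_succ]
    exact Finset.sum_congr rfl fun t ht => by rw [periodicWord_of_lt (Finset.mem_range.1 ht)]
  rw [hc, sigmaPow_succ, count_three_sigma] at hs
  exact count_one_sigmaPow k ⟨_, hs⟩

theorem periodicWord_collision {k k' s s' : ℕ} (hs : s < 3 ^ k) (hs' : s' < 3 ^ k')
    (e : ∀ t, periodicWord k (s + t) = periodicWord k' (s' + t)) : k = k' ∧ s = s' := by
  have shift : ∀ {k s d : ℕ}, (∀ t, periodicWord k (s + t + d) = periodicWord k (s + t)) →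
      3 ^ k ∣ d := by
    intro k s d hd
    refine dvd_of_periodic fun t => ?_
    have hN : Function.Periodic (periodicWord k) (3 ^ k) := periodicWord_add k
    -- Adding the full periods s · 3^k moves any index past s, so periodicity of a tail is
    -- periodicity of the whole sequence.
    have h₁ := hN.nat_mul s
    rw [Nat.cast_id] at h₁
    have hle : s ≤ s * 3 ^ k := Nat.le_mul_of_pos_right _ (by positivity)
    have h₂ := hd (t + s * 3 ^ k - s)
    rw [show s + (t + s * 3 ^ k - s) = t + s * 3 ^ k by omega] at h₂
    rw [← h₁ (t + d), ← h₁ t, ← h₂]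
    congr 1; ring
  have hk : ∀ {k k' s s' : ℕ}, (∀ t, periodicWord k (s + t) = periodicWord k' (s' + t)) →
      k' ≤ k := by
    intro k k' s s' e
    have : 3 ^ k' ∣ 3 ^ k := shift (s := s') fun t => by
      rw [add_assoc, ← e, ← e, ← add_assoc, periodicWord_add]
    exact (Nat.pow_dvd_pow_iff_le_right (by norm_num)).1 this
  obtain rfl : k = k' := le_antisymm (hk fun t => (e t).symm) (hk e)
  refine ⟨rfl, ?_⟩
  wlog hss : s ≤ s' generalizing s s'
  · exact (this hs' hs (fun t => (e t).symm) (by omega)).symm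
  have : 3 ^ k ∣ s' - s := shift (s := s) fun t => by
    rw [e, show s + t + (s' - s) = s' + t by omega]
  have := Nat.eq_zero_of_dvd_of_lt this (by omega)
  omega

/-! ### Itineraries of the octagons -/

section

variable {l h : ℝ}

theorem iterate_mem_atom_of_mem_octagon (hh : 0 < h) (hhl : h < l) {k : ℕ} (hk : k < J l h)
    (t : ℕ) : ∀ {p : Plane}, p ∈ octagon l h k →
      (periodicWord k t = 1 ∨ periodicWord k t = 3) ∧
        (rho l h)^[t] p ∈ atom l h (periodicWord k t) := by
  obtain ⟨-, h₂, -⟩ := octagon_spec hh hhl k hk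
  induction t using Nat.strong_induction_on with
  | _ t ih =>
    intro p hp
    obtain ⟨q, hq, hr⟩ := h₂ p hp
    rcases lt_or_ge t (3 ^ k) with ht | ht
    · have ht' : t < (sigmaPow k).length := by rwa [length_sigmaPow]
      have := hr.mem_atom ht'
      rwa [← List.getD_eq_getElem _ 0 ht', ← periodicWord_of_lt ht] at this
    · obtain ⟨s, rfl⟩ := Nat.exists_eq_add_of_le' ht
      have h3 : 0 < 3 ^ k := by positivity
      have := ih s (by omega) hq
      rwa [periodicWord_add, Function.iterate_add_apply, ← length_sigmaPow, hr.eq_iterate]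

/-! ### Transfer times and visit counts read off from paths -/

theorem transferTime_eq (hl : 0 < l) (hh : 0 < h) {w : List ℕ} {p q : Plane}
    (hp : p ∈ entranceTile l h) (hr : Reach l h w p q) (hq : q ∈ exitTile l h) :
    transferTime l h p = w.length := by
  have : {n | ∃ w : List ℕ, w.length = n ∧ IsTransferPath l h w p} = {w.length} := by
    ext n
    simp only [Set.mem_ofPred_eq, Set.mem_singleton_iff, isTransferPath_iff]
    constructor
    · rintro ⟨v, rfl, -, r, hr', hv⟩
      rw [reach_unique hl hh hv hr hr' hq]
    · rintro rfl
      exact ⟨w, rfl, hp, q, hq, hr⟩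
  rw [transferTime, this, csInf_singleton]

theorem visits_eq (hl : 0 < l) (hh : 0 < h) {w : List ℕ} {p q : Plane}
    (hp : p ∈ entranceTile l h) (hr : Reach l h w p q) (hq : q ∈ exitTile l h) {i : ℕ}
    (hi : i = 1 ∨ i = 3) : visits l h i p = w.count i := by
  have : {t : ℕ | t < transferTime l h p ∧ (rho l h)^[t] p ∈ atom l h i} =
      ((Finset.range w.length).filter fun t => w.getD t 0 = i : Finset ℕ) := by
    ext t
    rw [transferTime_eq hl hh hp hr hq, Finset.coe_filter]
    simp only [Set.mem_ofPred_eq, Finset.mem_range]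
    refine and_congr_right fun ht => ?_
    obtain ⟨h₁, h₂⟩ := hr.mem_atom ht
    rw [List.getD_eq_getElem _ 0 ht]
    refine ⟨fun h₃ => atoms_disjoint hl hh ?_ ?_ h₂ h₃, fun e => e ▸ h₂⟩ <;> tauto
  rw [visits, this, Set.ncard_coe_finset, Finset.card_filter, sum_getD_eq_count]

/-! ### The partition of the entrance tile -/

theorem isOpen_setOf_reach (hl : 0 < l) (hh : 0 < h) (w : List ℕ) :
    IsOpen {p | ∃ q ∈ exitTile l h, Reach l h w p q} := by
  induction w with
  | nil =>
    have : {p | ∃ q ∈ exitTile l h, Reach l h [] p q} = exitTile l h := by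
      ext p; simp [Reach]
    rw [this]
    exact (isPolygonal_atom l h 2).isOpen
  | cons a w ih =>
    by_cases ha : a = 1 ∨ a = 3
    · obtain ⟨f, hf, hfr⟩ : ∃ f : Plane → Plane, Continuous f ∧
          ∀ p ∈ atom l h a, rho l h p = f p := by
        rcases ha with rfl | rfl
        · exact ⟨_, continuous_R 5, fun p hp => rho_of_mem_one hp⟩
        · exact ⟨_, continuous_T_R l, fun p hp => rho_of_mem_three hl hh hp⟩
      have : {p | ∃ q ∈ exitTile l h, Reach l h (a :: w) p q} =
          atom l h a ∩ f ⁻¹' {p | ∃ q ∈ exitTile l h, Reach l h w p q} := by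
        ext p
        simp only [Set.mem_ofPred_eq, Reach, Set.mem_inter_iff, Set.mem_preimage]
        constructor
        · rintro ⟨q, hq, -, h₁, h₂⟩
          exact ⟨h₁, q, hq, hfr p h₁ ▸ h₂⟩
        · rintro ⟨h₁, q, hq, h₂⟩
          exact ⟨q, hq, ha, h₁, (hfr p h₁).symm ▸ h₂⟩
      rw [this]
      exact (isPolygonal_atom l h a).isOpen.inter (ih.preimage hf)
    · have : {p | ∃ q ∈ exitTile l h, Reach l h (a :: w) p q} = ∅ := by
        ext p
        simp only [Set.mem_ofPred_eq, Reach, Set.mem_empty_iff_false, iff_false]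
        rintro ⟨q, -, h₁, -⟩
        exact ha h₁
      rw [this]; exact isOpen_empty

theorem index_eq_of_mem_E (hh : 0 < h) (hhl : h < l) {i j : ℕ} (hi : i ∈ Set.Icc 1 (2 * J l h))
    (hj : j ∈ Set.Icc 1 (2 * J l h)) {p : Plane} (pi : p ∈ E l h i) (pj : p ∈ E l h j) : i = j := by
  obtain ⟨q, hq, hr⟩ := reach_of_mem_E hh hhl hi.1 hi.2 pi
  obtain ⟨q', hq', hr'⟩ := reach_of_mem_E hh hhl hj.1 hj.2 pj
  exact word_injective hi.1 hj.1
    (congrArg List.length (reach_unique (hh.trans hhl) hh hr hr' hq hq'))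

theorem injOn_E (hh : 0 < h) (hhl : h < l) : Set.InjOn (E l h) (Set.Icc 1 (2 * J l h)) := by
  intro i hi j hj e
  obtain ⟨p, hp⟩ := (transferTile_E hh hhl i hi.1 hi.2).2.1
  exact index_eq_of_mem_E hh hhl hi hj hp (e ▸ hp)

/-- The path set is open and the tiles are dense in the entrance tile. Distinct tiles have distinct
paths, so E_j is dense in the path set, which therefore lies in the interior of the closure of E_j,
namely E_j. -/
theorem setOf_isTransferPath_word (hh : 0 < h) (hhl : h < l) {j : ℕ}
    (hj : j ∈ Set.Icc 1 (2 * J l h)) : {p | IsTransferPath l h (word j) p} = E l h j := by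
  have hl := hh.trans hhl
  obtain ⟨h₁, -, h₃, -⟩ := transferTile_E hh hhl j hj.1 hj.2
  refine Set.Subset.antisymm ?_ fun p hp => ?_
  · have hV : {p | IsTransferPath l h (word j) p} =
        entranceTile l h ∩ {p | ∃ q ∈ exitTile l h, Reach l h (word j) p q} := by
      ext p; exact isTransferPath_iff
    have hVo : IsOpen {p | IsTransferPath l h (word j) p} := by
      rw [hV]
      exact (entranceTile_isPolygonal l h).isOpen.inter (isOpen_setOf_reach hl hh _)
    rw [← h₁.interior_closure]
    refine interior_maximal (fun p hp => ?_) hVo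
    refine map_mem_closure_of_isOpen (f := id) hVo continuous_id
      (Y := entranceSet l h) (fun q hq => ?_) (fun x hx hxE => subset_closure ?_) hp
    · rw [hV] at hq
      exact entranceTile_subset hh hhl hq.1
    · obtain ⟨i, hi, hxE⟩ := Set.mem_iUnion₂.1 hxE
      obtain ⟨-, q, hq, hr⟩ := isTransferPath_iff.1 hx
      obtain ⟨q', hq', hr'⟩ := reach_of_mem_E hh hhl hi.1 hi.2 hxE
      have := word_injective hi.1 hj.1 (congrArg List.length (reach_unique hl hh hr' hr hq' hq))
      subst this
      exact hxE
  · exact isTransferPath_iff.2 ⟨h₃ hp, reach_of_mem_E hh hhl hj.1 hj.2 hp⟩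

/-- A non-empty path set is open, hence meets some E_j, and uniqueness of paths identifies its word
with that of E_j. -/
theorem transferPartition_eq (hh : 0 < h) (hhl : h < l) :
    transferPartition l h = E l h '' Set.Icc 1 (2 * J l h) := by
  have hl := hh.trans hhl
  ext S
  constructor
  · rintro ⟨⟨p, hp⟩, w, rfl⟩
    have hVo : IsOpen {p | IsTransferPath l h w p} := by
      have hV : {p | IsTransferPath l h w p} =
          entranceTile l h ∩ {p | ∃ q ∈ exitTile l h, Reach l h w p q} := by
        ext p; exact isTransferPath_iff
      rw [hV]
      exact (entranceTile_isPolygonal l h).isOpen.inter (isOpen_setOf_reach hl hh _)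
    obtain ⟨x, hx, hxE⟩ := mem_closure_iff.1 (entranceTile_subset hh hhl hp.1) _ hVo hp
    obtain ⟨j, hj, hxE⟩ := Set.mem_iUnion₂.1 hxE
    refine ⟨j, hj, ?_⟩
    obtain ⟨-, q, hq, hr⟩ := isTransferPath_iff.1 hx
    obtain ⟨q', hq', hr'⟩ := reach_of_mem_E hh hhl hj.1 hj.2 hxE
    rw [← setOf_isTransferPath_word hh hhl hj, reach_unique hl hh hr' hr hq' hq]
  · rintro ⟨j, hj, rfl⟩
    exact ⟨(transferTile_E hh hhl j hj.1 hj.2).2.1, word j,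
      (setOf_isTransferPath_word hh hhl hj).symm⟩

theorem sUnion_E (l h : ℝ) : ⋃₀ (E l h '' Set.Icc 1 (2 * J l h)) = entranceSet l h := by
  rw [Set.sUnion_image, entranceSet]

theorem closure_entranceSet (hh : 0 < h) (hhl : h < l) :
    closure (entranceSet l h) = closure (entranceTile l h) := by
  refine Set.Subset.antisymm (closure_mono (Set.iUnion₂_subset fun j hj => ?_))
    (closure_minimal (entranceTile_subset hh hhl) isClosed_closure)
  exact (transferTile_E hh hhl j hj.1 hj.2).2.2.1

theorem tileSpan_E (hh : 0 < h) (hhl : h < l) :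
    tileSpan (E l h '' Set.Icc 1 (2 * J l h)) = entranceTile l h := by
  rw [tileSpan, sUnion_E, closure_entranceSet hh hhl,
    (entranceTile_isPolygonal l h).interior_closure]

/-! ### The two involutions -/

/-- The reflection `U m` as a homeomorphism. -/
noncomputable def homeoU (m : ℝ) : Plane ≃ₜ Plane where
  toFun := U m
  invFun := U m
  left_inv := U_U m
  right_inv := U_U m
  continuous_toFun := continuous_U m
  continuous_invFun := continuous_U m

/-- The reflection exchanges `nu 2` and `nu 3`. It sends the part of A₁ below `nu 2` = l - h to A₁,
the part up to l + h to A₂ and the rest to A₃, while A₂ and A₃ return into A₁. -/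
theorem image_U_domain (hl : 0 < l) (hh : 0 < h) (hhl : h < l) :
    U (5 / 2) '' domain l h = domain l h := by
  have e : ∀ S, U (5 / 2) '' S = homeoU (5 / 2) '' S := fun S => rfl
  have hX : U (5 / 2) '' ⋃₀ {atom l h 1, atom l h 2, atom l h 3} ⊆
      closure (⋃₀ {atom l h 1, atom l h 2, atom l h 3}) := by
    have hs : ∀ (a : ℕ), a = 1 ∨ a = 2 ∨ a = 3 → ∀ x ∈ atom l h a,
        x ∈ closure (⋃₀ {atom l h 1, atom l h 2, atom l h 3}) := fun a ha x hx =>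
      subset_closure ⟨atom l h a, by rcases ha with rfl | rfl | rfl <;> simp, hx⟩
    rintro _ ⟨p, ⟨S, hS, hp⟩, rfl⟩
    simp only [Set.mem_insert_iff, Set.mem_singleton_iff] at hS
    rcases hS with rfl | rfl | rfl
    · refine map_mem_closure_of_isOpen (isPolygonal_atom l h 1).isOpen (continuous_U _)
        (subset_closure_lines _ [(2, l - h), (2, l + h)]) (fun x hx hg => ?_) hp
      simp only [List.forall_mem_cons, List.not_mem_nil, false_imp_iff, implies_true, and_true,
        Set.mem_ofPred_eq] at hg
      rw [mem_atom_one] at hx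
      rcases lt_or_gt_of_ne hg.1 with h₁ | h₁
      · refine hs 1 (by simp) _ (mem_atom_one.2 ?_)
        simp only [nu_U_axis]
        refine ⟨?_, ?_, ?_⟩ <;> linarith
      · rcases lt_or_gt_of_ne hg.2 with h₂ | h₂
        · refine hs 2 (by simp) _ ((mem_atom_two hl).2 ?_)
          simp only [nu_U_axis]
          refine ⟨?_, ?_, ?_, ?_⟩ <;> linarith
        · refine hs 3 (by simp) _ ((mem_atom_three hl).2 ?_)
          simp only [nu_U_axis]
          refine ⟨?_, ?_, ?_⟩ <;> linarith
    · refine hs 1 (by simp) _ (mem_atom_one.2 ?_)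
      rw [mem_atom_two hl] at hp
      have := sqrt_two_mul_nu_three p
      have := sqrt_two_mul_nu_two p
      have := sqrt_two_mul_nu_zero p
      simp only [nu_U_axis]
      refine ⟨?_, ?_, ?_⟩ <;> first | linarith | nlinarith [sqrt_two_gt]
    · refine hs 1 (by simp) _ (mem_atom_one.2 ?_)
      rw [mem_atom_three hl] at hp
      have := sqrt_two_mul_nu_three p
      simp only [nu_U_axis]
      refine ⟨?_, ?_, ?_⟩ <;> first | linarith | nlinarith [sqrt_two_gt]
  have hc : U (5 / 2) '' closure (⋃₀ {atom l h 1, atom l h 2, atom l h 3}) =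
      closure (⋃₀ {atom l h 1, atom l h 2, atom l h 3}) := by
    have h₁ : U (5 / 2) '' closure (⋃₀ {atom l h 1, atom l h 2, atom l h 3}) ⊆
        closure (⋃₀ {atom l h 1, atom l h 2, atom l h 3}) := by
      rw [e, (homeoU _).image_closure]
      exact closure_minimal hX isClosed_closure
    refine Set.Subset.antisymm h₁ fun p hp => ⟨U (5 / 2) p, h₁ ⟨p, hp, rfl⟩, U_U _ p⟩
  rw [domain, tileSpan, e, (homeoU _).image_interior, ← e, hc]

theorem psi_eq (hh : 0 < h) (hhl : h < l) {j : ℕ} (hj : j ∈ Set.Icc 1 (2 * J l h)) :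
    ∃ (c : Plane) (n : ℤ), IsTileAxis (E l h j) c (n / 2) ∧
      ∀ p ∈ E l h j, psi l h p = U (5 / 2) (reflectAt c (n / 2) p) := by
  obtain ⟨-, -, h₃, c, n, h₄, h₅⟩ := transferTile_E hh hhl j hj.1 hj.2
  refine ⟨c, n, h₄, fun p hp => ?_⟩
  obtain ⟨q, hq, hr⟩ := reach_of_mem_E hh hhl hj.1 hj.2 hp
  rw [psi, transferTime_eq (hh.trans hhl) hh (h₃ hp) hr hq, (h₅ p hp).eq_iterate]

theorem image_psi_E (hh : 0 < h) (hhl : h < l) {j : ℕ} (hj : j ∈ Set.Icc 1 (2 * J l h)) :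
    psi l h '' E l h j = U (5 / 2) '' E l h j := by
  obtain ⟨c, n, h₁, h₂⟩ := psi_eq hh hhl hj
  rw [Set.image_congr h₂]
  conv_rhs => rw [← h₁.1, ← Set.image_comp]
  rfl

theorem tileSpan_psi_E (hh : 0 < h) (hhl : h < l) :
    tileSpan ((fun j => psi l h '' E l h j) '' Set.Icc 1 (2 * J l h)) = exitTile l h := by
  have e : ⋃₀ ((fun j => psi l h '' E l h j) '' Set.Icc 1 (2 * J l h)) =
      homeoU (5 / 2) '' entranceSet l h := by
    rw [Set.sUnion_image, entranceSet, Set.image_iUnion₂]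
    exact Set.iUnion₂_congr fun j hj => image_psi_E hh hhl hj
  rw [tileSpan, e, ← Homeomorph.image_closure, closure_entranceSet hh hhl, Homeomorph.image_closure]
  have : homeoU (5 / 2) '' entranceTile l h = exitTile l h := by
    ext p
    change p ∈ U (5 / 2) '' entranceTile l h ↔ _
    rw [mem_image_U, entranceTile, mem_image_U, U_U]
  rw [this]
  exact (isPolygonal_atom l h 2).interior_closure

/-! ### The orbits of the tiles -/

/-- All points share the path, so each step acts on the whole tile as a single isometry. -/
theorem isPolygonal_iterate (hl : 0 < l) (hh : 0 < h) {w : List ℕ} {S : Set Plane}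
    (hS : IsPolygonal S) (hr : ∀ p ∈ S, ∃ q, Reach l h w p q) {t : ℕ} (ht : t ≤ w.length) :
    IsPolygonal ((rho l h)^[t] '' S) := by
  induction t generalizing w S with
  | zero => simpa using hS
  | succ t ih =>
    cases w with
    | nil => simp at ht
    | cons a w =>
      rw [Function.iterate_succ, Set.image_comp]
      refine ih (w := w) ?_ ?_ (by simpa using ht)
      · rcases S.eq_empty_or_nonempty with rfl | ⟨p, hp⟩
        · simpa using hS
        · obtain ⟨q, rfl | rfl, -⟩ := hr p hp
          · have : rho l h '' S = R 5 '' S := Set.image_congr fun x hx => by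
              obtain ⟨q, -, hx, -⟩ := hr x hx
              exact rho_of_mem_one hx
            rw [this]; exact hS.image_R 5
          · have : rho l h '' S = T (2 * l, 2 * l) '' (R 1 '' S) := by
              rw [← Set.image_comp]
              refine Set.image_congr fun x hx => ?_
              obtain ⟨q, -, hx, -⟩ := hr x hx
              exact rho_of_mem_three hl hh hx
            rw [this]; exact (hS.image_R 1).image_T _
      · rintro _ ⟨p, hp, rfl⟩
        obtain ⟨q, -, -, h₂⟩ := hr p hp
        exact ⟨q, h₂⟩

theorem isPolygonal_octagon (l h : ℝ) (k : ℕ) : IsPolygonal (octagon l h k) :=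
  (isPolygonal_polygon _).image_T _

theorem mem_orbitIndex_inl (hh : 0 < h) (hhl : h < l) {j t : ℕ} :
    Sum.inl (j, t) ∈ orbitIndex l h ↔ j ∈ Set.Icc 1 (2 * J l h) ∧ t ≤ (word j).length := by
  have hl := hh.trans hhl
  have key : ∀ {j p}, 1 ≤ j → j ≤ 2 * J l h → p ∈ E l h j →
      transferTime l h p = (word j).length := fun h₁ h₂ hp => by
    obtain ⟨q, hq, hr⟩ := reach_of_mem_E hh hhl h₁ h₂ hp
    exact transferTime_eq hl hh ((transferTile_E hh hhl _ h₁ h₂).2.2.1 hp) hr hq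
  constructor
  · rintro (⟨j', t', e, h₁, h₂, p, hp, ht⟩ | ⟨k, t, e, -⟩)
    · obtain ⟨rfl, rfl⟩ := Prod.mk.inj (Sum.inl.inj e)
      rw [key h₁ h₂ hp] at ht
      exact ⟨⟨h₁, h₂⟩, ht⟩
    · cases e
  · rintro ⟨⟨h₁, h₂⟩, ht⟩
    obtain ⟨p, hp⟩ := (transferTile_E hh hhl j h₁ h₂).2.1
    exact Or.inl ⟨j, t, rfl, h₁, h₂, p, hp, by rwa [key h₁ h₂ hp]⟩

theorem mem_orbitIndex_inr {k t : ℕ} :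
    Sum.inr (k, t) ∈ orbitIndex l h ↔ k < J l h ∧ t < 3 ^ k := by
  constructor
  · rintro (⟨j', t', e, -⟩ | ⟨k, t, e, h₁, h₂⟩)
    · cases e
    · obtain ⟨rfl, rfl⟩ := Prod.mk.inj (Sum.inr.inj e)
      exact ⟨h₁, h₂⟩
  · rintro ⟨h₁, h₂⟩
    exact Or.inr ⟨k, t, rfl, h₁, h₂⟩

/-- A common point would later be in the exit tile, but octagon orbits stay in A₁ ∪ A₃ forever. -/
theorem iterate_E_ne_iterate_octagon (hh : 0 < h) (hhl : h < l) {j k s t : ℕ}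
    (hj : j ∈ Set.Icc 1 (2 * J l h)) (hs : s ≤ (word j).length) (hk : k < J l h) {p q : Plane}
    (hp : p ∈ E l h j) (hq : q ∈ octagon l h k) : (rho l h)^[s] p ≠ (rho l h)^[t] q := by
  intro e
  obtain ⟨r, hr, hpr⟩ := reach_of_mem_E hh hhl hj.1 hj.2 hp
  have h₁ := (hpr.drop hs).eq_iterate
  rw [e, ← Function.iterate_add_apply] at h₁
  obtain ⟨h₂, h₃⟩ := iterate_mem_atom_of_mem_octagon hh hhl hk
    ((List.drop s (word j)).length + t) hq
  rw [h₁] at h₃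
  have := atoms_disjoint (hh.trans hhl) hh (by tauto) (by simp) h₃ hr
  omega

/-- A common point has one future itinerary, and the itinerary determines both the level and the
phase. -/
theorem iterate_octagon_injective (hh : 0 < h) (hhl : h < l) {k k' s s' : ℕ} (hk : k < J l h)
    (hk' : k' < J l h) (hs : s < 3 ^ k) (hs' : s' < 3 ^ k') {p q : Plane}
    (hp : p ∈ octagon l h k) (hq : q ∈ octagon l h k')
    (e : (rho l h)^[s] p = (rho l h)^[s'] q) : k = k' ∧ s = s' := by
  refine periodicWord_collision hs hs' fun t => ?_
  obtain ⟨h₁, h₂⟩ := iterate_mem_atom_of_mem_octagon hh hhl hk (s + t) hp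
  obtain ⟨h₃, h₄⟩ := iterate_mem_atom_of_mem_octagon hh hhl hk' (s' + t) hq
  rw [add_comm, Function.iterate_add_apply, e, ← Function.iterate_add_apply, add_comm t s,
    add_comm t s'] at h₂
  exact atoms_disjoint (hh.trans hhl) hh (by tauto) (by tauto) h₂ h₄

theorem pairwiseDisjoint_orbitTile (hh : 0 < h) (hhl : h < l) :
    (orbitIndex l h).PairwiseDisjoint (orbitTile l h) := by
  have hl := hh.trans hhl
  rintro (⟨j, t⟩ | ⟨k, t⟩) ha (⟨j', t'⟩ | ⟨k', t'⟩) hb hne <;>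
    refine Set.disjoint_left.2 ?_ <;> rintro _ ⟨p, hp, rfl⟩ ⟨q, hq, e⟩
  · obtain ⟨hj, ht⟩ := (mem_orbitIndex_inl hh hhl).1 ha
    obtain ⟨hj', ht'⟩ := (mem_orbitIndex_inl hh hhl).1 hb
    obtain ⟨r, -, hr⟩ := reach_of_mem_E hh hhl hj.1 hj.2 hp
    obtain ⟨r', -, hr'⟩ := reach_of_mem_E hh hhl hj'.1 hj'.2 hq
    obtain ⟨rfl, rfl⟩ := iterate_eq_iterate hl hh hr' hr ht' ht
      ((transferTile_E hh hhl _ hj'.1 hj'.2).2.2.1 hq)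
      ((transferTile_E hh hhl _ hj.1 hj.2).2.2.1 hp) e
    exact hne (by rw [index_eq_of_mem_E hh hhl hj hj' hp hq])
  · obtain ⟨hj, ht⟩ := (mem_orbitIndex_inl hh hhl).1 ha
    obtain ⟨hk, ht'⟩ := mem_orbitIndex_inr.1 hb
    exact iterate_E_ne_iterate_octagon hh hhl hj ht hk hp hq e.symm
  · obtain ⟨hk, ht⟩ := mem_orbitIndex_inr.1 ha
    obtain ⟨hj, ht'⟩ := (mem_orbitIndex_inl hh hhl).1 hb
    exact iterate_E_ne_iterate_octagon hh hhl hj ht' hk hq hp e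
  · obtain ⟨hk, ht⟩ := mem_orbitIndex_inr.1 ha
    obtain ⟨hk', ht'⟩ := mem_orbitIndex_inr.1 hb
    obtain ⟨rfl, rfl⟩ := iterate_octagon_injective hh hhl hk' hk ht' ht hq hp e
    exact hne rfl

theorem orbitTile_subset_domain (hh : 0 < h) (hhl : h < l) :
    ∀ a ∈ orbitIndex l h, orbitTile l h a ⊆ domain l h := by
  have hs : ∀ (a : ℕ), a = 1 ∨ a = 2 ∨ a = 3 → atom l h a ⊆ domain l h := fun a ha =>
    interior_maximal (fun x hx =>
      subset_closure ⟨atom l h a, by rcases ha with rfl | rfl | rfl <;> simp, hx⟩)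
      (isPolygonal_atom l h a).isOpen
  rintro (⟨j, t⟩ | ⟨k, t⟩) ha _ ⟨p, hp, rfl⟩
  · obtain ⟨hj, ht⟩ := (mem_orbitIndex_inl hh hhl).1 ha
    obtain ⟨q, hq, hr⟩ := reach_of_mem_E hh hhl hj.1 hj.2 hp
    rcases ht.lt_or_eq with ht | rfl
    · obtain ⟨h₁, h₂⟩ := hr.mem_atom ht
      exact hs _ (by tauto) h₂
    · rw [hr.eq_iterate]
      exact hs 2 (by simp) hq
  · obtain ⟨hk, ht⟩ := mem_orbitIndex_inr.1 ha
    obtain ⟨h₁, h₂⟩ := iterate_mem_atom_of_mem_octagon hh hhl hk t hp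
    exact hs _ (by tauto) h₂

theorem isPolygonal_orbitTile (hh : 0 < h) (hhl : h < l) :
    ∀ a ∈ orbitIndex l h, IsPolygonal (orbitTile l h a) := by
  have hl := hh.trans hhl
  rintro (⟨j, t⟩ | ⟨k, t⟩) ha
  · obtain ⟨hj, ht⟩ := (mem_orbitIndex_inl hh hhl).1 ha
    refine isPolygonal_iterate hl hh (transferTile_E hh hhl j hj.1 hj.2).1 (fun p hp => ?_) ht
    obtain ⟨q, -, hr⟩ := reach_of_mem_E hh hhl hj.1 hj.2 hp
    exact ⟨q, hr⟩
  · obtain ⟨hk, ht⟩ := mem_orbitIndex_inr.1 ha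
    refine isPolygonal_iterate hl hh (isPolygonal_octagon l h k) (w := sigmaPow k) (fun p hp => ?_)
      (by rw [length_sigmaPow]; exact ht.le)
    obtain ⟨q, -, hr⟩ := (octagon_spec hh hhl k hk).2.1 p hp
    exact ⟨q, hr⟩

theorem finite_orbitIndex (hh : 0 < h) (hhl : h < l) : (orbitIndex l h).Finite := by
  have h₁ : (⋃ j ∈ Set.Icc 1 (2 * J l h), (fun t => (Sum.inl (j, t) : (ℕ × ℕ) ⊕ (ℕ × ℕ))) ''
      Set.Iic (word j).length).Finite :=
    (Set.finite_Icc _ _).biUnion fun j _ => (Set.finite_Iic _).image _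
  have h₂ : (⋃ k ∈ Set.Iio (J l h), (fun t => (Sum.inr (k, t) : (ℕ × ℕ) ⊕ (ℕ × ℕ))) ''
      Set.Iio (3 ^ k)).Finite :=
    (Set.finite_Iio _).biUnion fun j _ => (Set.finite_Iio _).image _
  refine (h₁.union h₂).subset ?_
  rintro (⟨j, t⟩ | ⟨k, t⟩) ha
  · obtain ⟨hj, ht⟩ := (mem_orbitIndex_inl hh hhl).1 ha
    exact Or.inl (Set.mem_biUnion hj ⟨t, ht, rfl⟩)
  · obtain ⟨hk, ht⟩ := mem_orbitIndex_inr.1 ha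
    exact Or.inr (Set.mem_biUnion (Set.mem_Iio.2 hk) ⟨t, ht, rfl⟩)

theorem orbitSet_subset (hh : 0 < h) (hhl : h < l) :
    orbitSet l h ⊆ ⋃ a ∈ orbitIndex l h, orbitTile l h a := by
  rintro _ (⟨j, hj, hj', t, ht, p, hp, rfl⟩ | ⟨k, hk, t, ht, p, hp, rfl⟩)
  · exact Set.mem_biUnion ((mem_orbitIndex_inl hh hhl).2 ⟨⟨hj, hj'⟩, ht⟩) ⟨p, hp, rfl⟩
  · exact Set.mem_biUnion (mem_orbitIndex_inr.2 ⟨hk, ht⟩) ⟨p, hp, rfl⟩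

/-- There are finitely many tiles, so the closure of their union is the union of their closures.
What they miss lies in finitely many boundaries of convex sets, which are null. -/
theorem volume_domain_diff (hh : 0 < h) (hhl : h < l) :
    MeasureTheory.volume (domain l h \ ⋃ a ∈ orbitIndex l h, orbitTile l h a) = 0 := by
  have hfin := finite_orbitIndex hh hhl
  have h₀ : MeasureTheory.volume (⋃ a ∈ orbitIndex l h, frontier (orbitTile l h a)) = 0 :=
    (MeasureTheory.measure_biUnion_null_iff hfin.countable).2 fun a ha =>
      (isPolygonal_orbitTile hh hhl a ha).volume_frontier
  refine MeasureTheory.measure_mono_null ?_ h₀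
  rintro p ⟨hp, hpn⟩
  have hcl : domain l h ⊆ closure (orbitSet l h) := by
    refine interior_subset.trans (closure_minimal ?_ isClosed_closure)
    rintro x ⟨S, hS, hx⟩
    simp only [Set.mem_insert_iff, Set.mem_singleton_iff] at hS
    rcases hS with rfl | rfl | rfl <;> exact atom_subset_closure hh hhl _ hx
  have hp' := closure_mono (orbitSet_subset hh hhl) (hcl hp)
  rw [hfin.closure_biUnion] at hp'
  obtain ⟨a, ha, hpa⟩ := Set.mem_iUnion₂.1 hp'
  refine Set.mem_biUnion ha ⟨hpa, fun hi => hpn (Set.mem_biUnion ha (interior_subset hi))⟩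

theorem octagon_orbit (hh : 0 < h) (hhl : h < l) {k : ℕ} (hk : k < J l h) :
    (octagon l h k).Nonempty ∧ (sigmaPow k).length = 3 ^ k ∧
      (∀ p ∈ octagon l h k, Follows l h (sigmaPow k) p) ∧
      (rho l h)^[3 ^ k] '' octagon l h k = octagon l h k ∧
      ∀ t, 0 < t → t < 3 ^ k → (rho l h)^[t] '' octagon l h k ≠ octagon l h k := by
  obtain ⟨h₁, h₂, h₃⟩ := octagon_spec hh hhl k hk
  refine ⟨h₁, length_sigmaPow k, fun p hp => ?_, ?_, fun t ht ht' e => ?_⟩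
  · obtain ⟨q, -, hr⟩ := h₂ p hp
    exact (reach_iff.1 hr).2.1
  · rw [← length_sigmaPow]
    refine Set.Subset.antisymm ?_ fun q hq => ?_
    · rintro _ ⟨p, hp, rfl⟩
      obtain ⟨q, hq, hr⟩ := h₂ p hp
      rwa [hr.eq_iterate]
    · obtain ⟨p, hp, hr⟩ := h₃ q hq
      exact ⟨p, hp, hr.eq_iterate⟩
  · obtain ⟨q, hq⟩ := h₁
    obtain ⟨p, hp, hpq⟩ := e.symm ▸ hq
    -- An earlier return would make phases t and 0 share a point.
    have := iterate_octagon_injective hh hhl hk hk ht' (s' := 0) (by positivity) hp hq hpq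
    omega

theorem visits_E (hh : 0 < h) (hhl : h < l) {j : ℕ} (hj : 1 ≤ j) (hj' : j ≤ 2 * J l h)
    {p : Plane} (hp : p ∈ E l h j) :
    visits l h 1 p = (word j).count 1 ∧ visits l h 3 p = (word j).count 3 := by
  obtain ⟨q, hq, hr⟩ := reach_of_mem_E hh hhl hj hj' hp
  have hp' := (transferTile_E hh hhl j hj hj').2.2.1 hp
  exact ⟨visits_eq (hh.trans hhl) hh hp' hr hq (Or.inl rfl),
    visits_eq (hh.trans hhl) hh hp' hr hq (Or.inr rfl)⟩

end

end Arrowhead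

theorem mainTheorem4 (l h : ℝ) (hl : 0 < l) (hh : 0 < h) (hhl : h < l) :
    -- (i) the transfer map tiles the entrance tile by `E₁, …, E_{2J}`
    (Set.InjOn (E l h) (Set.Icc 1 (2 * J l h)) ∧
      transferPartition l h = E l h '' Set.Icc 1 (2 * J l h) ∧
      tileSpan (E l h '' Set.Icc 1 (2 * J l h)) = entranceTile l h) ∧
    -- (ii) `ψ` is a reflection of every `E_j` about its symmetry axis, followed by the reflection
    -- about the symmetry axis of the arrowhead; it maps the entrance tile onto the exit tile
    (U (5 / 2) '' domain l h = domain l h ∧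
      (∀ j ∈ Set.Icc 1 (2 * J l h), ∃ (c : Plane) (n : ℤ),
        IsTileAxis (E l h j) c (n / 2) ∧
        ∀ p ∈ E l h j, psi l h p = U (5 / 2) (reflectAt c (n / 2) p)) ∧
      tileSpan ((fun j => psi l h '' E l h j) '' Set.Icc 1 (2 * J l h)) = exitTile l h) ∧
    -- (iii) incidence counts
    (∀ k ∈ Set.Icc 1 (J l h),
      (∀ p ∈ E l h (2 * k - 1),
        (visits l h 1 p : ℝ) = -1 / 2 - (-1) ^ k + 3 / 2 * 3 ^ k ∧
        (visits l h 3 p : ℝ) = -1 / 2 + (-1) ^ k + 1 / 2 * 3 ^ k) ∧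
      (∀ p ∈ E l h (2 * k),
        (visits l h 1 p : ℝ) = -1 / 2 - 1 / 4 * (-1) ^ k + 3 / 4 * 3 ^ k ∧
        (visits l h 3 p : ℝ) = -1 / 2 + 1 / 4 * (-1) ^ k + 1 / 4 * 3 ^ k)) ∧
    -- (iv) periodic octagons with path `σ^k(1)` and least period `3 ^ k`; complete tiling
    ((∀ k < J l h,
        (octagon l h k).Nonempty ∧
        (sigmaPow k).length = 3 ^ k ∧
        (∀ p ∈ octagon l h k, Follows l h (sigmaPow k) p) ∧
        (rho l h)^[3 ^ k] '' octagon l h k = octagon l h k ∧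
        ∀ t, 0 < t → t < 3 ^ k → (rho l h)^[t] '' octagon l h k ≠ octagon l h k) ∧
      (orbitIndex l h).PairwiseDisjoint (orbitTile l h) ∧
      (∀ a ∈ orbitIndex l h, orbitTile l h a ⊆ domain l h) ∧
      MeasureTheory.volume (domain l h \ ⋃ a ∈ orbitIndex l h, orbitTile l h a) = 0) := by
  refine ⟨⟨injOn_E hh hhl, transferPartition_eq hh hhl, tileSpan_E hh hhl⟩,
    ⟨image_U_domain hl hh hhl, fun j hj => psi_eq hh hhl hj, tileSpan_psi_E hh hhl⟩,
    fun k hk => ?_, fun k hk => octagon_orbit hh hhl hk, pairwiseDisjoint_orbitTile hh hhl,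
    orbitTile_subset_domain hh hhl, volume_domain_diff hh hhl⟩
  obtain ⟨i, rfl⟩ := Nat.exists_eq_add_of_le' hk.1
  have hk₂ := hk.2
  constructor
  · intro p hp
    rw [show 2 * (i + 1) - 1 = 2 * i + 1 by omega] at hp
    obtain ⟨v₁, v₃⟩ := visits_E hh hhl (by omega) (by omega) hp
    rw [v₁, v₃]
    exact count_word_odd i
  · intro p hp
    obtain ⟨v₁, v₃⟩ := visits_E hh hhl (by omega) (by omega) hp
    rw [v₁, v₃]
    exact count_word_even i
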